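/- Let $f:(\mathbb R^2,0)\to(\mathbb R,0)$ be a real analytic function germ that is mini-regular in $x$, i.e. $f(x,0)=ax^m+\cdots$ with $a\neq 0$, where $m$ is the multiplicity of $f$ at $0$. *Arcs.* An arc at $0$ in $\mathbb R^2$ (resp. $\mathbb C^2$) is the germ at $0$ of the image of a real analytic map germ $\vec\lambda:[0,\varepsilon)\to\mathbb R^2$ (resp. $\mathbb C^2$), $\vec\lambda(0)=0$, $\vec\lambda\not\equiv 0$. For arcs $\lambda\ne\mu$, the contact order $\mathcal O(\lambda,\mu)$ is the exponent $k$ in $\operatorname{dist}(P,\mu)=as^k+\cdots$, $a>0$, where $P\in\lambda$ and $s=|P|$; $\mathcal O(\lambda,\lambda)=\infty$. The height $h_f(\lambda)$ of an arc $\lambda$ in $\mathbb R^2$ is the maximum of $\mathcal O(\lambda,\zeta)$ over all arcs $\zeta$ in $\mathbb C^2$ on which the complexification of $f$ vanishes identically. Write $\lambda\sim_f\mu$ if $\lambda=\mu$ or $h_f(\lambda)=h_f(\mu)<\mathcal O(\lambda,\mu)$. The equivalence class $\lambda_f$ of $\lambda$ is called an $f$-arc; heights, and contact orders of distinct $f$-arcs,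 are those of representatives. *Bars.* Let $\mathbb R^{+}_{*/f}$ (resp. $\mathbb R^{-}_{*/f}$) be the set of $f$-arcs in $y>0$ (resp. $y<0$) that are not tangent to the $x$-axis. On each of these two sets, write $\lambda_f\simeq\mu_f$ if $\lambda_f=\mu_f$ or $h(\lambda_f)=h(\mu_f)=\mathcal O(\lambda_f,\mu_f)$. The equivalence classes are the $f$-bars, and $h(B)$ is the common height of the elements of a bar $B$. A bar has infinite height if and only if it is a singleton. If $h(B)<\infty$ (say $y>0$; for $y<0$ replace $y$ by $-y$), every arc of $B$ has an equation $x=\lambda_B(y)+uy^{h(B)}+\cdots$, a fractional power series, where $\lambda_B$ depends only on $B$ and has only exponents $<h(B)$, and where $u\in\mathbb R$, the canonical coordinate, depends only on the $f$-arc. There are a unique real polynomial $I^B_f$ and exponent $e$ such that $f(\lambda_B(y)+uy^{h(B)}+\cdots,y)=I^B_f(u)y^e+\cdots$ with $I^B_f(u)\ne0$ for all arcs of $B$. For an analytic germ $g$, a number $z\in\mathbb C$ is a $B$-root of $g$ if $g$ has a Newton–Puiseux root $\alpha(y)=\lambda_B(y)+zy^{h(B)}+\cdots$. The multiplicity $m(B)$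 of a singleton bar $B=\{\lambda_f\}$ is the order in $X$ of $f(X+\lambda(y),y)$. *Polar bars.* A bar $B$ is polar if either $h(B)<\infty$ and $I^B_f$ has at least two distinct complex roots, or $B$ is a singleton with $m(B)\ge2$. *Critical points.* The real critical points of $f_*$ are the following $f$-arcs. 1. The $f$-arcs in a bar $B$ with $h(B)<\infty$ whose canonical coordinate is a $B$-root of $f_x$. 2. The element of a singleton bar $B$ with $m(B)\ge 2$. 3. For each bar $B$ with $h(B)<\infty$ such that $f_x$ has a non-real $B$-root, but no $f$-arc in $B$ is of type 1: the $f$-arc of $x=\lambda_B(y)+r_By^{h(B)}$, where $r_B$ is a chosen generic real number, i.e. any real number that is not a $B$-root of $f$. **Statement.** For every choice of the generic numbers $r_B$, each real critical point of $f_*$ belongs to a polar bar, and each polar bar contains at least one real critical point of $f_*$. -/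

import Mathlib

open Filter Topology Asymptotics Polynomial
open scoped ENNReal NNReal

noncomputable section

namespace EnrichedLine

/-- The Euclidean plane `𝕜²`, for `𝕜 = ℝ` or `ℂ`, with coordinates `(x, y) = (P 0, P 1)`. -/
abbrev Plane (𝕜 : Type) [RCLike 𝕜] : Type := EuclideanSpace 𝕜 (Fin 2)

/-- The inclusion `ℝ² ⊆ ℂ²`. -/
def toComplexPlane (P : Plane ℝ) : Plane ℂ := !₂[((P 0 : ℝ) : ℂ), ((P 1 : ℝ) : ℂ)]

/-- A parametrized arc at `0`: a real analytic map germ `[0, ε) → 𝕜²` that maps `0` to `0` and is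
not identically `0`. -/
def IsArcParam {𝕜 : Type} [RCLike 𝕜] (γ : ℝ → Plane 𝕜) : Prop :=
  AnalyticAt ℝ γ 0 ∧ γ 0 = 0 ∧ ¬ ∀ᶠ s in 𝓝[≥] (0 : ℝ), γ s = 0

/-- A (geometric) arc at `0`: the germ at `0` of the image of a parametrized arc. The germ is
encoded by the filter of all sets that contain the image of some interval `[0, ε)`; two
parametrized arcs have the same image germ iff these filters coincide. -/
@[ext]
structure Arc (𝕜 : Type) [RCLike 𝕜] where
  germ : Filter (Plane 𝕜)
  exists_param : ∃ γ : ℝ → Plane 𝕜, IsArcParam γ ∧ germ = Filter.map γ (𝓝[≥] (0 : ℝ))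

/-- The contact order of two arcs (given by their germs): the order of vanishing of
`dist (P, μ)`, for `P ∈ lam`, with respect to `‖P‖`. It is `∞` if the arcs agree. (As
`T` runs through the members of the germ `μ`, it runs through representatives of `μ`, up to
passing to larger sets, which only makes the distance smaller.) -/
def contactOrder {𝕜 : Type} [RCLike 𝕜] (lam μ : Filter (Plane 𝕜)) : ℝ≥0∞ :=
  ⨆ (k : ℝ≥0) (_ : ∀ T ∈ μ,
    (fun P : Plane 𝕜 => Metric.infDist P T) =O[lam] (fun P : Plane 𝕜 => ‖P‖ ^ (k : ℝ))),
    (k : ℝ≥0∞)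

/-- `F` is (a representative of the germ at `0` of) the complexification of `f`. -/
def IsComplexification (f : Plane ℝ → ℝ) (F : Plane ℂ → ℂ) : Prop :=
  AnalyticAt ℂ F 0 ∧ ∀ᶠ P in 𝓝 (0 : Plane ℝ), F (toComplexPlane P) = (f P : ℂ)

/-- The set of arcs at `0` in `ℂ²` on which the complexification of `f` vanishes identically. -/
def complexZeroArcs (f : Plane ℝ → ℝ) : Set (Arc ℂ) :=
  {ζ | ∃ F, IsComplexification f F ∧ ∀ᶠ P in ζ.germ, F P = 0}

/-- The `f`-height of a real arc: its maximal contact order with the complex zero arcs of `f`. -/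
def arcHeight (f : Plane ℝ → ℝ) (lam : Arc ℝ) : ℝ≥0∞ :=
  ⨆ ζ ∈ complexZeroArcs f, contactOrder (lam.germ.map toComplexPlane) ζ.germ

/-- The equivalence relation whose classes are the `f`-arcs. -/
def FEquiv (f : Plane ℝ → ℝ) (lam μ : Arc ℝ) : Prop :=
  lam = μ ∨ (arcHeight f lam = arcHeight f μ ∧ arcHeight f μ < contactOrder lam.germ μ.germ)

/-- The `f`-truncated arcs (`f`-arcs): equivalence classes of real arcs. -/
def FArc (f : Plane ℝ → ℝ) : Type :=
  {a : Set (Arc ℝ) // ∃ lam : Arc ℝ, a = {μ | FEquiv f lam μ}}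

/-- The height of an `f`-arc (`arcHeight f` is constant on the class). -/
def FArc.height {f : Plane ℝ → ℝ} (a : FArc f) : ℝ≥0∞ := ⨆ lam ∈ a.1, arcHeight f lam

/-- The contact order of two `f`-arcs: `∞` if they agree, and otherwise the contact order of any
two representatives, which does not depend on their choice. -/
def FArc.contact {f : Plane ℝ → ℝ} (a b : FArc f) : ℝ≥0∞ :=
  ⨆ lam ∈ a.1, ⨆ μ ∈ b.1, contactOrder lam.germ μ.germ

/-- `f` is mini-regular in `x`: for some `m`, `f` has multiplicity at least `m` at `0`, and the
coefficient of `x ^ m` is non-zero. -/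
def MiniRegular (f : Plane ℝ → ℝ) : Prop :=
  ∃ m : ℕ, f =O[𝓝 0] (fun P => ‖P‖ ^ m) ∧ iteratedDeriv m (fun x : ℝ => f !₂[x, 0]) 0 ≠ 0

/-- A sign `±1`, as a real number. It distinguishes the half planes `y > 0` and `y < 0`. -/
def sgn (σ : ℤˣ) : ℝ := ((σ : ℤ) : ℝ)

/-- The arc lies in the half plane `σ y > 0`, and is not tangent to the `x`-axis. -/
def Arc.InHalf (σ : ℤˣ) (lam : Arc ℝ) : Prop :=
  (∀ᶠ P in lam.germ, P ≠ 0 → 0 < sgn σ * P 1) ∧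
    ¬ (fun P : Plane ℝ => P 1) =o[lam.germ] (fun P : Plane ℝ => P 0)

/-- The `f`-arc lies in the half plane `σ y > 0`, and is not tangent to the `x`-axis. -/
def FArc.InHalf {f : Plane ℝ → ℝ} (σ : ℤˣ) (a : FArc f) : Prop :=
  ∃ lam ∈ a.1, lam.InHalf σ

/-- Bar equivalence. -/
def BarEquiv {f : Plane ℝ → ℝ} (a b : FArc f) : Prop :=
  a = b ∨ (a.height = b.height ∧ b.height = a.contact b)

/-- The `f`-bars: the bar equivalence classes of `f`-arcs in one of the two half planes
`sign * y > 0`. -/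
structure FBar (f : Plane ℝ → ℝ) where
  sign : ℤˣ
  carrier : Set (FArc f)
  isClass : ∃ a : FArc f, a.InHalf sign ∧ carrier = {b | b.InHalf sign ∧ BarEquiv a b}

/-- The height of a bar (`FArc.height` is constant on the bar). -/
def FBar.height {f : Plane ℝ → ℝ} (B : FBar f) : ℝ≥0∞ := ⨆ a ∈ B.carrier, a.height

/-- `φ`, as a germ at `0` on `y ≥ 0`, is a convergent fractional power series
`c₀ + c₁ y ^ (1 / d) + c₂ y ^ (2 / d) + ⋯`. -/
def IsFractionalSeries {𝕜 : Type} [RCLike 𝕜] (φ : ℝ → 𝕜) : Prop :=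
  ∃ d : ℕ, 0 < d ∧ ∃ a : ℝ → 𝕜, AnalyticAt ℝ a 0 ∧ ∀ᶠ t in 𝓝[≥] (0 : ℝ), φ (t ^ d) = a t

/-- The arc `lam` in the half plane `σ y > 0` has the equation `x = φ (σ y)`, `σ y ≥ 0`, where `φ`
is a fractional power series. -/
def Represents (σ : ℤˣ) (lam : Arc ℝ) (φ : ℝ → ℝ) : Prop :=
  IsFractionalSeries φ ∧
    lam.germ = Filter.map (fun y : ℝ => (!₂[φ y, sgn σ * y] : Plane ℝ)) (𝓝[≥] (0 : ℝ))

/-- The finite fractional power series `∑ p_e y ^ e`. -/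
def fracEval (p : ℚ →₀ ℝ) (y : ℝ) : ℝ := p.sum fun e c => c * y ^ (e : ℝ)

/-- For `h(B) < ∞`: `x = p(y)` is the canonical representation `λ_B` of `B`, that is, `p` is what
remains of the series of an arc in `B` after deleting all terms `y ^ e` with `e ≥ h(B)`. -/
def IsCanonicalRep {f : Plane ℝ → ℝ} (B : FBar f) (p : ℚ →₀ ℝ) : Prop :=
  (∀ e ∈ p.support, (e : ℝ) < B.height.toReal) ∧
    ∀ a ∈ B.carrier, ∀ lam ∈ a.1, ∀ φ, Represents B.sign lam φ →
      (fun y => φ y - fracEval p y) =O[𝓝[>] (0 : ℝ)] (fun y => y ^ B.height.toReal)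

/-- For `h(B) < ∞`: the `f`-arc `a` has canonical coordinate `u` in `B`; its arcs have the form
`x = λ_B(y) + u y ^ h(B) + ⋯`. -/
def IsCanonicalCoord {f : Plane ℝ → ℝ} (B : FBar f) (a : FArc f) (u : ℝ) : Prop :=
  a ∈ B.carrier ∧ ∃ p, IsCanonicalRep B p ∧ ∃ lam ∈ a.1, ∃ φ, Represents B.sign lam φ ∧
    (fun y => φ y - (fracEval p y + u * y ^ B.height.toReal))
      =o[𝓝[>] (0 : ℝ)] (fun y => y ^ B.height.toReal)

/-- For `h(B) < ∞`: `I` is the polynomial `I^B_f` and `e` is the Lojasiewicz exponent of `f` on `B`: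
`f (λ_B(y) + u y ^ h(B) + ⋯, y) = I(u) y ^ e + ⋯` with `I(u) ≠ 0`, for all arcs in `B` (on
`y < 0`, with `y` replaced by `-y`). Since infinitely many `u` occur, `I` and `e` are unique. -/
def IsInitialForm {f : Plane ℝ → ℝ} (B : FBar f) (I : ℝ[X]) (e : ℝ) : Prop :=
  ∀ a ∈ B.carrier, ∀ u : ℝ, IsCanonicalCoord B a u →
    I.eval u ≠ 0 ∧ ∀ lam ∈ a.1, ∀ φ, Represents B.sign lam φ →
      (fun y : ℝ => f !₂[φ y, sgn B.sign * y] - I.eval u * y ^ e)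
        =o[𝓝[>] (0 : ℝ)] (fun y => y ^ e)

/-- For `h(B) < ∞`: `z` is a `B`-root of `g`, that is, `g` has a Newton-Puiseux root of the form
`α(y) = λ_B(y) + z y ^ h(B) + ⋯`. -/
def IsBRoot {f : Plane ℝ → ℝ} (g : Plane ℝ → ℝ) (B : FBar f) (z : ℂ) : Prop :=
  ∃ p, IsCanonicalRep B p ∧ ∃ α : ℝ → ℂ, IsFractionalSeries α ∧
    (∃ G, IsComplexification g G ∧
      ∀ᶠ y in 𝓝[≥] (0 : ℝ), G !₂[α y, ((sgn B.sign * y : ℝ) : ℂ)] = 0) ∧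
    (fun y : ℝ => α y - ((fracEval p y : ℝ) + z * ((y ^ B.height.toReal : ℝ) : ℂ)))
      =o[𝓝[>] (0 : ℝ)] (fun y : ℝ => y ^ B.height.toReal)

/-- The partial derivative `f_x`. -/
def partialX (f : Plane ℝ → ℝ) (P : Plane ℝ) : ℝ := deriv (fun x : ℝ => f !₂[x, P 1]) (P 0)

/-- The multiplicity of `lam` as a zero arc of `f`, that is, the order in `X` of
`f (X + lam(y), y)`: the least `k` such that the `k`-th partial derivative of `f` in `x` does not
vanish identically on `lam`. -/
def zeroMultiplicity (f : Plane ℝ → ℝ) (lam : Arc ℝ) : ℕ :=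
  sInf {k | ¬ ∀ᶠ P in lam.germ, iteratedDeriv k (fun x : ℝ => f !₂[x, P 1]) (P 0) = 0}

/-- `B = {c}` is a singleton, of multiplicity `m(B) ≥ 2`. -/
def IsMultipleSingleton {f : Plane ℝ → ℝ} (B : FBar f) (c : FArc f) : Prop :=
  B.carrier = {c} ∧ ∃ lam ∈ c.1, 2 ≤ zeroMultiplicity f lam

/-- `B` is a polar bar: `I^B_f` has at least two distinct complex roots, or `B` is a singleton with
`m(B) ≥ 2`. -/
def IsPolar {f : Plane ℝ → ℝ} (B : FBar f) : Prop :=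
  (B.height ≠ ⊤ ∧ ∃ I e, IsInitialForm B I e ∧
      ∃ z w : ℂ, z ≠ w ∧ Polynomial.aeval z I = 0 ∧ Polynomial.aeval w I = 0) ∨
    ∃ c, IsMultipleSingleton B c

/-- `c` is an `f`-arc in `B`, `h(B) < ∞`, whose canonical coordinate is a `B`-root of `f_x`. -/
def IsOrdinaryCritical {f : Plane ℝ → ℝ} (B : FBar f) (c : FArc f) : Prop :=
  B.height ≠ ⊤ ∧ ∃ u : ℝ, IsCanonicalCoord B c u ∧ IsBRoot (partialX f) B (u : ℂ)

/-- `h(B) < ∞`, `f_x` has a non-real `B`-root, but no real `B`-root in `B`. -/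
def NeedsGenericPoint {f : Plane ℝ → ℝ} (B : FBar f) : Prop :=
  B.height ≠ ⊤ ∧ (∃ z : ℂ, z.im ≠ 0 ∧ IsBRoot (partialX f) B z) ∧
    ¬ ∃ c ∈ B.carrier, IsOrdinaryCritical B c

/-- The numbers `r B` are generic: for each bar `B` in which a generic point has to be taken, `r B`
is not among the (finitely many) `B`-roots of `f`. -/
def IsGenericChoice (f : Plane ℝ → ℝ) (r : FBar f → ℝ) : Prop :=
  ∀ B : FBar f, NeedsGenericPoint B → ¬ IsBRoot f B ((r B : ℝ) : ℂ)

/-- `c` is the `f`-arc of the arc `x = λ_B(y) + r y ^ h(B)`. -/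
def IsPointOf {f : Plane ℝ → ℝ} (B : FBar f) (r : ℝ) (c : FArc f) : Prop :=
  ∃ p, IsCanonicalRep B p ∧ ∃ lam ∈ c.1,
    Represents B.sign lam (fun y => fracEval p y + r * y ^ B.height.toReal)

/-- The (real) critical points of `f_*`, with respect to a choice `r` of generic numbers. -/
def IsCriticalPoint {f : Plane ℝ → ℝ} (r : FBar f → ℝ) (c : FArc f) : Prop :=
  ∃ B : FBar f, IsOrdinaryCritical B c ∨ IsMultipleSingleton B c ∨
    (NeedsGenericPoint B ∧ IsPointOf B (r B) c)

end EnrichedLine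

end

/-! For a bar `B` of finite height `h`, everything is read off from one polynomial and its
derivative. Near `0` the complexification factors as `F = U * ∏ (x - α_i(y))` with Newton–Puiseux
roots `α_i` (`exists_puiseux_factorization`, packaged in `exists_isRootSystem`). Substituting `x =
λ_B(y) + u y^h`, each factor contributes either `u - z_i` or a constant, so the leading coefficient
is a polynomial `J(u)` whose zeros are exactly the `B`-roots of `f`
(`IsRootSystem.exists_initialForm`). It takes real values at real `u`, so it comes from a real
polynomial `I`.

Contact orders of graphs are orders of differences of series (`contactOrder_eq_fracOrd`), and the
height of an arc is its largest contact with some `α_i` (`arcHeight_eq`). Hence the arc with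
coefficient `u` has height exactly `h` iff `I(u) ≠ 0`: the real non-roots of `I` are the canonical
coordinates of the points of `B`. Since the height is attained by some `α_i`, `I` has a root and is
not constant. The limit defining `J` is locally uniform in `u`, so it may be differentiated, and the
`B`-roots of `f_x` are the zeros of `I'` (`IsComplexInitialForm.derivative_eq`). All of this is
collected in `exists_isBarForm`.

What remains is algebra. Counting multiplicities, a nonconstant `I` has two distinct complex roots
iff `I'` has a root at which `I` does not vanish (`exists_root_derivative_iff`). An ordinary
critical point has a coordinate that is such a root. A non-real root of `I'` either is such a root
or is a root of `I`, in which case its conjugate is a second one. Conversely, if `I` has two roots,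
a root of `I'` off the zeros of `I` gives an ordinary critical point when it is real; when it is not
real, the bar contains an ordinary critical point or its generic point is critical. Singleton bars
are covered by the definitions. -/

noncomputable section
-- Division of analytic germs of two variables by `x`.
namespace EnrichedLine

/-- The linear map `(x, y) ↦ (s x, y)`. -/
def scaleFst (s : ℝ) : ℂ × ℂ →L[ℂ] ℂ × ℂ :=
  (s : ℂ) • (ContinuousLinearMap.inl ℂ ℂ ℂ ∘L ContinuousLinearMap.fst ℂ ℂ ℂ) +
    ContinuousLinearMap.inr ℂ ℂ ℂ ∘L ContinuousLinearMap.snd ℂ ℂ ℂ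

theorem scaleFst_apply (s : ℝ) (v : ℂ × ℂ) : scaleFst s v = ((s : ℂ) * v.1, v.2) := by
  ext <;> simp [scaleFst]

theorem norm_scaleFst_le {s : ℝ} (hs : |s| ≤ 1) : ‖scaleFst s‖ ≤ 1 := by
  refine ContinuousLinearMap.opNorm_le_bound _ zero_le_one fun v => ?_
  rw [one_mul, scaleFst_apply, Prod.norm_def, Prod.norm_def]
  refine max_le_max ?_ le_rfl
  rw [norm_mul, Complex.norm_real]
  exact mul_le_of_le_one_left (norm_nonneg _) hs

theorem continuous_scaleFst : Continuous scaleFst := by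
  unfold scaleFst
  fun_prop

/-- The power series of `K` can be integrated term by term: precomposing with `scaleFst s`, `|s| ≤
1`, does not increase the norms of its terms, so the integrated series converges on the same ball
and dominated convergence identifies its sum. -/
theorem analyticAt_integral_scaleFst {K : ℂ × ℂ → ℂ} (hK : AnalyticAt ℂ K 0) :
    AnalyticAt ℂ (fun v => ∫ s in (0 : ℝ)..1, K (scaleFst s v)) 0 := by
  obtain ⟨p, r, hp⟩ := hK
  set P : ∀ n, ℝ → ContinuousMultilinearMap ℂ (fun _ : Fin n => ℂ × ℂ) ℂ :=
    fun n s => (p n).compContinuousLinearMap fun _ => scaleFst s with hP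
  have hPc : ∀ n, Continuous (P n) := fun n => by
    have := (ContinuousMultilinearMap.compContinuousLinearMapContinuousMultilinear ℂ
      (fun _ : Fin n => ℂ × ℂ) (fun _ : Fin n => ℂ × ℂ) ℂ).cont.comp
        (continuous_pi fun _ : Fin n => continuous_scaleFst)
    exact (ContinuousLinearMap.apply ℂ _ (p n)).continuous.comp this
  have hPn : ∀ n s, |s| ≤ 1 → ‖P n s‖ ≤ ‖p n‖ := fun n s hs => by
    refine ((p n).norm_compContinuousLinearMap_le _).trans ?_
    refine mul_le_of_le_one_right (norm_nonneg _) ?_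
    exact Finset.prod_le_one (fun _ _ => norm_nonneg _) fun _ _ => norm_scaleFst_le hs
  have habs : ∀ s ∈ Set.uIoc (0 : ℝ) 1, |s| ≤ 1 := fun s hs => by
    rw [Set.uIoc_of_le zero_le_one] at hs
    rw [abs_of_pos hs.1]; exact hs.2
  let q : FormalMultilinearSeries ℂ (ℂ × ℂ) ℂ := fun n => ∫ s in (0 : ℝ)..1, P n s
  have hq : ∀ n, ‖q n‖ ≤ ‖p n‖ := fun n => by
    have := intervalIntegral.norm_integral_le_of_norm_le_const
      (a := (0 : ℝ)) (b := 1) (f := P n) (C := ‖p n‖) fun s hs => hPn n s (habs s hs)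
    simpa using this
  refine ⟨q, r, ⟨?_, hp.r_pos, fun {y} hy => ?_⟩⟩
  · refine ENNReal.le_of_forall_nnreal_lt fun ρ hρ => ?_
    obtain ⟨C, -, hC⟩ := p.norm_mul_pow_le_of_lt_radius (hρ.trans_le hp.r_le)
    exact q.le_radius_of_bound C fun n =>
      (mul_le_mul_of_nonneg_right (hq n) (by positivity)).trans (hC n)
  · have hsm : Summable fun n => ‖p n‖ * ‖y‖ ^ n := by
      have := p.summable_norm_mul_pow (r := ‖y‖₊) (lt_of_lt_of_le (by
        simpa [enorm_eq_nnnorm] using hy) hp.r_le)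
      simpa using this
    have hterm : ∀ n, q n (fun _ => y) = ∫ s in (0 : ℝ)..1, P n s (fun _ => y) := fun n => by
      have := (ContinuousMultilinearMap.apply ℂ (fun _ : Fin n => ℂ × ℂ) ℂ
        (fun _ => y)).intervalIntegral_comp_comm
          ((hPc n).intervalIntegrable (μ := MeasureTheory.volume) 0 1)
      exact this.symm
    simp only [hterm, zero_add]
    refine intervalIntegral.hasSum_integral_of_dominated_convergence
      (fun n _ => ‖p n‖ * ‖y‖ ^ n) (fun n => ?_) (fun n => ?_) ?_ ?_ ?_
    · exact ((ContinuousMultilinearMap.apply ℂ (fun _ : Fin n => ℂ × ℂ) ℂ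
        (fun _ => y)).continuous.comp (hPc n)).aestronglyMeasurable
    · refine .of_forall fun s hs => ?_
      refine ((P n s).le_opNorm _).trans ?_
      simp only [Finset.prod_const, Finset.card_univ, Fintype.card_fin]
      exact mul_le_mul_of_nonneg_right (hPn n s (habs s hs)) (by positivity)
    · exact .of_forall fun _ _ => hsm
    · exact _root_.intervalIntegrable_const
    · refine .of_forall fun s hs => ?_
      have hmem : scaleFst s y ∈ Metric.eball (0 : ℂ × ℂ) r := by
        have h1 : ‖scaleFst s y‖ ≤ ‖y‖ := by
          simpa using (scaleFst s).le_of_opNorm_le (norm_scaleFst_le (habs s hs)) y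
        simp only [Metric.mem_eball, edist_zero_right] at hy ⊢
        refine lt_of_le_of_lt ?_ hy
        exact enorm_le_iff_norm_le.2 h1
      have := hp.hasSum hmem
      simpa [hP, ContinuousMultilinearMap.compContinuousLinearMap_apply] using this

/-- An analytic function of two variables that vanishes for `x = 0` is divisible by `x`. -/
theorem exists_eq_mul_of_apply_zero {G : ℂ × ℂ → ℂ} (hG : AnalyticAt ℂ G 0)
    (h0 : ∀ᶠ y in 𝓝 (0 : ℂ), G (0, y) = 0) :
    ∃ H : ℂ × ℂ → ℂ, AnalyticAt ℂ H 0 ∧ ∀ᶠ v in 𝓝 (0 : ℂ × ℂ), G v = v.1 * H v := by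
  -- Hadamard's formula: `G(x, y) - G(0, y) = x ∫₀¹ G_x(s x, y) ds`.
  set K : ℂ × ℂ → ℂ := fun v => fderiv ℂ G v (1, 0) with hKdef
  have hK : AnalyticAt ℂ K 0 := ((ContinuousLinearMap.apply ℂ ℂ ((1, 0) : ℂ × ℂ)).analyticAt _).comp hG.fderiv
  refine ⟨_, analyticAt_integral_scaleFst hK, ?_⟩
  obtain ⟨ε, hε, hball⟩ := Metric.eventually_nhds_iff_ball.1 hG.eventually_analyticAt
  have hsnd : ∀ᶠ v in 𝓝 (0 : ℂ × ℂ), G (0, v.2) = 0 :=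
    (continuous_snd.tendsto (0 : ℂ × ℂ)).eventually h0
  filter_upwards [hsnd, Metric.ball_mem_nhds _ hε] with v hv hvε
  have hin : ∀ s ∈ Set.uIcc (0 : ℝ) 1, AnalyticAt ℂ G (scaleFst s v) := fun s hs => by
    rw [Set.uIcc_of_le zero_le_one] at hs
    refine hball _ ?_
    rw [mem_ball_zero_iff] at hvε ⊢
    refine lt_of_le_of_lt ?_ hvε
    simpa using (scaleFst s).le_of_opNorm_le
      (norm_scaleFst_le (by rw [abs_of_nonneg hs.1]; exact hs.2)) v
  have hline : ∀ s : ℝ, HasDerivAt (fun s : ℝ => scaleFst s v) (v.1, 0) s := fun s => by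
    have h1 : HasDerivAt (fun s : ℝ => (s : ℂ) * v.1) (1 * v.1) s :=
      (Complex.ofRealCLM.hasDerivAt (x := s)).mul_const v.1
    rw [one_mul] at h1
    simp only [scaleFst_apply]
    exact h1.prodMk (hasDerivAt_const s v.2)
  have hderiv : ∀ s ∈ Set.uIcc (0 : ℝ) 1,
      HasDerivAt (fun s : ℝ => G (scaleFst s v)) (v.1 * K (scaleFst s v)) s := fun s hs => by
    have h1 := ((hin s hs).differentiableAt.hasFDerivAt.restrictScalars ℝ).comp_hasDerivAt s
      (hline s)
    refine h1.congr_deriv ?_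
    have : ((v.1, 0) : ℂ × ℂ) = v.1 • ((1, 0) : ℂ × ℂ) := by simp
    rw [ContinuousLinearMap.coe_restrictScalars', this, map_smul, smul_eq_mul]
  have hcont : ContinuousOn (fun s : ℝ => v.1 * K (scaleFst s v)) (Set.uIcc 0 1) := fun s hs => by
    have : ContinuousAt (fun s : ℝ => scaleFst s v) s := (hline s).continuousAt
    exact (continuousAt_const.mul (ContinuousAt.comp (f := fun s : ℝ => scaleFst s v) (g := K)
      ((ContinuousLinearMap.apply ℂ ℂ
        ((1, 0) : ℂ × ℂ)).continuous.continuousAt.comp (hin s hs).fderiv.continuousAt) this)).continuousWithinAt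
  have := intervalIntegral.integral_eq_sub_of_hasDerivAt hderiv hcont.intervalIntegrable
  rw [intervalIntegral.integral_const_mul] at this
  rw [this]
  simp [scaleFst_apply, hv]

end EnrichedLine
end

/-! ### Taylor expansion in `x`, and the implicit function theorem. -/

noncomputable section
namespace EnrichedLine

/-- Taylor expansion in `x` with analytic coefficients and an analytic remainder. -/
theorem exists_taylor {G : ℂ × ℂ → ℂ} (hG : AnalyticAt ℂ G 0) (n : ℕ) :
    ∃ (b : ℕ → ℂ → ℂ) (R : ℂ × ℂ → ℂ), (∀ k, AnalyticAt ℂ (b k) 0) ∧ AnalyticAt ℂ R 0 ∧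
      ∀ᶠ v in 𝓝 (0 : ℂ × ℂ), G v = ∑ k ∈ Finset.range n, b k v.2 * v.1 ^ k + v.1 ^ n * R v := by
  induction n with
  | zero => exact ⟨0, G, fun _ => analyticAt_const, hG, by simp⟩
  | succ n ih =>
    obtain ⟨b, R, hb, hR, h⟩ := ih
    -- The old remainder at `x = 0` becomes the coefficient of `x ^ n`; the difference `R(x, y) -
    -- R(0, y)` is divisible by `x`.
    have hc : AnalyticAt ℂ (fun y : ℂ => R (0, y)) 0 :=
      AnalyticAt.comp (g := R) (f := fun y : ℂ => ((0 : ℂ), y)) hR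
        (analyticAt_const.prod analyticAt_id)
    have hc2 : AnalyticAt ℂ (fun v : ℂ × ℂ => R (0, v.2)) 0 :=
      AnalyticAt.comp (g := fun y : ℂ => R (0, y)) (f := fun v : ℂ × ℂ => v.2) hc analyticAt_snd
    obtain ⟨H, hH, hHe⟩ := exists_eq_mul_of_apply_zero (hR.sub hc2) (by simp)
    refine ⟨fun k => if k = n then fun y => R (0, y) else b k, H, fun k => ?_, hH, ?_⟩
    · dsimp only
      split_ifs
      exacts [hc, hb k]
    · filter_upwards [h, hHe] with v hv hv2
      rw [hv, Finset.sum_range_succ]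
      · simp only [Pi.sub_apply] at hv2
        simp only [if_true]
        have : ∀ k ∈ Finset.range n, (if k = n then fun y => R (0, y) else b k) v.2 * v.1 ^ k =
            b k v.2 * v.1 ^ k := fun k hk => by rw [if_neg (Finset.mem_range.1 hk).ne]
        rw [Finset.sum_congr rfl this]
        linear_combination v.1 ^ n * hv2

/-- Each derivative of `x ^ n * r x` costs at most one power of `x`. At `x = 0` the remainder is
therefore invisible to derivatives of order below `n`, which is how Taylor coefficients are
identified below. -/
theorem iteratedDeriv_eq_polynomial_add {q : ℂ[X]} {r g : ℂ → ℂ} {n : ℕ} (hr : AnalyticAt ℂ r 0)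
    (hg : ∀ᶠ x in 𝓝 (0 : ℂ), g x = q.eval x + x ^ n * r x) {j : ℕ} (hj : j ≤ n) :
    ∃ s : ℂ → ℂ, AnalyticAt ℂ s 0 ∧
      ∀ᶠ x in 𝓝 (0 : ℂ), iteratedDeriv j g x = (derivative^[j] q).eval x + x ^ (n - j) * s x := by
  induction j with
  | zero => exact ⟨r, hr, by simpa using hg⟩
  | succ j ih =>
    obtain ⟨s, hs, h⟩ := ih (by omega)
    refine ⟨fun x => ((n - j : ℕ) : ℂ) * s x + x * deriv s x,
      (analyticAt_const.mul hs).add (analyticAt_id.mul hs.deriv), ?_⟩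
    filter_upwards [h.eventually_nhds, hs.eventually_analyticAt] with x hx hsx
    rw [iteratedDeriv_succ, Filter.EventuallyEq.deriv_eq hx]
    have h1 := ((derivative^[j] q).hasDerivAt x).add
      ((hasDerivAt_pow (n - j) x).mul hsx.differentiableAt.hasDerivAt)
    have h2 : (fun x => (derivative^[j] q).eval x + x ^ (n - j) * s x) =
      ((fun x => (derivative^[j] q).eval x) + (fun x => x ^ (n - j)) * s) := rfl
    rw [h2, h1.deriv, Function.iterate_succ_apply']
    obtain ⟨k, hk⟩ : ∃ k, n - j = k + 1 := ⟨n - j - 1, by omega⟩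
    have hk2 : n - (j + 1) = k := by omega
    rw [hk, hk2]
    simp only [Nat.add_sub_cancel]
    push_cast
    ring

theorem coeff_eq_iteratedDeriv {b : ℕ → ℂ} {r g : ℂ → ℂ} {n : ℕ} (hr : AnalyticAt ℂ r 0)
    (hg : ∀ᶠ x in 𝓝 (0 : ℂ), g x = ∑ k ∈ Finset.range n, b k * x ^ k + x ^ n * r x)
    {j : ℕ} (hj : j < n) : iteratedDeriv j g 0 = j.factorial * b j := by
  set q : ℂ[X] := ∑ k ∈ Finset.range n, C (b k) * X ^ k with hq
  have hcoeff : q.coeff j = b j := by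
    simp [hq, Polynomial.finsetSum_coeff, coeff_C_mul, coeff_X_pow, hj]
  obtain ⟨s, -, h⟩ := iteratedDeriv_eq_polynomial_add (q := q) hr
    (by simpa [hq, eval_finsetSum] using hg) hj.le
  rw [h.self_of_nhds, zero_pow (by omega), zero_mul, add_zero, ← coeff_zero_eq_eval_zero,
    coeff_iterate_derivative, zero_add, Nat.descFactorial_self, hcoeff, nsmul_eq_mul]

/-- Differentiation in `x` is `fderiv` applied to `(1, 0)`, which preserves analyticity in both
variables jointly. This makes the implicit function theorem applicable to higher `x`-derivatives. -/
theorem exists_analytic_iteratedDeriv_slice {G : ℂ × ℂ → ℂ} (hG : AnalyticAt ℂ G 0) (j : ℕ) :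
    ∃ E : ℂ × ℂ → ℂ, AnalyticAt ℂ E 0 ∧
      ∀ᶠ v in 𝓝 (0 : ℂ × ℂ), iteratedDeriv j (fun x => G (x, v.2)) v.1 = E v := by
  induction j with
  | zero => exact ⟨G, hG, by simp⟩
  | succ j ih =>
    obtain ⟨E, hE, h⟩ := ih
    refine ⟨fun v => fderiv ℂ E v (1, 0),
      ((ContinuousLinearMap.apply ℂ ℂ ((1, 0) : ℂ × ℂ)).analyticAt _).comp hE.fderiv, ?_⟩
    filter_upwards [h.eventually_nhds, hE.eventually_analyticAt] with v hv hEv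
    rw [iteratedDeriv_succ]
    have hline : HasDerivAt (fun x : ℂ => (x, v.2)) (1, 0) v.1 :=
      (hasDerivAt_id v.1).prodMk (hasDerivAt_const v.1 v.2)
    have h1 : ∀ᶠ x in 𝓝 v.1, iteratedDeriv j (fun x => G (x, v.2)) x = E (x, v.2) := by
      have : Tendsto (fun x : ℂ => (x, v.2)) (𝓝 v.1) (𝓝 v) := hline.continuousAt
      exact this.eventually hv
    rw [Filter.EventuallyEq.deriv_eq h1]
    exact (HasFDerivAt.comp_hasDerivAt v.1 (l := E) hEv.differentiableAt.hasFDerivAt hline).deriv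

theorem analyticAt_slice {G : ℂ × ℂ → ℂ} (hG : AnalyticAt ℂ G 0) :
    AnalyticAt ℂ (fun x : ℂ => G (x, 0)) 0 :=
  AnalyticAt.comp (g := G) (f := fun x : ℂ => (x, (0 : ℂ))) hG (analyticAt_id.prod analyticAt_const)

/-- The analytic implicit function theorem for `E (x, y) = 0`, solved for `x`. -/
theorem exists_implicit {E : ℂ × ℂ → ℂ} (hE : AnalyticAt ℂ E 0) (h0 : E 0 = 0)
    (hd : deriv (fun x : ℂ => E (x, 0)) 0 ≠ 0) :
    ∃ c : ℂ → ℂ, AnalyticAt ℂ c 0 ∧ c 0 = 0 ∧ ∀ᶠ y in 𝓝 (0 : ℂ), E (c y, y) = 0 := by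
  -- The implicit function solves for the second variable, hence the swap.
  set S : ℂ × ℂ → ℂ := fun v => E (v.2, v.1) with hS
  have hSa : AnalyticAt ℂ S 0 :=
    AnalyticAt.comp (g := E) (f := fun v : ℂ × ℂ => (v.2, v.1)) hE (analyticAt_snd.prod analyticAt_fst)
  have hcd : ContDiffAt ℂ ⊤ S (0 : ℂ × ℂ) := hSa.contDiffAt
  have hder : (fderiv ℂ S 0 ∘L .inr ℂ ℂ ℂ) 1 = deriv (fun x : ℂ => E (x, 0)) 0 := by
    have hline : HasDerivAt (fun x : ℂ => ((0 : ℂ), x)) (0, 1) 0 :=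
      (hasDerivAt_const 0 0).prodMk (hasDerivAt_id 0)
    exact (HasFDerivAt.comp_hasDerivAt (0 : ℂ) (l := S) (f := fun x : ℂ => ((0 : ℂ), x))
      hSa.differentiableAt.hasFDerivAt hline).deriv.symm
  have hinv : (fderiv ℂ S 0 ∘L .inr ℂ ℂ ℂ).IsInvertible := by
    refine ⟨ContinuousLinearEquiv.unitsEquivAut ℂ (Units.mk0 _ hd), ?_⟩
    ext
    simp [← hder]
  refine ⟨hcd.implicitFunction (by simp) hinv, ?_, ?_, ?_⟩
  · exact (hcd.contDiffAt_implicitFunction (by simp) hinv).analyticAt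
  · exact hcd.implicitFunction_apply_self (by simp) hinv
  · have := hcd.eventually_apply_implicitFunction (by simp) hinv
    rw [show S 0 = 0 from h0] at this
    exact this

end EnrichedLine
end

/-! ### Root multiplicities and the Newton polygon. -/

noncomputable section
namespace EnrichedLine

/-- A root of multiplicity `n` would give `Q = c (X - z) ^ n`. The missing coefficient of `X ^ (n -
1)` then forces `z = 0`, so all lower coefficients vanish, contrary to `hk`. This is what makes the
induction for Puiseux roots descend. -/
theorem exists_root_rootMultiplicity_lt {Q : ℂ[X]} {n : ℕ} (hQ : Q.natDegree = n)
    (h1 : Q.coeff (n - 1) = 0) (hk : ∃ k < n, Q.coeff k ≠ 0) :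
    ∃ z, Q.IsRoot z ∧ Q.rootMultiplicity z < n := by
  obtain ⟨k, hkn, hk⟩ := hk
  have hQ0 : Q ≠ 0 := fun h => hk (by simp [h])
  obtain ⟨z, hz⟩ := Complex.exists_root (f := Q) (by
    rw [← Polynomial.natDegree_pos_iff_degree_pos]; omega)
  refine ⟨z, hz, lt_of_not_ge fun hle => ?_⟩
  obtain ⟨q, hq⟩ := (le_rootMultiplicity_iff hQ0).1 hle
  have hq0 : q ≠ 0 := fun h => hQ0 (by rw [hq, h, mul_zero])
  have hdeg : q.natDegree = 0 := by
    have := congrArg natDegree hq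
    rw [natDegree_mul (pow_ne_zero _ (X_sub_C_ne_zero z)) hq0, natDegree_pow, natDegree_X_sub_C,
      hQ] at this
    omega
  rw [eq_C_of_natDegree_eq_zero hdeg] at hq hq0
  have hcoeff : ∀ j, Q.coeff j = (-z) ^ (n - j) * (n.choose j : ℂ) * q.coeff 0 := fun j => by
    rw [hq, coeff_mul_C, sub_eq_add_neg, ← C_neg, coeff_X_add_C_pow]
  have hc : q.coeff 0 ≠ 0 := fun h => hq0 (by rw [h, C_0])
  have hz0 : z = 0 := by
    rw [hcoeff, show n - (n - 1) = 1 by omega, pow_one] at h1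
    have hch : (n.choose (n - 1) : ℂ) ≠ 0 := by
      exact_mod_cast (Nat.choose_pos (Nat.sub_le n 1)).ne'
    simpa [hch, hc] using h1
  rw [hcoeff, hz0, neg_zero, zero_pow (by omega)] at hk
  simp at hk

theorem analyticOrderAt_eval_add {Q : ℂ[X]} (hQ : Q ≠ 0) (z : ℂ) :
    analyticOrderAt (fun x => Q.eval (z + x)) 0 = Q.rootMultiplicity z := by
  have han : ∀ q : ℂ[X], AnalyticAt ℂ (fun x => q.eval (z + x)) 0 := fun q =>
    AnalyticAt.comp (g := fun x => q.eval x) (f := fun x => z + x)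
      (AnalyticOnNhd.eval_polynomial q _ (Set.mem_univ _)) (analyticAt_const.add analyticAt_id)
  obtain ⟨q, hq, hqz⟩ := exists_eq_pow_rootMultiplicity_mul_and_not_dvd Q hQ z
  rw [(han Q).analyticOrderAt_eq_natCast]
  refine ⟨fun x => q.eval (z + x), han q, ?_, .of_forall fun x => ?_⟩
  · simpa [dvd_iff_isRoot] using hqz
  · conv_lhs => rw [hq]
    simp

/-- Newton polygon: the substitution `y = t ^ D`, `x = t ^ p z` makes the coefficients of
`∑ b k (y) x ^ k` divisible by `t ^ (p n)`, and not all quotients vanish at `t = 0`. -/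
theorem exists_newton_slope {n : ℕ} {b : ℕ → ℂ → ℂ} (hb : ∀ k, AnalyticAt ℂ (b k) 0)
    (hb0 : ∀ k < n, b k 0 = 0) (hne : ∃ k < n, ¬ ∀ᶠ y in 𝓝 (0 : ℂ), b k y = 0) :
    ∃ D > 0, ∃ p > 0, ∃ c : ℕ → ℂ → ℂ, (∀ k, AnalyticAt ℂ (c k) 0) ∧
      (∀ k < n, ∀ᶠ t in 𝓝 (0 : ℂ), b k (t ^ D) = t ^ (p * (n - k)) * c k t) ∧
      (∀ k < n, (∀ᶠ y in 𝓝 (0 : ℂ), b k y = 0) → c k 0 = 0) ∧ ∃ k < n, c k 0 ≠ 0 := by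
  classical
  choose! o g hg hg0 hbg using fun k (h : ¬ ∀ᶠ y in 𝓝 (0 : ℂ), b k y = 0) =>
    (hb k).exists_eventuallyEq_pow_smul_nonzero_iff.2 h
  -- `n!` clears the denominators of all the slopes `o k / (n - k)` at once.
  set D := n.factorial
  have hD : 0 < D := n.factorial_pos
  have hdvd : ∀ k < n, (n - k) * (D / (n - k)) = D := fun k hk =>
    Nat.mul_div_cancel' (Nat.dvd_factorial (by omega) (by omega))
  have hdiv : ∀ k < n, 0 < D / (n - k) := fun k hk =>
    Nat.pos_of_ne_zero fun h => by have := hdvd k hk; rw [h] at this; omega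
  set S := (Finset.range n).filter fun k => ¬ ∀ᶠ y in 𝓝 (0 : ℂ), b k y = 0 with hS
  have hSne : S.Nonempty := by
    obtain ⟨k, hk, h⟩ := hne
    exact ⟨k, by simp only [hS, Finset.mem_filter, Finset.mem_range]; exact ⟨hk, h⟩⟩
  -- The smallest slope, scaled by `D`, will be `p`. Minimality gives `p * (n - k) ≤ D * o k`, with
  -- equality at `k₀`, whose quotient therefore survives at `t = 0`.
  obtain ⟨k₀, hk₀, hmin⟩ := S.exists_min_image (fun k => D / (n - k) * o k) hSne
  have hSmem : ∀ {k}, k ∈ S ↔ k < n ∧ ¬ ∀ᶠ y in 𝓝 (0 : ℂ), b k y = 0 := by simp [hS]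
  have ho : ∀ k ∈ S, 0 < o k := fun k hk => by
    obtain ⟨hkn, hk⟩ := hSmem.1 hk
    refine Nat.pos_of_ne_zero fun h => hg0 k hk ?_
    have := (hbg k hk).self_of_nhds
    rw [hb0 k hkn, h] at this
    simpa using this.symm
  set p := D / (n - k₀) * o k₀
  have hle : ∀ k ∈ S, p * (n - k) ≤ D * o k := fun k hk => by
    calc p * (n - k) ≤ D / (n - k) * o k * (n - k) := Nat.mul_le_mul_right _ (hmin k hk)
      _ = D * o k := by
        conv_rhs => rw [← hdvd k (hSmem.1 hk).1]
        ring
  have hpow : Tendsto (fun t : ℂ => t ^ D) (𝓝 0) (𝓝 0) :=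
    (continuous_pow D).tendsto' _ _ (zero_pow hD.ne')
  refine ⟨D, hD, p, Nat.mul_pos (hdiv _ (hSmem.1 hk₀).1) (ho _ hk₀),
    fun k t => if k ∈ S then t ^ (D * o k - p * (n - k)) * g k (t ^ D) else 0, fun k => ?_,
    fun k hk => ?_, fun k _ h => ?_, k₀, (hSmem.1 hk₀).1, ?_⟩
  · by_cases hk : k ∈ S
    · simp only [hk, if_true]
      refine (analyticAt_id.pow _).mul (AnalyticAt.comp (g := g k) (f := fun t : ℂ => t ^ D) ?_
        (analyticAt_id.pow _))
      simpa [hD.ne'] using hg k (hSmem.1 hk).2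
    · simp only [hk, if_false]
      exact analyticAt_const
  · by_cases hkS : k ∈ S
    · filter_upwards [hpow.eventually (hbg k (hSmem.1 hkS).2)] with t ht
      rw [ht, if_pos hkS, ← mul_assoc, ← pow_add, Nat.add_sub_cancel' (hle k hkS), sub_zero,
        smul_eq_mul, pow_mul]
    · have : ∀ᶠ y in 𝓝 (0 : ℂ), b k y = 0 := by
        by_contra h
        exact hkS (hSmem.2 ⟨hk, h⟩)
      filter_upwards [hpow.eventually this] with t ht
      simp [ht, hkS]
  · have : k ∉ S := fun hk => (hSmem.1 hk).2 h
    simp [this]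
  · have : D * o k₀ - p * (n - k₀) = 0 := by
      have : p * (n - k₀) = D * o k₀ := by
        conv_rhs => rw [← hdvd k₀ (hSmem.1 hk₀).1]
        simp only [p]; ring
      omega
    simp only [hk₀, if_true, this, pow_zero, one_mul, zero_pow hD.ne']
    exact hg0 k₀ (hSmem.1 hk₀).2

end EnrichedLine
end

/-! ### The Newton–Puiseux theorem. -/

noncomputable section
namespace EnrichedLine

/-- The Tschirnhaus shift: after a translation in `x`, the Taylor coefficient of `x ^ (n - 1)`
vanishes. -/
theorem exists_tschirnhaus {G : ℂ × ℂ → ℂ} (hG : AnalyticAt ℂ G 0) {n : ℕ} (hn : n ≠ 0)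
    (ho : analyticOrderAt (fun x : ℂ => G (x, 0)) 0 = n) :
    ∃ (c : ℂ → ℂ) (b : ℕ → ℂ → ℂ) (R : ℂ × ℂ → ℂ), AnalyticAt ℂ c 0 ∧ c 0 = 0 ∧
      (∀ k, AnalyticAt ℂ (b k) 0) ∧ AnalyticAt ℂ R 0 ∧ R 0 ≠ 0 ∧ (∀ k < n, b k 0 = 0) ∧
      (∀ᶠ y in 𝓝 (0 : ℂ), b (n - 1) y = 0) ∧
      ∀ᶠ v in 𝓝 (0 : ℂ × ℂ),
        G (v.1 + c v.2, v.2) = ∑ k ∈ Finset.range n, b k v.2 * v.1 ^ k + v.1 ^ n * R v := by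
  have hsl := (analyticAt_slice hG)
  obtain ⟨hlow, hnz⟩ := (analyticOrderAt_eq_nat_iff_iteratedDeriv_eq_zero hsl).1 ho
  -- The `(n - 1)`-st `x`-derivative has a simple zero in `x` at the origin, so its zero set is a
  -- graph `x = c(y)`; translating by `c` kills the coefficient of `x ^ (n - 1)`.
  obtain ⟨E, hE, hEe⟩ := exists_analytic_iteratedDeriv_slice hG (n - 1)
  have hEx : ∀ᶠ x in 𝓝 (0 : ℂ), iteratedDeriv (n - 1) (fun x => G (x, 0)) x = E (x, 0) := by
    have : Tendsto (fun x : ℂ => (x, (0 : ℂ))) (𝓝 0) (𝓝 0) :=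
      Continuous.tendsto' (by fun_prop) _ _ rfl
    exact this.eventually hEe
  obtain ⟨c, hc, hc0, hce⟩ := exists_implicit hE
    (hEx.self_of_nhds.symm.trans (hlow _ (by omega))) (by
      rw [← Filter.EventuallyEq.deriv_eq hEx, ← iteratedDeriv_succ, Nat.sub_add_cancel (by omega)]
      exact hnz)
  have hshift : AnalyticAt ℂ (fun v : ℂ × ℂ => (v.1 + c v.2, v.2)) 0 :=
    (analyticAt_fst.add (AnalyticAt.comp (g := c) (f := fun v : ℂ × ℂ => v.2) hc
      analyticAt_snd)).prod analyticAt_snd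
  have hG' : AnalyticAt ℂ (fun v : ℂ × ℂ => G (v.1 + c v.2, v.2)) 0 :=
    AnalyticAt.comp (g := G) (f := fun v : ℂ × ℂ => (v.1 + c v.2, v.2))
      (by simpa [hc0, Prod.mk_zero_zero] using hG) hshift
  obtain ⟨b, R, hb, hR, h⟩ := exists_taylor hG' n
  have hy0 : ∀ᶠ x in 𝓝 (0 : ℂ),
      G (x, 0) = ∑ k ∈ Finset.range n, b k 0 * x ^ k + x ^ n * R (x, 0) := by
    have : Tendsto (fun x : ℂ => (x, (0 : ℂ))) (𝓝 0) (𝓝 0) :=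
      Continuous.tendsto' (by fun_prop) _ _ rfl
    simpa [hc0] using this.eventually h
  have hb0 : ∀ k < n, b k 0 = 0 := fun k hk => by
    have := coeff_eq_iteratedDeriv (analyticAt_slice hR) hy0 hk
    rw [hlow k hk] at this
    simpa [Nat.factorial_ne_zero] using this.symm
  refine ⟨c, b, R, hc, hc0, hb, hR, fun hR0 => ?_, hb0, ?_, h⟩
  -- If `R 0` vanished, the order of the slice `G(x, 0) = x ^ n R(x, 0)` would exceed `n`.
  · have hxn : (fun x : ℂ => G (x, 0)) =ᶠ[𝓝 0] id ^ n * fun x => R (x, 0) := by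
      filter_upwards [hy0] with x hx
      rw [hx, Finset.sum_eq_zero fun k hk => by rw [hb0 k (Finset.mem_range.1 hk), zero_mul]]
      simp
    rw [analyticOrderAt_congr hxn, analyticOrderAt_mul (analyticAt_id.pow n) (analyticAt_slice hR),
      analyticOrderAt_pow analyticAt_id,
      analyticOrderAt_id] at ho
    have h1 : analyticOrderAt (fun x : ℂ => R (x, 0)) 0 ≠ 0 :=
      (analyticAt_slice hR).analyticOrderAt_ne_zero.2 hR0
    have h2 : analyticOrderAt (fun x : ℂ => R (x, 0)) 0 = 0 := by
      simp only [nsmul_eq_mul, mul_one] at ho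
      exact ENat.add_right_injective_of_ne_top (ENat.natCast_ne_top n) (ho.trans (add_zero _).symm)
    exact h1 h2
  · have hcurry : ∀ᶠ y in 𝓝 (0 : ℂ), ∀ᶠ x in 𝓝 (0 : ℂ),
        G (x + c y, y) = ∑ k ∈ Finset.range n, b k y * x ^ k + x ^ n * R (x, y) := by
      have := h
      rw [← Prod.mk_zero_zero, nhds_prod_eq] at this
      exact (eventually_swap_iff.1 this).curry
    have hin : Tendsto (fun y : ℂ => ((0 : ℂ), y)) (𝓝 0) (𝓝 0) :=
      Continuous.tendsto' (by fun_prop) _ _ rfl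
    have hcy : Tendsto (fun y : ℂ => (c y, y)) (𝓝 0) (𝓝 0) := by
      have := hc.continuousAt.prodMk continuousAt_id
      simpa [ContinuousAt, hc0, Prod.mk_zero_zero] using this
    filter_upwards [hcurry, hin.eventually hR.eventually_analyticAt, hcy.eventually hEe, hce]
      with y hy hRy hEy hcy0
    have hRs : AnalyticAt ℂ (fun x => R (x, y)) 0 :=
      AnalyticAt.comp (g := R) (f := fun x : ℂ => (x, y)) hRy
        (analyticAt_id.prod analyticAt_const)
    have h1 := coeff_eq_iteratedDeriv (j := n - 1) hRs hy (by omega)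
    rw [iteratedDeriv_comp_add_const (n - 1) (fun x => G (x, y)) (c y)] at h1
    simp only [zero_add] at h1
    rw [hEy, hcy0] at h1
    simpa [Nat.factorial_ne_zero] using h1.symm

/-- The Newton–Puiseux theorem: existence of a root. -/
theorem exists_puiseux_root {G : ℂ × ℂ → ℂ} (hG : AnalyticAt ℂ G 0) {n : ℕ} (hn : n ≠ 0)
    (ho : analyticOrderAt (fun x : ℂ => G (x, 0)) 0 = n) :
    ∃ d > 0, ∃ a : ℂ → ℂ, AnalyticAt ℂ a 0 ∧ a 0 = 0 ∧ ∀ᶠ t in 𝓝 (0 : ℂ), G (a t, t ^ d) = 0 := by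
  induction n using Nat.strong_induction_on generalizing G with
  | _ n ih =>
  obtain ⟨c, b, R, hc, hc0, hb, hR, hR0, hb0, hbn, h⟩ := exists_tschirnhaus hG hn ho
  -- A root of the translated germ becomes a root of `G` on adding `c (t ^ d)`.
  suffices hs : ∃ d > 0, ∃ a : ℂ → ℂ, AnalyticAt ℂ a 0 ∧ a 0 = 0 ∧ ∀ᶠ t in 𝓝 (0 : ℂ),
      ∑ k ∈ Finset.range n, b k (t ^ d) * a t ^ k + a t ^ n * R (a t, t ^ d) = 0 by
    obtain ⟨d, hd, a, ha, ha0, hae⟩ := hs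
    have hpow : AnalyticAt ℂ (fun t : ℂ => t ^ d) 0 := analyticAt_id.pow d
    refine ⟨d, hd, fun t => a t + c (t ^ d), ha.add (AnalyticAt.comp (g := c)
      (f := fun t : ℂ => t ^ d) (by simpa [hd.ne'] using hc) hpow), by simp [ha0, hd.ne', hc0], ?_⟩
    have ht : Tendsto (fun t : ℂ => (a t, t ^ d)) (𝓝 0) (𝓝 0) := by
      have := ha.continuousAt.prodMk hpow.continuousAt
      simpa [ContinuousAt, ha0, hd.ne', Prod.mk_zero_zero] using this
    filter_upwards [hae, ht.eventually h] with t h1 h2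
    exact h2.trans h1
  by_cases hall : ∀ k < n, ∀ᶠ y in 𝓝 (0 : ℂ), b k y = 0
  · refine ⟨1, one_pos, fun _ => 0, analyticAt_const, rfl, ?_⟩
    have := (Filter.eventually_all_finset (Finset.range n)).2 fun k hk =>
      hall k (Finset.mem_range.1 hk)
    filter_upwards [this] with t ht
    rw [Finset.sum_eq_zero fun k hk => by rw [pow_one, ht k hk, zero_mul], zero_pow hn]
    simp
  push Not at hall
  obtain ⟨D, hD, p, hp, g, hg, hbg, hgz, hgnz⟩ := exists_newton_slope hb hb0
    (by simpa [not_eventually] using hall)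
  -- The polynomial of the chosen edge of the Newton polygon; its zeros are the possible leading
  -- coefficients of roots.
  set Q : ℂ[X] := ∑ k ∈ Finset.range n, C (g k 0) * X ^ k + C (R 0) * X ^ n with hQ
  have hcoeff : ∀ j < n, Q.coeff j = g j 0 := fun j hj => by
    simp [hQ, Polynomial.finsetSum_coeff, coeff_C_mul, coeff_X_pow, hj, hj.ne]
  have hcoeffn : Q.coeff n = R 0 := by
    simp [hQ, Polynomial.finsetSum_coeff, coeff_C_mul, coeff_X_pow]
  have hdeg : Q.natDegree = n := by
    refine natDegree_eq_of_le_of_coeff_ne_zero ?_ (hcoeffn ▸ hR0)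
    refine natDegree_add_le_of_degree_le (natDegree_sum_le_of_forall_le _ _ fun k hk => ?_)
      (natDegree_C_mul_X_pow_le _ _)
    exact (natDegree_C_mul_X_pow_le _ _).trans (Finset.mem_range.1 hk).le
  obtain ⟨z, hz, hzn⟩ := exists_root_rootMultiplicity_lt hdeg
    (by rw [hcoeff _ (by omega)]; exact hgz _ (by omega) hbn)
    (by obtain ⟨k, hk, h⟩ := hgnz; exact ⟨k, hk, by rwa [hcoeff k hk]⟩)
  have hQ0 : Q ≠ 0 := fun h => hR0 (by rw [← hcoeffn, h, coeff_zero])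
  -- The germ after `y = t ^ D`, `x = t ^ p (z + x')`, divided by `t ^ (p n)`. Its slice at `t = 0`
  -- is `Q(z + x')`, whose order is the multiplicity of `z`, smaller than `n`.
  set G₁ : ℂ × ℂ → ℂ := fun v => ∑ k ∈ Finset.range n, g k v.2 * (z + v.1) ^ k +
    (z + v.1) ^ n * R (v.2 ^ p * (z + v.1), v.2 ^ D) with hG₁
  have hz1 : AnalyticAt ℂ (fun v : ℂ × ℂ => z + v.1) 0 := analyticAt_const.add analyticAt_fst
  have hG₁a : AnalyticAt ℂ G₁ 0 := by
    refine AnalyticAt.add (Finset.analyticAt_fun_sum _ fun k _ => ?_) ((hz1.pow n).mul ?_)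
    · exact (AnalyticAt.comp (g := g k) (f := fun v : ℂ × ℂ => v.2) (hg k) analyticAt_snd).mul
        (hz1.pow k)
    · refine AnalyticAt.comp (g := R) (f := fun v : ℂ × ℂ => (v.2 ^ p * (z + v.1), v.2 ^ D)) ?_
        (((analyticAt_snd.pow p).mul hz1).prod (analyticAt_snd.pow D))
      simpa only [Prod.snd_zero, Prod.fst_zero, zero_pow hp.ne', zero_pow hD.ne', zero_mul,
        Prod.mk_zero_zero] using hR
  have hsl : (fun x : ℂ => G₁ (x, 0)) = fun x => Q.eval (z + x) := by
    ext x
    simp only [hG₁, hQ, eval_add, eval_finsetSum, eval_mul, eval_C, eval_pow, eval_X,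
      zero_pow hp.ne', zero_pow hD.ne', zero_mul, Prod.mk_zero_zero]
    ring
  obtain ⟨d, hd, a, ha, ha0, hae⟩ := ih _ hzn (G := G₁)
    hG₁a ((rootMultiplicity_pos hQ0).2 hz).ne' (by rw [hsl]; exact analyticOrderAt_eval_add hQ0 z)
  refine ⟨d * D, Nat.mul_pos hd hD, fun t => (t ^ d) ^ p * (z + a t),
    ((analyticAt_id.pow d).pow p).mul (analyticAt_const.add ha), by simp [hd.ne', hp.ne'], ?_⟩
  have hpow : Tendsto (fun t : ℂ => t ^ d) (𝓝 0) (𝓝 0) :=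
    (continuous_pow d).tendsto' _ _ (zero_pow hd.ne')
  have hall := (Filter.eventually_all_finset (Finset.range n)).2 fun k hk =>
    hpow.eventually (hbg k (Finset.mem_range.1 hk))
  filter_upwards [hae, hall] with t h1 h2
  have h3 : ∀ k ∈ Finset.range n, b k (t ^ (d * D)) * ((t ^ d) ^ p * (z + a t)) ^ k =
      (t ^ d) ^ (p * n) * (g k (t ^ d) * (z + a t) ^ k) := fun k hk => by
    have hk' := Finset.mem_range.1 hk
    have : p * n = p * (n - k) + p * k := by rw [← mul_add, Nat.sub_add_cancel hk'.le]
    rw [pow_mul, h2 k hk, this, pow_add, mul_pow, ← pow_mul]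
    ring
  rw [Finset.sum_congr rfl h3, ← Finset.mul_sum, mul_pow, ← pow_mul (t ^ d) p n, pow_mul t d D, mul_assoc,
    ← mul_add]
  simp only [hG₁] at h1
  rw [h1, mul_zero]

/-- The Newton–Puiseux factorization. -/
theorem exists_puiseux_factorization {G : ℂ × ℂ → ℂ} (hG : AnalyticAt ℂ G 0) {n : ℕ}
    (ho : analyticOrderAt (fun x : ℂ => G (x, 0)) 0 = n) :
    ∃ d > 0, ∃ (a : Fin n → ℂ → ℂ) (U : ℂ × ℂ → ℂ), (∀ i, AnalyticAt ℂ (a i) 0) ∧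
      (∀ i, a i 0 = 0) ∧ AnalyticAt ℂ U 0 ∧ U 0 ≠ 0 ∧
      ∀ᶠ v in 𝓝 (0 : ℂ × ℂ), G (v.1, v.2 ^ d) = U v * ∏ i, (v.1 - a i v.2) := by
  induction n generalizing G with
  | zero =>
    refine ⟨1, one_pos, fun _ _ => 0, G, fun _ => analyticAt_const, fun _ => rfl, hG, ?_, by simp⟩
    exact ((analyticAt_slice hG).analyticOrderAt_eq_zero).1 (by simpa using ho)
  | succ n ih =>
    obtain ⟨d, hd, a, ha, ha0, hae⟩ := exists_puiseux_root hG n.succ_ne_zero ho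
    have ha2 : AnalyticAt ℂ (fun v : ℂ × ℂ => a v.2) 0 :=
      AnalyticAt.comp (g := a) (f := fun v : ℂ × ℂ => v.2) ha analyticAt_snd
    have hG' : AnalyticAt ℂ (fun v : ℂ × ℂ => G (v.1 + a v.2, v.2 ^ d)) 0 :=
      AnalyticAt.comp (g := G) (f := fun v : ℂ × ℂ => (v.1 + a v.2, v.2 ^ d))
        (by simpa [ha0, hd.ne', Prod.mk_zero_zero] using hG) ((analyticAt_fst.add ha2).prod (analyticAt_snd.pow d))
    -- Translating the root to `x = 0` turns splitting off a linear factor into division by `x`.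
    obtain ⟨H, hH, hHe⟩ := exists_eq_mul_of_apply_zero hG' (by simpa using hae)
    have hsub : AnalyticAt ℂ (fun v : ℂ × ℂ => (v.1 - a v.2, v.2)) 0 :=
      (analyticAt_fst.sub ha2).prod analyticAt_snd
    have hsub0 : Tendsto (fun v : ℂ × ℂ => (v.1 - a v.2, v.2)) (𝓝 0) (𝓝 0) := by
      simpa [ContinuousAt, ha0, Prod.mk_zero_zero] using hsub.continuousAt
    have hK : AnalyticAt ℂ (fun v : ℂ × ℂ => H (v.1 - a v.2, v.2)) 0 :=
      AnalyticAt.comp (g := H) (f := fun v : ℂ × ℂ => (v.1 - a v.2, v.2))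
        (by simpa [ha0, Prod.mk_zero_zero] using hH) hsub
    have hGK : ∀ᶠ v in 𝓝 (0 : ℂ × ℂ),
        G (v.1, v.2 ^ d) = (v.1 - a v.2) * H (v.1 - a v.2, v.2) := by
      filter_upwards [hsub0.eventually hHe] with v hv
      simpa using hv
    have hoK : analyticOrderAt (fun x : ℂ => H (x - a 0, 0)) 0 = n := by
      have h1 : (fun x : ℂ => G (x, 0)) =ᶠ[𝓝 0] id * fun x => H (x - a 0, 0) := by
        have : Tendsto (fun x : ℂ => (x, (0 : ℂ))) (𝓝 0) (𝓝 0) :=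
          Continuous.tendsto' (by fun_prop) _ _ rfl
        filter_upwards [this.eventually hGK] with x hx
        simpa [hd.ne', ha0] using hx
      rw [analyticOrderAt_congr h1, analyticOrderAt_mul analyticAt_id (analyticAt_slice hK),
        analyticOrderAt_id] at ho
      refine ENat.add_right_injective_of_ne_top (ENat.natCast_ne_top 1) ?_
      simpa [add_comm] using ho
    obtain ⟨d', hd', as, U, has, has0, hU, hU0, hUe⟩ := ih hK hoK
    have hpow : AnalyticAt ℂ (fun t : ℂ => t ^ d') 0 := analyticAt_id.pow d'
    -- The cofactor needs a further ramification `t ^ d'`; the first root is rewritten in the new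
    -- parameter.
    refine ⟨d' * d, Nat.mul_pos hd' hd, Fin.cons (fun t => a (t ^ d')) as, U, ?_, ?_, hU, hU0, ?_⟩
    · refine Fin.cases ?_ has
      exact AnalyticAt.comp (g := a) (f := fun t : ℂ => t ^ d') (by simpa [hd'.ne'] using ha) hpow
    · refine Fin.cases ?_ has0
      simp [hd'.ne', ha0]
    · have : Tendsto (fun v : ℂ × ℂ => (v.1, v.2 ^ d')) (𝓝 0) (𝓝 0) :=
        Continuous.tendsto' (by fun_prop) _ _ (by simp [hd'.ne'])
      filter_upwards [hUe, this.eventually hGK] with v h1 h2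
      rw [pow_mul, Fin.prod_univ_succ]
      simp only [Fin.cons_zero, Fin.cons_succ]
      rw [h2, h1]
      ring

end EnrichedLine
end

/-! ### Existence and uniqueness of the complexification. -/

noncomputable section
namespace EnrichedLine

/-- The complexification of a real multilinear form on the plane. -/
def complexifyForm {n : ℕ} (p : ContinuousMultilinearMap ℝ (fun _ : Fin n => Plane ℝ) ℝ) :
    ContinuousMultilinearMap ℂ (fun _ : Fin n => Plane ℂ) ℂ :=
  ∑ s : Fin n → Fin 2, ((p fun i => EuclideanSpace.single (s i) (1 : ℝ) : ℝ) : ℂ) •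
    (ContinuousMultilinearMap.mkPiAlgebra ℂ (Fin n) ℂ).compContinuousLinearMap
      fun i => EuclideanSpace.proj (s i)

theorem complexifyForm_apply {n : ℕ} (p : ContinuousMultilinearMap ℝ (fun _ : Fin n => Plane ℝ) ℝ)
    (v : Fin n → Plane ℂ) : complexifyForm p v = ∑ s : Fin n → Fin 2,
      ((p fun i => EuclideanSpace.single (s i) (1 : ℝ) : ℝ) : ℂ) * ∏ i, v i (s i) := by
  simp [complexifyForm]

/-- The factor `2 ^ n` counts the coordinate words `s`. It is geometric in `n`, so a positive radius
of convergence survives complexification. -/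
theorem norm_complexifyForm_le {n : ℕ}
    (p : ContinuousMultilinearMap ℝ (fun _ : Fin n => Plane ℝ) ℝ) :
    ‖complexifyForm p‖ ≤ 2 ^ n * ‖p‖ := by
  refine ContinuousMultilinearMap.opNorm_le_bound (by positivity) fun v => ?_
  rw [complexifyForm_apply]
  refine (norm_sum_le _ _).trans ?_
  have : ∀ s : Fin n → Fin 2, s ∈ Finset.univ →
      ‖((p fun i => EuclideanSpace.single (s i) (1 : ℝ) : ℝ) : ℂ) * ∏ i, v i (s i)‖ ≤
        ‖p‖ * ∏ i, ‖v i‖ := fun s _ => by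
    rw [norm_mul, norm_prod, Complex.norm_real]
    refine mul_le_mul ?_ (Finset.prod_le_prod (fun _ _ => norm_nonneg _) fun i _ =>
      PiLp.norm_apply_le (v i) (s i)) (Finset.prod_nonneg fun _ _ => norm_nonneg _) (norm_nonneg _)
    refine (p.le_opNorm _).trans ?_
    simp
  refine (Finset.sum_le_sum this).trans ?_
  simp [mul_assoc]

theorem complexifyForm_toComplexPlane {n : ℕ}
    (p : ContinuousMultilinearMap ℝ (fun _ : Fin n => Plane ℝ) ℝ) (P : Plane ℝ) :
    complexifyForm p (fun _ => toComplexPlane P) = (p fun _ => P : ℝ) := by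
  have hP : P = ∑ j, P j • EuclideanSpace.single j (1 : ℝ) := by
    ext i
    fin_cases i <;> simp [Fin.sum_univ_two]
  have h1 : (p fun _ => P) = ∑ s : Fin n → Fin 2,
      (∏ i, P (s i)) * p fun i => EuclideanSpace.single (s i) (1 : ℝ) := by
    conv_lhs => rw [hP]
    rw [p.map_sum]
    exact Finset.sum_congr rfl fun s _ => p.map_smul_univ _ _
  have hc : ∀ j, toComplexPlane P j = (P j : ℂ) := fun j => by
    fin_cases j <;> simp [toComplexPlane]
  rw [complexifyForm_apply, h1]
  push_cast
  refine Finset.sum_congr rfl fun s _ => ?_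
  simp only [hc]
  ring

theorem norm_toComplexPlane (P : Plane ℝ) : ‖toComplexPlane P‖ = ‖P‖ := by
  simp [EuclideanSpace.norm_eq, toComplexPlane, Fin.sum_univ_two]

theorem exists_isComplexification {f : Plane ℝ → ℝ} (hf : AnalyticAt ℝ f 0) :
    ∃ F, IsComplexification f F := by
  obtain ⟨p, r, hp⟩ := hf
  let q : FormalMultilinearSeries ℂ (Plane ℂ) ℂ := fun n => complexifyForm (p n)
  obtain ⟨ρ, hρ0, hρ⟩ := ENNReal.lt_iff_exists_nnreal_btwn.1 (hp.r_pos.trans_le hp.r_le)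
  obtain ⟨C, -, hC⟩ := p.norm_mul_pow_le_of_lt_radius hρ
  -- Halving `ρ` absorbs the factor `2 ^ n`.
  have hrad : ((ρ / 2 : ℝ≥0) : ℝ≥0∞) ≤ q.radius := by
    refine q.le_radius_of_bound C fun n => le_trans ?_ (hC n)
    refine (mul_le_mul_of_nonneg_right (norm_complexifyForm_le (p n)) (by positivity)).trans ?_
    rw [NNReal.coe_div, div_pow, NNReal.coe_ofNat]
    refine le_of_eq ?_
    field_simp
  have hpos : 0 < q.radius := by
    refine lt_of_lt_of_le ?_ hrad
    have : (0 : ℝ≥0) < ρ := by exact_mod_cast hρ0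
    exact_mod_cast half_pos this
  have hq := q.hasFPowerSeriesOnBall hpos
  refine ⟨q.sum, hq.analyticAt, ?_⟩
  filter_upwards [Metric.eball_mem_nhds (0 : Plane ℝ) hp.r_pos, Metric.eball_mem_nhds _ hpos]
    with P hP hP2
  have h1 : HasSum (fun n => q n fun _ => toComplexPlane P) (q.sum (toComplexPlane P)) := by
    have hmem : toComplexPlane P ∈ Metric.eball (0 : Plane ℂ) q.radius := by
      simp only [Metric.mem_eball, edist_zero_right, ← ofReal_norm, norm_toComplexPlane]
        at hP2 ⊢
      exact hP2
    simpa using hq.hasSum hmem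
  have h2 : HasSum (fun n => ((p n fun _ => P : ℝ) : ℂ)) (f P : ℂ) := by
    have := hp.hasSum hP
    rw [zero_add] at this
    exact Complex.hasSum_ofReal.2 this
  simp only [q, complexifyForm_toComplexPlane] at h1
  exact h1.unique h2

theorem norm_vec_le {𝕜 : Type} [RCLike 𝕜] (x y : 𝕜) : ‖(!₂[x, y] : Plane 𝕜)‖ ≤ ‖x‖ + ‖y‖ := by
  rw [EuclideanSpace.norm_eq]
  refine Real.sqrt_le_iff.2 ⟨by positivity, ?_⟩
  simp only [Fin.sum_univ_two]
  simp
  nlinarith [norm_nonneg x, norm_nonneg y]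

/-- The linear isomorphism between the plane and the product. -/
def vecCLM (𝕜 : Type) [RCLike 𝕜] : 𝕜 × 𝕜 →L[𝕜] Plane 𝕜 :=
  (ContinuousLinearMap.fst 𝕜 𝕜 𝕜).smulRight (EuclideanSpace.single 0 1) +
    (ContinuousLinearMap.snd 𝕜 𝕜 𝕜).smulRight (EuclideanSpace.single 1 1)

theorem vecCLM_apply {𝕜 : Type} [RCLike 𝕜] (v : 𝕜 × 𝕜) : vecCLM 𝕜 v = !₂[v.1, v.2] := by
  ext i
  fin_cases i <;> simp [vecCLM]

theorem analyticAt_vec {𝕜 E : Type} [RCLike 𝕜] [NormedAddCommGroup E] [NormedSpace 𝕜 E]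
    {a b : E → 𝕜} {x : E} (ha : AnalyticAt 𝕜 a x) (hb : AnalyticAt 𝕜 b x) :
    AnalyticAt 𝕜 (fun s => (!₂[a s, b s] : Plane 𝕜)) x := by
  simp only [← vecCLM_apply (𝕜 := 𝕜) (_, _)]
  exact ((vecCLM 𝕜).analyticAt _).comp (ha.prod hb)

theorem analyticAt_real_vec {𝕜 : Type} [RCLike 𝕜] {a b : ℝ → 𝕜} {x : ℝ}
    (ha : AnalyticAt ℝ a x) (hb : AnalyticAt ℝ b x) :
    AnalyticAt ℝ (fun s => (!₂[a s, b s] : Plane 𝕜)) x := by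
  simp only [← vecCLM_apply (𝕜 := 𝕜) (_, _)]
  exact (((vecCLM 𝕜).restrictScalars ℝ).analyticAt _).comp (ha.prod hb)

theorem eqOn_zero_of_real {g : ℂ → ℂ} {ε : ℝ} (hε : 0 < ε)
    (hg : AnalyticOnNhd ℂ g (Metric.ball 0 ε)) (h0 : ∀ x : ℝ, |x| < ε → g x = 0) :
    Set.EqOn g 0 (Metric.ball 0 ε) := by
  refine hg.eqOn_zero_of_preconnected_of_frequently_eq_zero
    (convex_ball (0 : ℂ) ε).isPreconnected (Metric.mem_ball_self hε) ?_
  have ht : Tendsto (fun x : ℝ => (x : ℂ)) (𝓝[≠] 0) (𝓝[≠] 0) := by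
    refine tendsto_nhdsWithin_iff.2 ⟨?_, ?_⟩
    · exact (Complex.continuous_ofReal.tendsto' 0 0 rfl).mono_left nhdsWithin_le_nhds
    · filter_upwards [self_mem_nhdsWithin] with x hx
      simpa using hx
  refine ht.frequently (Eventually.frequently ?_)
  filter_upwards [nhdsWithin_le_nhds (Metric.ball_mem_nhds (0 : ℝ) hε)] with x hx
  exact h0 x (by simpa using hx)

/-- The identity theorem is applied one variable at a time: in `x` for each fixed real `y`, then in
`y` for each fixed complex `x`. -/
theorem eventually_eq_zero_of_real {D : Plane ℂ → ℂ} (hD : AnalyticAt ℂ D 0)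
    (h0 : ∀ᶠ P in 𝓝 (0 : Plane ℝ), D (toComplexPlane P) = 0) : ∀ᶠ P in 𝓝 (0 : Plane ℂ), D P = 0 := by
  obtain ⟨ε, hε, h⟩ := Metric.eventually_nhds_iff_ball.1 hD.eventually_analyticAt
  obtain ⟨ε', hε', h'⟩ := Metric.eventually_nhds_iff_ball.1 h0
  set δ := min ε ε' / 2 with hδ
  have hδ0 : 0 < δ := half_pos (lt_min hε hε')
  have hdε : ∀ {a b : ℝ}, a < δ → b < δ → a + b < ε := fun ha hb => by
    have := min_le_left ε ε'; linarith
  have hdε' : ∀ {a b : ℝ}, a < δ → b < δ → a + b < ε' := fun ha hb => by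
    have := min_le_right ε ε'; linarith
  have han : ∀ x y : ℂ, ‖x‖ < δ → ‖y‖ < δ → AnalyticAt ℂ D !₂[x, y] := fun x y hx hy =>
    h _ (mem_ball_zero_iff.2 ((norm_vec_le x y).trans_lt (hdε hx hy)))
  have step1 : ∀ y : ℝ, |y| < δ → ∀ x : ℂ, ‖x‖ < δ → D !₂[x, (y : ℂ)] = 0 := fun y hy x hx => by
    refine eqOn_zero_of_real (g := fun x => D !₂[x, (y : ℂ)]) hδ0 (fun z hz => ?_) (fun t ht => ?_)
      (mem_ball_zero_iff.2 hx)
    · exact AnalyticAt.comp (g := D) (f := fun x : ℂ => !₂[x, (y : ℂ)])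
        (han z y (mem_ball_zero_iff.1 hz) (by simpa using hy))
        (analyticAt_vec analyticAt_id analyticAt_const)
    · have := h' !₂[t, y] (mem_ball_zero_iff.2 ((norm_vec_le t y).trans_lt (hdε' ht hy)))
      simpa [toComplexPlane] using this
  have step2 : ∀ x y : ℂ, ‖x‖ < δ → ‖y‖ < δ → D !₂[x, y] = 0 := fun x y hx hy => by
    refine eqOn_zero_of_real (g := fun y => D !₂[x, y]) hδ0 (fun z hz => ?_) (fun t ht => ?_)
      (mem_ball_zero_iff.2 hy)
    · exact AnalyticAt.comp (g := D) (f := fun y : ℂ => !₂[x, y])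
        (han x z hx (mem_ball_zero_iff.1 hz))
        (analyticAt_vec analyticAt_const analyticAt_id)
    · exact step1 t ht x hx
  filter_upwards [Metric.ball_mem_nhds (0 : Plane ℂ) hδ0] with P hP
  rw [mem_ball_zero_iff] at hP
  have hPv : P = !₂[P 0, P 1] := by ext i; fin_cases i <;> rfl
  rw [hPv]
  exact step2 _ _ ((PiLp.norm_apply_le P 0).trans_lt hP) ((PiLp.norm_apply_le P 1).trans_lt hP)

/-- Zero arcs and `B`-roots are defined with an arbitrary complexification; uniqueness of the germ
allows one fixed `F` to serve throughout. -/
theorem IsComplexification.eventuallyEq {f : Plane ℝ → ℝ} {F G : Plane ℂ → ℂ}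
    (hF : IsComplexification f F) (hG : IsComplexification f G) : F =ᶠ[𝓝 0] G := by
  have := eventually_eq_zero_of_real (hF.1.sub hG.1) (by
    filter_upwards [hF.2, hG.2] with P h1 h2
    simp [h1, h2])
  filter_upwards [this] with P hP
  exact sub_eq_zero.1 hP

/-- The partial derivative in `x` of the complexification is the complexification of `f_x`. -/
theorem IsComplexification.partialX {f : Plane ℝ → ℝ} {F : Plane ℂ → ℂ}
    (hF : IsComplexification f F) :
    IsComplexification (partialX f) fun P => deriv (fun x : ℂ => F !₂[x, P 1]) (P 0) := by
  have hslope : ∀ᶠ P in 𝓝 (0 : Plane ℂ), HasDerivAt (fun x : ℂ => F !₂[x, P 1])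
      (fderiv ℂ F P !₂[1, 0]) (P 0) := by
    filter_upwards [hF.1.eventually_analyticAt] with P hP
    have hPv : !₂[P 0, P 1] = P := by ext i; fin_cases i <;> rfl
    have hline : HasDerivAt (fun x : ℂ => (!₂[x, P 1] : Plane ℂ)) !₂[1, 0] (P 0) := by
      have := (vecCLM ℂ).hasFDerivAt.comp_hasDerivAt (P 0)
        ((hasDerivAt_id (P 0)).prodMk (hasDerivAt_const (P 0) (P 1)))
      simpa [Function.comp_def, vecCLM_apply] using this
    exact HasFDerivAt.comp_hasDerivAt (P 0) (l := F) (by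
      simpa [hPv] using hP.differentiableAt.hasFDerivAt) hline
  refine ⟨?_, ?_⟩
  · refine AnalyticAt.congr (f := fun P => fderiv ℂ F P !₂[1, 0]) ?_ ?_
    · exact ((ContinuousLinearMap.apply ℂ ℂ (!₂[1, 0] : Plane ℂ)).analyticAt _).comp hF.1.fderiv
    · filter_upwards [hslope] with P hP using hP.deriv.symm
  · have htc : Tendsto toComplexPlane (𝓝 0) (𝓝 0) := by
      rw [tendsto_zero_iff_norm_tendsto_zero]
      simpa [norm_toComplexPlane] using tendsto_norm_zero (E := Plane ℝ)
    filter_upwards [hF.2.eventually_nhds, htc.eventually hslope] with P hP hd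
    have h0 : toComplexPlane P 0 = ((P 0 : ℝ) : ℂ) := by simp [toComplexPlane]
    have h1 : toComplexPlane P 1 = ((P 1 : ℝ) : ℂ) := by simp [toComplexPlane]
    rw [h0, h1] at hd ⊢
    have hPv : !₂[P 0, P 1] = P := by ext i; fin_cases i <;> rfl
    have hline : Tendsto (fun x : ℝ => (!₂[x, P 1] : Plane ℝ)) (𝓝 (P 0)) (𝓝 P) := by
      have : Continuous (fun x : ℝ => (!₂[x, P 1] : Plane ℝ)) := by
        have := (vecCLM ℝ).continuous.comp (continuous_id.prodMk (continuous_const (y := P 1)))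
        simpa [Function.comp_def, vecCLM_apply] using this
      exact this.tendsto' _ _ hPv
    have heq : (fun x : ℝ => F !₂[(x : ℂ), ((P 1 : ℝ) : ℂ)]) =ᶠ[𝓝 (P 0)]
        fun x : ℝ => ((f !₂[x, P 1] : ℝ) : ℂ) := by
      filter_upwards [hline.eventually hP] with x hx
      simpa [toComplexPlane] using hx
    have hcr := (hd.comp_ofReal).congr_of_eventuallyEq heq.symm
    -- Along the real axis `F` equals `f`, so the real part of its derivative is `f_x`. Uniqueness
    -- of derivatives then shows that the complex derivative is itself real.
    have hre : HasDerivAt (fun x : ℝ => f !₂[x, P 1]) (fderiv ℂ F (toComplexPlane P) !₂[1, 0]).re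
        (P 0) := by
      have := Complex.reCLM.hasFDerivAt.comp_hasDerivAt (P 0) hcr
      simpa only [Function.comp_def, Complex.reCLM_apply, Complex.ofReal_re] using this
    have hof := hre.ofReal_comp
    rw [hd.deriv, EnrichedLine.partialX, hre.deriv]
    exact hcr.unique hof

end EnrichedLine
end

/-! ### Leading terms, orders and truncations of fractional power series. -/

noncomputable section
namespace EnrichedLine

theorem tendsto_rpow_mul_inv {a b : ℝ} (h : b < a) :
    Tendsto (fun y : ℝ => (y ^ b)⁻¹ * y ^ a) (𝓝[>] 0) (𝓝 0) := by
  have h1 : Tendsto (fun y : ℝ => y ^ (a - b)) (𝓝[>] 0) (𝓝 0) := by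
    have := (Real.continuousAt_rpow_const 0 (a - b) (Or.inr (sub_nonneg.2 h.le))).tendsto
    rw [Real.zero_rpow (sub_pos.2 h).ne'] at this
    exact this.mono_left nhdsWithin_le_nhds
  refine h1.congr' ?_
  filter_upwards [self_mem_nhdsWithin] with y hy
  rw [Real.rpow_sub hy, div_eq_inv_mul]

theorem rpow_isBigO_rpow_iff {a b : ℝ} :
    (fun y : ℝ => y ^ a) =O[𝓝[>] 0] (fun y : ℝ => y ^ b) ↔ b ≤ a := by
  constructor
  · intro h
    by_contra hlt
    rw [not_le] at hlt
    have h0 : Tendsto (fun y : ℝ => (y ^ a)⁻¹ * y ^ b) (𝓝[>] 0) (𝓝 0) := tendsto_rpow_mul_inv hlt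
    obtain ⟨C, hC⟩ := h.bound
    have h1 : ∀ᶠ y : ℝ in 𝓝[>] 0, |C| * ((y ^ a)⁻¹ * y ^ b) < 1 := by
      have := h0.const_mul |C|
      rw [mul_zero] at this
      exact this.eventually (gt_mem_nhds zero_lt_one)
    obtain ⟨y, h1, hC, hy⟩ := (h1.and (hC.and self_mem_nhdsWithin)).exists
    have hy : 0 < y := hy
    have hya := Real.rpow_pos_of_pos hy a
    have hyb := Real.rpow_pos_of_pos hy b
    rw [Real.norm_of_nonneg hya.le, Real.norm_of_nonneg hyb.le] at hC
    have : |C| * y ^ b < y ^ a := by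
      rw [← mul_assoc, mul_comm |C|, mul_assoc, inv_mul_lt_iff₀ hya, mul_one] at h1
      exact h1
    nlinarith [mul_le_mul_of_nonneg_right (le_abs_self C) hyb.le]
  · intro h
    refine IsBigO.of_bound 1 ?_
    filter_upwards [Ioc_mem_nhdsGT (zero_lt_one' ℝ)] with y hy
    rw [one_mul, Real.norm_of_nonneg (Real.rpow_nonneg hy.1.le _),
      Real.norm_of_nonneg (Real.rpow_nonneg hy.1.le _)]
    exact Real.rpow_le_rpow_of_exponent_ge hy.1 hy.2 h

/-- `δ y = c y ^ q + ⋯` for `y → 0+`. -/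
def HasLeading {𝕜 : Type} [RCLike 𝕜] (δ : ℝ → 𝕜) (q : ℝ) (c : 𝕜) : Prop :=
  Tendsto (fun y : ℝ => (y ^ q)⁻¹ • δ y) (𝓝[>] 0) (𝓝 c)

section leading
variable {𝕜 : Type} [RCLike 𝕜] {δ ε : ℝ → 𝕜} {q : ℝ} {c : 𝕜}

theorem HasLeading.isBigO (h : HasLeading δ q c) : δ =O[𝓝[>] 0] (fun y : ℝ => y ^ q) := by
  have h1 : δ =ᶠ[𝓝[>] 0] fun y : ℝ => (y ^ q) • ((y ^ q)⁻¹ • δ y) := by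
    filter_upwards [self_mem_nhdsWithin] with y hy
    rw [smul_smul, mul_inv_cancel₀ (Real.rpow_pos_of_pos hy q).ne', one_smul]
  have h2 := (isBigO_refl (fun y : ℝ => y ^ q) (𝓝[>] 0)).smul (h.isBigO_one ℝ)
  simp only [smul_eq_mul, mul_one] at h2
  exact h1.trans_isBigO h2

theorem HasLeading.isBigO_symm (h : HasLeading δ q c) (hc : c ≠ 0) :
    (fun y : ℝ => y ^ q) =O[𝓝[>] 0] δ := by
  have hpos : 0 < ‖c‖ := norm_pos_iff.2 hc
  refine IsBigO.of_bound (2 / ‖c‖) ?_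
  filter_upwards [h.norm.eventually (lt_mem_nhds (half_lt_self hpos)), self_mem_nhdsWithin]
    with y hy hy0
  have hyq := Real.rpow_pos_of_pos hy0 q
  rw [norm_smul, norm_inv, Real.norm_of_nonneg hyq.le, lt_inv_mul_iff₀ hyq] at hy
  rw [Real.norm_of_nonneg hyq.le, div_mul_eq_mul_div, le_div_iff₀ hpos]
  linarith

/-- With `c ≠ 0`, `δ` and `y ^ q` are bounded by each other, so `q` is the exact order. `HasLeading`
also admits `c = 0`, where it only says `δ = o(y ^ q)`. -/
theorem HasLeading.isBigO_iff (h : HasLeading δ q c) (hc : c ≠ 0) {k : ℝ} :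
    δ =O[𝓝[>] 0] (fun y : ℝ => y ^ k) ↔ k ≤ q :=
  ⟨fun h1 => rpow_isBigO_rpow_iff.1 ((h.isBigO_symm hc).trans h1),
    fun h1 => h.isBigO.trans (rpow_isBigO_rpow_iff.2 h1)⟩

theorem hasLeading_iff_isLittleO : HasLeading δ q c ↔
    (fun y : ℝ => δ y - (y ^ q) • c) =o[𝓝[>] 0] (fun y : ℝ => y ^ q) := by
  rw [HasLeading, ← tendsto_sub_nhds_zero_iff, ← isLittleO_one_iff ℝ]
  have h1 : (fun y : ℝ => (y ^ q)⁻¹ • δ y - c) =ᶠ[𝓝[>] 0]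
      fun y : ℝ => (y ^ q)⁻¹ • (δ y - (y ^ q) • c) := by
    filter_upwards [self_mem_nhdsWithin] with y hy
    rw [smul_sub, smul_smul, inv_mul_cancel₀ (Real.rpow_pos_of_pos hy q).ne', one_smul]
  rw [isLittleO_congr h1 (EventuallyEq.refl _ _)]
  constructor
  · intro h
    have := (isBigO_refl (fun y : ℝ => y ^ q) (𝓝[>] 0)).smul_isLittleO h
    refine (this.congr' ?_ ?_)
    · filter_upwards [self_mem_nhdsWithin] with y hy
      rw [smul_smul, mul_inv_cancel₀ (Real.rpow_pos_of_pos hy q).ne', one_smul]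
    · simp [EventuallyEq]
  · intro h
    have := (isBigO_refl (fun y : ℝ => (y ^ q)⁻¹) (𝓝[>] 0)).smul_isLittleO h
    refine this.congr' (EventuallyEq.refl _ _) ?_
    filter_upwards [self_mem_nhdsWithin] with y hy
    rw [smul_eq_mul, inv_mul_cancel₀ (Real.rpow_pos_of_pos hy q).ne']

theorem HasLeading.sub {c' : 𝕜} (h : HasLeading δ q c) (h' : HasLeading ε q c') :
    HasLeading (fun y => δ y - ε y) q (c - c') := by
  simpa only [HasLeading, smul_sub] using Tendsto.sub h h'

theorem HasLeading.of_lt {q' : ℝ} (h : HasLeading δ q c) (hq : q' < q) : HasLeading δ q' 0 := by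
  have := (tendsto_rpow_mul_inv hq).smul h
  rw [zero_smul] at this
  refine this.congr' ?_
  filter_upwards [self_mem_nhdsWithin] with y hy
  rw [smul_smul, mul_assoc, mul_inv_cancel₀ (Real.rpow_pos_of_pos hy q).ne', mul_one]

theorem HasLeading.congr (h : HasLeading δ q c) (hd : δ =ᶠ[𝓝[>] 0] ε) : HasLeading ε q c :=
  Tendsto.congr' (by filter_upwards [hd] with y hy; rw [hy]) h

theorem hasLeading_monomial (c : 𝕜) (q : ℝ) : HasLeading (fun y : ℝ => (y ^ q) • c) q c := by
  rw [hasLeading_iff_isLittleO]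
  simp

theorem HasLeading.ofReal {δ : ℝ → ℝ} {c : ℝ} (h : HasLeading δ q c) :
    HasLeading (fun y => (δ y : ℂ)) q (c : ℂ) := by
  have := (Complex.continuous_ofReal.tendsto c).comp h
  simpa [HasLeading, Function.comp_def] using this

end leading

section fractional
variable {𝕜 : Type} [RCLike 𝕜] {φ ψ : ℝ → 𝕜}

theorem tendsto_rpow_nhdsGE {q : ℝ} (hq : 0 < q) :
    Tendsto (fun y : ℝ => y ^ q) (𝓝[≥] 0) (𝓝[≥] 0) := by
  refine tendsto_nhdsWithin_iff.2 ⟨?_, ?_⟩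
  · have := (Real.continuousAt_rpow_const 0 q (Or.inr hq.le)).tendsto
    rw [Real.zero_rpow hq.ne'] at this
    exact this.mono_left nhdsWithin_le_nhds
  · filter_upwards [self_mem_nhdsWithin] with y hy
    exact Real.rpow_nonneg hy _

theorem tendsto_rpow_nhdsGT {q : ℝ} (hq : 0 < q) :
    Tendsto (fun y : ℝ => y ^ q) (𝓝[>] 0) (𝓝[>] 0) := by
  refine tendsto_nhdsWithin_iff.2 ⟨?_, ?_⟩
  · exact ((tendsto_rpow_nhdsGE hq).mono_left
      (nhdsWithin_mono _ Set.Ioi_subset_Ici_self)).mono_right nhdsWithin_le_nhds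
  · filter_upwards [self_mem_nhdsWithin] with y hy
    exact Real.rpow_pos_of_pos hy _

theorem tendsto_pow_nhdsGE {d : ℕ} (hd : 0 < d) :
    Tendsto (fun y : ℝ => y ^ d) (𝓝[≥] 0) (𝓝[≥] 0) := by
  simpa using tendsto_rpow_nhdsGE (q := d) (by exact_mod_cast hd)

theorem rpow_inv_pow {d : ℕ} (hd : 0 < d) {y : ℝ} (hy : 0 ≤ y) : (y ^ (d : ℝ)⁻¹) ^ d = y :=
  Real.rpow_inv_natCast_pow hy hd.ne'

/-- The real `d`-th root is a right inverse on `y ≥ 0`. Germs of images can thus be computed in the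
parameter `t` with `y = t ^ d`. -/
theorem map_pow_nhdsGE {d : ℕ} (hd : 0 < d) :
    Filter.map (fun y : ℝ => y ^ d) (𝓝[≥] 0) = 𝓝[≥] 0 := by
  refine le_antisymm (tendsto_pow_nhdsGE hd) ?_
  have h1 : Tendsto (fun y : ℝ => y ^ (d : ℝ)⁻¹) (𝓝[≥] 0) (𝓝[≥] 0) :=
    tendsto_rpow_nhdsGE (by positivity)
  have h2 := Filter.map_mono (m := fun y : ℝ => y ^ d) h1
  rw [Filter.map_map] at h2
  refine le_trans (le_of_eq ?_) h2
  refine (Filter.map_id.symm).trans (Filter.map_congr ?_)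
  filter_upwards [self_mem_nhdsWithin] with y hy
  exact (rpow_inv_pow hd hy).symm

theorem IsFractionalSeries.mul_denominator {d : ℕ} {a : ℝ → 𝕜}
    (ha : AnalyticAt ℝ a 0) (h : ∀ᶠ t in 𝓝[≥] (0 : ℝ), φ (t ^ d) = a t) {k : ℕ} (hk : 0 < k) :
    ∃ b : ℝ → 𝕜, AnalyticAt ℝ b 0 ∧ ∀ᶠ t in 𝓝[≥] (0 : ℝ), φ (t ^ (d * k)) = b t := by
  refine ⟨fun t => a (t ^ k), AnalyticAt.comp (g := a) (f := fun t : ℝ => t ^ k)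
    (by simpa [hk.ne'] using ha) (analyticAt_id.pow k), ?_⟩
  filter_upwards [(tendsto_pow_nhdsGE hk).eventually h] with t ht
  rw [mul_comm, pow_mul, ht]

theorem IsFractionalSeries.common (hφ : IsFractionalSeries φ) {𝕂 : Type} [RCLike 𝕂] {ψ : ℝ → 𝕂}
    (hψ : IsFractionalSeries ψ) :
    ∃ d : ℕ, 0 < d ∧ ∃ (a : ℝ → 𝕜) (b : ℝ → 𝕂), AnalyticAt ℝ a 0 ∧ AnalyticAt ℝ b 0 ∧
      ∀ᶠ t in 𝓝[≥] (0 : ℝ), φ (t ^ d) = a t ∧ ψ (t ^ d) = b t := by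
  obtain ⟨d, hd, a, ha, hae⟩ := hφ
  obtain ⟨e, he, b, hb, hbe⟩ := hψ
  obtain ⟨a', ha', h1⟩ := IsFractionalSeries.mul_denominator ha hae he
  obtain ⟨b', hb', h2⟩ := IsFractionalSeries.mul_denominator hb hbe hd
  rw [mul_comm] at h2
  exact ⟨d * e, Nat.mul_pos hd he, a', b', ha', hb', h1.and h2⟩

theorem IsFractionalSeries.add (hφ : IsFractionalSeries φ) (hψ : IsFractionalSeries ψ) :
    IsFractionalSeries fun y => φ y + ψ y := by
  obtain ⟨d, hd, a, b, ha, hb, h⟩ := hφ.common hψ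
  exact ⟨d, hd, fun t => a t + b t, ha.add hb, h.mono fun t ht => by simp only [ht.1, ht.2]⟩

theorem IsFractionalSeries.sub (hφ : IsFractionalSeries φ) (hψ : IsFractionalSeries ψ) :
    IsFractionalSeries fun y => φ y - ψ y := by
  obtain ⟨d, hd, a, b, ha, hb, h⟩ := hφ.common hψ
  exact ⟨d, hd, fun t => a t - b t, ha.sub hb, h.mono fun t ht => by simp only [ht.1, ht.2]⟩

theorem IsFractionalSeries.ofReal {φ : ℝ → ℝ} (hφ : IsFractionalSeries φ) :
    IsFractionalSeries fun y => (φ y : ℂ) := by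
  obtain ⟨d, hd, a, ha, h⟩ := hφ
  exact ⟨d, hd, fun t => (a t : ℂ), (Complex.ofRealCLM.analyticAt _).comp ha,
    h.mono fun t ht => by simp only [ht]⟩

theorem isFractionalSeries_monomial (c : ℝ) {q : ℚ} (hq : 0 ≤ q) :
    IsFractionalSeries fun y : ℝ => c * y ^ (q : ℝ) := by
  refine ⟨q.den, q.den_pos, fun t => c * t ^ q.num.toNat,
    analyticAt_const.mul (analyticAt_id.pow _), ?_⟩
  filter_upwards [self_mem_nhdsWithin] with t ht
  have ht : 0 ≤ t := ht
  rw [← Real.rpow_natCast t q.den, ← Real.rpow_mul ht, ← Real.rpow_natCast t q.num.toNat]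
  congr 2
  have h1 : (q.den : ℚ) * q = q.num := by rw [mul_comm]; exact Rat.mul_den_eq_num q
  have h2 : ((q.num.toNat : ℤ) : ℚ) = q.num := by rw [Int.toNat_of_nonneg (Rat.num_nonneg.2 hq)]
  have h3 : ((q.den : ℚ) * q : ℚ) = (q.num.toNat : ℚ) := by rw [h1, ← h2]; norm_cast
  exact_mod_cast congrArg (fun x : ℚ => (x : ℝ)) h3

theorem isFractionalSeries_fracEval {p : ℚ →₀ ℝ} (hp : ∀ e ∈ p.support, 0 ≤ e) :
    IsFractionalSeries (fracEval p) := by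
  have h : ∀ s : Finset ℚ, (∀ e ∈ s, 0 ≤ e) →
      IsFractionalSeries fun y : ℝ => ∑ e ∈ s, p e * y ^ (e : ℝ) := by
    intro s
    induction s using Finset.induction_on with
    | empty => exact fun _ => ⟨1, one_pos, fun _ => 0, analyticAt_const, by simp⟩
    | insert e s he ih =>
      intro hs
      simp only [Finset.sum_insert he]
      exact (isFractionalSeries_monomial _ (hs e (Finset.mem_insert_self e s))).add
        (ih fun e' he' => hs e' (Finset.mem_insert_of_mem he'))
  exact h _ hp

/-- A fractional power series either vanishes or has a leading term. -/
theorem IsFractionalSeries.eventually_zero_or_leading (hφ : IsFractionalSeries φ) :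
    (∀ᶠ y in 𝓝[>] (0 : ℝ), φ y = 0) ∨ ∃ q : ℚ, 0 ≤ q ∧ ∃ c : 𝕜, c ≠ 0 ∧ HasLeading φ q c := by
  obtain ⟨d, hd, a, ha, h⟩ := hφ
  have hroot : Tendsto (fun y : ℝ => y ^ (d : ℝ)⁻¹) (𝓝[>] 0) (𝓝[>] 0) :=
    tendsto_rpow_nhdsGT (by positivity)
  have hφa : ∀ᶠ y in 𝓝[>] (0 : ℝ), φ y = a (y ^ (d : ℝ)⁻¹) := by
    filter_upwards [hroot.eventually (h.filter_mono (nhdsWithin_mono _ Set.Ioi_subset_Ici_self)),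
      self_mem_nhdsWithin] with y hy hy0
    rw [← hy, rpow_inv_pow hd (le_of_lt hy0)]
  by_cases hz : ∀ᶠ t in 𝓝 (0 : ℝ), a t = 0
  · left
    filter_upwards [hφa, hroot.eventually (hz.filter_mono nhdsWithin_le_nhds)] with y h1 h2
    rw [h1, h2]
  · right
    obtain ⟨n, g, hg, hg0, hgz⟩ := ha.exists_eventuallyEq_pow_smul_nonzero_iff.2 hz
    refine ⟨n / d, by positivity, g 0, hg0, ?_⟩
    have ht : Tendsto (fun y : ℝ => g (y ^ (d : ℝ)⁻¹)) (𝓝[>] 0) (𝓝 (g 0)) :=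
      (hg.continuousAt.tendsto.mono_left nhdsWithin_le_nhds).comp hroot
    refine ht.congr' ?_
    filter_upwards [hφa, hroot.eventually (hgz.filter_mono nhdsWithin_le_nhds),
      self_mem_nhdsWithin] with y h1 h2 hy
    have hy : 0 < y := hy
    have : (y ^ (d : ℝ)⁻¹) ^ n = y ^ (((n / d : ℚ) : ℝ)) := by
      rw [← Real.rpow_natCast, ← Real.rpow_mul hy.le]
      congr 1
      push_cast
      ring
    rw [h1, h2, sub_zero, this, smul_smul, inv_mul_cancel₀ (Real.rpow_pos_of_pos hy _).ne', one_smul]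

end fractional

/-- The order in `y` of a function on `y > 0`. -/
def fracOrd {𝕜 : Type} [RCLike 𝕜] (δ : ℝ → 𝕜) : ℝ≥0∞ :=
  ⨆ (k : ℝ≥0) (_ : δ =O[𝓝[>] (0 : ℝ)] fun y : ℝ => y ^ (k : ℝ)), (k : ℝ≥0∞)

section fracOrd
variable {𝕜 : Type} [RCLike 𝕜] {δ ε : ℝ → 𝕜}

theorem HasLeading.fracOrd_eq {q : ℝ} {c : 𝕜} (h : HasLeading δ q c) (hc : c ≠ 0) (hq : 0 ≤ q) :
    fracOrd δ = ENNReal.ofReal q := by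
  refine le_antisymm (iSup₂_le fun k hk => ?_) ?_
  · rw [← ENNReal.ofReal_coe_nnreal]
    exact ENNReal.ofReal_le_ofReal ((h.isBigO_iff hc).1 hk)
  · exact le_iSup₂_of_le q.toNNReal (by
      rw [h.isBigO_iff hc, Real.coe_toNNReal q hq]) le_rfl

/-- The supremum defining `fracOrd` is attained because a fractional series that is not zero has a
genuine leading exponent. -/
theorem le_fracOrd_iff (hδ : IsFractionalSeries δ) {k : ℝ≥0} :
    (k : ℝ≥0∞) ≤ fracOrd δ ↔ δ =O[𝓝[>] (0 : ℝ)] fun y : ℝ => y ^ (k : ℝ) := by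
  refine ⟨fun h => ?_, fun h => le_iSup₂_of_le k h le_rfl⟩
  rcases hδ.eventually_zero_or_leading with h0 | ⟨q, hq, c, hc, hl⟩
  · exact EventuallyEq.trans_isBigO h0 (isBigO_zero _ _)
  · rw [hl.isBigO_iff hc]
    rw [hl.fracOrd_eq hc (by exact_mod_cast hq), ← ENNReal.ofReal_coe_nnreal] at h
    exact (ENNReal.ofReal_le_ofReal_iff (by exact_mod_cast hq)).1 h

theorem fracOrd_eq_top_iff (hδ : IsFractionalSeries δ) :
    fracOrd δ = ⊤ ↔ ∀ᶠ y in 𝓝[>] (0 : ℝ), δ y = 0 := by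
  rcases hδ.eventually_zero_or_leading with h0 | ⟨q, hq, c, hc, hl⟩
  · refine iff_of_true (ENNReal.eq_top_of_forall_nnreal_le fun k => (le_fracOrd_iff hδ).2 ?_) h0
    exact EventuallyEq.trans_isBigO h0 (isBigO_zero _ _)
  · refine iff_of_false (by simp [hl.fracOrd_eq hc (by exact_mod_cast hq)]) fun h => hc ?_
    refine tendsto_nhds_unique hl (tendsto_const_nhds.congr' ?_)
    filter_upwards [h] with y hy
    rw [hy, smul_zero]

theorem exists_leading_of_fracOrd_ne_top (hδ : IsFractionalSeries δ) (h : fracOrd δ ≠ ⊤) :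
    ∃ q : ℚ, 0 ≤ q ∧ ∃ c : 𝕜, c ≠ 0 ∧ HasLeading δ q c ∧ fracOrd δ = ENNReal.ofReal q := by
  rcases hδ.eventually_zero_or_leading with h0 | ⟨q, hq, c, hc, hl⟩
  · exact absurd ((fracOrd_eq_top_iff hδ).2 h0) h
  · exact ⟨q, hq, c, hc, hl, hl.fracOrd_eq hc (by exact_mod_cast hq)⟩

theorem fracOrd_add_le (hδ : IsFractionalSeries δ) (hε : IsFractionalSeries ε) :
    min (fracOrd δ) (fracOrd ε) ≤ fracOrd fun y => δ y + ε y := by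
  refine ENNReal.le_of_forall_nnreal_lt fun k hk => (le_fracOrd_iff (hδ.add hε)).2 ?_
  exact ((le_fracOrd_iff hδ).1 (hk.le.trans (min_le_left _ _))).add
    ((le_fracOrd_iff hε).1 (hk.le.trans (min_le_right _ _)))

theorem fracOrd_congr_norm {𝕂 : Type} [RCLike 𝕂] {ε : ℝ → 𝕂} (h : ∀ y, ‖δ y‖ = ‖ε y‖) :
    fracOrd δ = fracOrd ε := by
  unfold fracOrd
  have : ∀ k : ℝ≥0, (δ =O[𝓝[>] (0 : ℝ)] fun y : ℝ => y ^ (k : ℝ)) ↔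
      (ε =O[𝓝[>] (0 : ℝ)] fun y : ℝ => y ^ (k : ℝ)) := fun k => by
    rw [← isBigO_norm_left, ← isBigO_norm_left (f' := ε)]
    simp only [h]
  simp only [this]

end fracOrd

theorem fracEval_sub (p p' : ℚ →₀ ℝ) (y : ℝ) :
    fracEval (p - p') y = fracEval p y - fracEval p' y :=
  Finsupp.sum_sub_index fun _ _ _ => sub_mul _ _ _

/-- A truncated fractional series is determined by its class modulo `O (y ^ h)`. -/
theorem fracEval_unique {p p' : ℚ →₀ ℝ} {h : ℝ} (hp : ∀ e ∈ p.support, (e : ℝ) < h)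
    (hp' : ∀ e ∈ p'.support, (e : ℝ) < h)
    (hO : (fun y => fracEval p y - fracEval p' y) =O[𝓝[>] (0 : ℝ)] fun y : ℝ => y ^ h) :
    p = p' := by
  classical
  by_contra hne
  have hs : (p - p').support.Nonempty := Finsupp.support_nonempty_iff.2 (sub_ne_zero.2 hne)
  -- The smallest exponent at which the two truncations differ is below `h`, yet would be the exact
  -- order of a difference that is `O(y ^ h)`.
  set e := (p - p').support.min' hs with he
  have hmem : e ∈ (p - p').support := Finset.min'_mem _ hs
  have hlt : (e : ℝ) < h := by
    rcases Finset.mem_union.1 (Finsupp.support_sub hmem) with h1 | h1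
    exacts [hp e h1, hp' e h1]
  have hl : HasLeading (fracEval (p - p')) e ((p - p') e) := by
    have hsum : ∀ e' ∈ (p - p').support, Tendsto
        (fun y : ℝ => (y ^ (e : ℝ))⁻¹ • ((p - p') e' * y ^ (e' : ℝ))) (𝓝[>] 0)
        (𝓝 (if e' = e then (p - p') e else 0)) := fun e' he' => by
      split_ifs with heq
      · rw [heq]
        have := hasLeading_monomial ((p - p') e) (e : ℝ)
        simpa only [HasLeading, smul_eq_mul, mul_comm ((p - p') e)] using this
      · have hlt : (e : ℝ) < e' := by
          exact_mod_cast lt_of_le_of_ne (Finset.min'_le _ _ he') (Ne.symm heq)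
        have := (hasLeading_monomial ((p - p') e') (e' : ℝ)).of_lt hlt
        simpa only [HasLeading, smul_eq_mul, mul_comm ((p - p') e')] using this
    have := tendsto_finsetSum _ hsum
    rw [Finset.sum_ite_eq' _ e, if_pos hmem] at this
    simpa only [HasLeading, fracEval, Finsupp.sum, Finset.smul_sum] using this
  have h1 := (hl.isBigO_iff (Finsupp.mem_support_iff.1 hmem) (k := h)).1
    (hO.congr_left fun y => (fracEval_sub p p' y).symm)
  linarith

/-- Truncation of a fractional power series. -/
theorem IsFractionalSeries.exists_truncation {φ : ℝ → ℝ} (hφ : IsFractionalSeries φ) (h : ℝ) :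
    ∃ p : ℚ →₀ ℝ, (∀ e ∈ p.support, 0 ≤ e ∧ (e : ℝ) < h) ∧
      (fun y => φ y - fracEval p y) =O[𝓝[>] (0 : ℝ)] fun y : ℝ => y ^ h := by
  obtain ⟨d, hd, a, ha, hae⟩ := hφ
  -- With `N = ⌈h d⌉`, `n < N` means precisely `n / d < h`, and the remainder starts at exponent `N
  -- / d ≥ h`.
  obtain ⟨r, hr, hre⟩ := ha.exists_eventuallyEq_sum_add_pow_mul ⌈h * d⌉₊
  set N := ⌈h * d⌉₊
  set c : ℕ → ℝ := fun n => iteratedDeriv n a 0 / n.factorial with hc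
  have hd' : (0 : ℝ) < d := by exact_mod_cast hd
  set p : ℚ →₀ ℝ := ∑ n ∈ Finset.range N, Finsupp.single ((n / d : ℚ)) (c n) with hp
  have heval : ∀ y, fracEval p y = ∑ n ∈ Finset.range N, c n * y ^ (((n / d : ℚ)) : ℝ) := fun y => by
    rw [fracEval, hp, ← Finsupp.sum_finsetSum_index (by simp) (by intros; ring)]
    simp [Finsupp.sum_single_index]
  have hroot : Tendsto (fun y : ℝ => y ^ (d : ℝ)⁻¹) (𝓝[>] 0) (𝓝[>] 0) :=
    tendsto_rpow_nhdsGT (by positivity)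
  refine ⟨p, fun e he => ?_, ?_⟩
  · obtain ⟨n, hn, hne⟩ := Finset.mem_biUnion.1 (Finsupp.support_finsetSum he)
    have he' : e = (n / d : ℚ) := by
      simpa using Finsupp.support_single_subset hne
    rw [he']
    refine ⟨by positivity, ?_⟩
    push_cast
    rw [div_lt_iff₀ hd']
    exact Nat.lt_ceil.1 (Finset.mem_range.1 hn)
  · have h1 : (fun y => φ y - fracEval p y) =ᶠ[𝓝[>] 0]
        fun y : ℝ => y ^ ((N : ℝ) / d) * r (y ^ (d : ℝ)⁻¹) := by
      filter_upwards [hroot.eventually (hae.filter_mono (nhdsWithin_mono _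
        Set.Ioi_subset_Ici_self)), hroot.eventually (hre.filter_mono nhdsWithin_le_nhds),
        self_mem_nhdsWithin] with y h1 h2 hy
      have hy : 0 < y := hy
      have hpow : ∀ n : ℕ, (y ^ (d : ℝ)⁻¹) ^ n = y ^ ((n : ℝ) / d) := fun n => by
        rw [← Real.rpow_natCast, ← Real.rpow_mul hy.le]
        congr 1
        ring
      rw [rpow_inv_pow hd hy.le] at h1
      rw [h1, h2, heval, hpow N, smul_eq_mul, add_sub_right_comm, add_eq_right, sub_eq_zero]
      refine Finset.sum_congr rfl fun n _ => ?_
      rw [hpow n, hc, smul_eq_mul]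
      push_cast
      ring
    have hrb : (fun y : ℝ => r (y ^ (d : ℝ)⁻¹)) =O[𝓝[>] 0] fun _ => (1 : ℝ) :=
      ((hr.continuousAt.tendsto.mono_left nhdsWithin_le_nhds).comp hroot).isBigO_one ℝ
    have h2 := ((rpow_isBigO_rpow_iff (a := (N : ℝ) / (d : ℝ)) (b := h)).2 (by
      rw [le_div_iff₀ hd']; exact Nat.le_ceil _)).mul hrb
    simp only [mul_one] at h2
    exact h1.trans_isBigO h2

end EnrichedLine
end

/-! ### Arcs in a half plane as graphs. -/

noncomputable section
namespace EnrichedLine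

theorem sgn_mul_self (σ : ℤˣ) : sgn σ * sgn σ = 1 := by
  rcases Int.units_eq_one_or σ with rfl | rfl <;> simp [sgn]

theorem abs_sgn (σ : ℤˣ) : |sgn σ| = 1 := by
  rcases Int.units_eq_one_or σ with rfl | rfl <;> simp [sgn]

theorem sgn_ne_zero (σ : ℤˣ) : sgn σ ≠ 0 := fun h => by simpa [h] using abs_sgn σ

theorem eventually_nhdsGE_iff {p : ℝ → Prop} :
    (∀ᶠ y in 𝓝[≥] (0 : ℝ), p y) ↔ p 0 ∧ ∀ᶠ y in 𝓝[>] (0 : ℝ), p y := by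
  rw [← Set.Ioi_insert, nhdsWithin_insert, eventually_sup, eventually_pure]

section arcs
variable {𝕜 : Type} [RCLike 𝕜]

theorem Arc.germ_le_nhds (A : Arc 𝕜) : A.germ ≤ 𝓝 0 := by
  obtain ⟨γ, ⟨h1, h2, -⟩, hg⟩ := A.exists_param
  rw [hg]
  have : Tendsto γ (𝓝 0) (𝓝 0) := by simpa [ContinuousAt, h2] using h1.continuousAt
  exact this.mono_left nhdsWithin_le_nhds

theorem Arc.zero_mem (A : Arc 𝕜) {T : Set (Plane 𝕜)} (hT : T ∈ A.germ) : (0 : Plane 𝕜) ∈ T := by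
  obtain ⟨γ, ⟨-, h2, -⟩, hg⟩ := A.exists_param
  rw [hg] at hT
  have := mem_of_mem_nhdsWithin (Set.self_mem_Ici) (Filter.mem_map.1 hT)
  simpa [h2] using this

theorem Arc.frequently_ne_zero (A : Arc 𝕜) : ∃ᶠ P in A.germ, P ≠ 0 := by
  obtain ⟨γ, ⟨-, -, h3⟩, hg⟩ := A.exists_param
  rw [hg, frequently_map]
  simpa only [not_eventually] using h3

/-- The graph of a fractional power series is an arc. -/
theorem exists_arc_graph {φ : ℝ → 𝕜} (hφ : IsFractionalSeries φ) (h0 : φ 0 = 0)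
    {l : ℝ →L[ℝ] 𝕜} (hl : l 1 ≠ 0) :
    ∃ A : Arc 𝕜, A.germ = Filter.map (fun y : ℝ => (!₂[φ y, l y] : Plane 𝕜)) (𝓝[≥] 0) := by
  obtain ⟨d, hd, a, ha, hae⟩ := hφ
  have hl' : ∀ y : ℝ, l y = 0 → y = 0 := fun y hy => by
    have : l y = y • l 1 := by rw [← map_smul, smul_eq_mul, mul_one]
    rw [this] at hy
    exact (smul_eq_zero.1 hy).resolve_right hl
  have hmap : Filter.map (fun y : ℝ => (!₂[φ y, l y] : Plane 𝕜)) (𝓝[≥] 0) =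
      Filter.map (fun t => !₂[a t, l (t ^ d)]) (𝓝[≥] 0) := by
    conv_lhs => rw [← map_pow_nhdsGE hd]
    rw [Filter.map_map]
    refine Filter.map_congr ?_
    filter_upwards [hae] with t ht
    simp [ht]
  refine ⟨⟨_, fun t => !₂[a t, l (t ^ d)], ⟨analyticAt_real_vec ha
    ((l.analyticAt _).comp (analyticAt_id.pow d)), ?_, fun h => ?_⟩, hmap⟩, rfl⟩
  · have := (eventually_nhdsGE_iff.1 hae).1
    rw [zero_pow hd.ne', h0] at this
    ext i
    fin_cases i <;> simp [← this, hd.ne']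
  · obtain ⟨t, ht, ht0⟩ := ((eventually_nhdsGE_iff.1 h).2.and self_mem_nhdsWithin).exists
    have : l (t ^ d) = 0 := by simpa using congrArg (fun P : Plane 𝕜 => P 1) ht
    exact (pow_pos ht0 d).ne' (hl' _ this)

/-- A contact exponent `k > 1` would give `c ≤ C ‖P‖ ^ (k - 1)` at nonzero points of the arc
arbitrarily close to `0`. -/
theorem contactOrder_le_one {A : Arc 𝕜} {M : Filter (Plane 𝕜)} {c : ℝ} (hc : 0 < c)
    {T : Set (Plane 𝕜)} (hT : T ∈ M) (h : ∀ᶠ P in A.germ, c * ‖P‖ ≤ Metric.infDist P T) :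
    contactOrder A.germ M ≤ 1 := by
  refine iSup₂_le fun k hk => ?_
  by_contra hlt
  have hk1 : (1 : ℝ) < k := by
    rw [not_le] at hlt
    exact_mod_cast hlt
  obtain ⟨C, hC⟩ := (hk T hT).bound
  have hlim : Tendsto (fun P : Plane 𝕜 => |C| * ‖P‖ ^ ((k : ℝ) - 1)) A.germ (𝓝 0) := by
    have h1 : Tendsto (fun P : Plane 𝕜 => ‖P‖) A.germ (𝓝 0) := by
      simpa using (continuous_norm.tendsto (0 : Plane 𝕜)).mono_left A.germ_le_nhds
    have h2 := ((Real.continuousAt_rpow_const 0 ((k : ℝ) - 1)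
      (Or.inr (by linarith))).tendsto.comp h1).const_mul |C|
    rw [Real.zero_rpow (by linarith), mul_zero] at h2
    exact h2
  obtain ⟨P, hP0, hP1, hP2, hP3⟩ := (A.frequently_ne_zero.and_eventually
    (h.and (hC.and (hlim.eventually (gt_mem_nhds hc))))).exists
  have hpos : 0 < ‖P‖ := norm_pos_iff.2 hP0
  have hsplit : ‖P‖ ^ (k : ℝ) = ‖P‖ ^ ((k : ℝ) - 1) * ‖P‖ := by
    conv_rhs => rw [← Real.rpow_one ‖P‖, ← Real.rpow_mul hpos.le, mul_comm]
    rw [one_mul, Real.rpow_one, mul_comm]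
    rw [← Real.rpow_add_one hpos.ne']
    ring_nf
  rw [Real.norm_of_nonneg Metric.infDist_nonneg, Real.norm_of_nonneg (by positivity), hsplit]
    at hP2
  have hq : 0 ≤ ‖P‖ ^ ((k : ℝ) - 1) := by positivity
  have : C * (‖P‖ ^ ((k : ℝ) - 1) * ‖P‖) ≤ |C| * (‖P‖ ^ ((k : ℝ) - 1) * ‖P‖) :=
    mul_le_mul_of_nonneg_right (le_abs_self C) (by positivity)
  nlinarith

end arcs

section half
variable {σ : ℤˣ} {A M : Arc ℝ}

theorem abs_apply_le_norm (P : Plane ℝ) (i : Fin 2) : |P i| ≤ ‖P‖ := PiLp.norm_apply_le P i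

theorem inHalf_of_cone {c : ℝ} (hc : 0 < c) (h : ∀ᶠ P in A.germ, c * ‖P‖ ≤ sgn σ * P 1) :
    A.InHalf σ := by
  refine ⟨?_, fun ho => ?_⟩
  · filter_upwards [h] with P hP hP0
    exact (mul_pos hc (norm_pos_iff.2 hP0)).trans_le hP
  · obtain ⟨P, hP0, hP1, hP2⟩ := (A.frequently_ne_zero.and_eventually
      (h.and (ho.bound (half_pos hc)))).exists
    have hpos : 0 < ‖P‖ := norm_pos_iff.2 hP0
    have h1 : sgn σ * P 1 ≤ |P 1| := by
      refine (le_abs_self _).trans ?_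
      rw [abs_mul, abs_sgn, one_mul]
    have h2 := abs_apply_le_norm P 0
    rw [Real.norm_eq_abs, Real.norm_eq_abs] at hP2
    nlinarith

/-- An arc either lies in a cone around the half axis, or approaches the complement of every such
cone. -/
theorem cone_dichotomy (σ : ℤˣ) (A : Arc ℝ) :
    (∃ c > 0, ∀ᶠ P in A.germ, c * ‖P‖ ≤ sgn σ * P 1) ∨
      ∀ η > 0, ∀ᶠ P in A.germ, sgn σ * P 1 ≤ η * ‖P‖ := by
  obtain ⟨γ, ⟨h1, h2, h3⟩, hg⟩ := A.exists_param
  simp only [hg, eventually_map]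
  -- `w 0` is a tangent vector of the arc; the sign of its vertical component decides between the
  -- alternatives.
  obtain ⟨n, w, hw, hw0, hwe⟩ := h1.exists_eventuallyEq_pow_smul_nonzero_iff.2 fun h =>
    h3 (h.filter_mono nhdsWithin_le_nhds)
  simp only [sub_zero] at hwe
  have hcont : ∀ c : ℝ, Tendsto (fun s => sgn σ * w s 1 - c * ‖w s‖) (𝓝 0)
      (𝓝 (sgn σ * w 0 1 - c * ‖w 0‖)) := fun c => by
    have h4 := ((EuclideanSpace.proj (𝕜 := ℝ) (1 : Fin 2)).continuous.tendsto (w 0)).comp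
      hw.continuousAt.tendsto
    exact (h4.const_mul (sgn σ)).sub (hw.continuousAt.tendsto.norm.const_mul c)
  have hpos : 0 < ‖w 0‖ := norm_pos_iff.2 hw0
  have hval : ∀ s : ℝ, 0 ≤ s → γ s = s ^ n • w s → ∀ c : ℝ,
      sgn σ * γ s 1 - c * ‖γ s‖ = s ^ n * (sgn σ * w s 1 - c * ‖w s‖) := fun s hs h c => by
    rw [h, norm_smul, Real.norm_of_nonneg (pow_nonneg hs n)]
    simp only [PiLp.smul_apply, smul_eq_mul]
    ring
  by_cases hp : 0 < sgn σ * w 0 1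
  · left
    refine ⟨sgn σ * w 0 1 / (2 * ‖w 0‖), by positivity, ?_⟩
    have h5 : 0 < sgn σ * w 0 1 - sgn σ * w 0 1 / (2 * ‖w 0‖) * ‖w 0‖ := by
      have : sgn σ * w 0 1 / (2 * ‖w 0‖) * ‖w 0‖ = sgn σ * w 0 1 / 2 := by field_simp
      rw [this]; linarith
    filter_upwards [nhdsWithin_le_nhds hwe, nhdsWithin_le_nhds
      ((hcont _).eventually (lt_mem_nhds h5)), self_mem_nhdsWithin] with s hs hs2 hs0
    have := hval s hs0 hs (sgn σ * w 0 1 / (2 * ‖w 0‖))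
    have h6 := mul_nonneg (pow_nonneg hs0 n) hs2.le
    linarith
  · right
    intro η hη
    have h5 : sgn σ * w 0 1 - η * ‖w 0‖ < 0 := by
      have := mul_pos hη hpos
      linarith
    filter_upwards [nhdsWithin_le_nhds hwe, nhdsWithin_le_nhds
      ((hcont _).eventually (gt_mem_nhds h5)), self_mem_nhdsWithin] with s hs hs2 hs0
    have := hval s hs0 hs η
    have h6 := mul_nonneg (pow_nonneg hs0 n) (neg_nonneg.2 hs2.le)
    linarith

theorem Arc.InHalf.exists_cone (h : A.InHalf σ) :
    ∃ c > 0, ∀ᶠ P in A.germ, c * ‖P‖ ≤ sgn σ * P 1 := by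
  refine (cone_dichotomy σ A).resolve_right fun hη => h.2 (isLittleO_iff.2 fun {c} hc => ?_)
  -- This aperture makes `|y| ≤ c / (1 + c) * (|x| + |y|)` equivalent to `|y| ≤ c |x|`.
  have hc' : 0 < c / (1 + c) := by positivity
  filter_upwards [hη _ hc', h.1] with P h1 h2
  by_cases hP : P = 0
  · simp [hP]
  have h3 : |P 1| = sgn σ * P 1 := by
    rw [← abs_of_pos (h2 hP), abs_mul, abs_sgn, one_mul]
  have h4 : ‖P‖ ≤ |P 0| + |P 1| := by
    have := norm_vec_le (P 0) (P 1)
    have hPv : !₂[P 0, P 1] = P := by ext i; fin_cases i <;> rfl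
    rwa [hPv] at this
  rw [Real.norm_eq_abs, Real.norm_eq_abs]
  rw [← h3, div_mul_eq_mul_div, le_div_iff₀ (by positivity)] at h1
  nlinarith

theorem dist_cone {P Q : Plane ℝ} {c : ℝ} (hc : 0 < c) (hP : c * ‖P‖ ≤ sgn σ * P 1)
    (hQ : sgn σ * Q 1 ≤ c / 2 * ‖Q‖) :
    c / (2 + 2 * c) * ‖P‖ ≤ dist P Q ∧ c / (2 + 2 * c) * ‖Q‖ ≤ dist P Q := by
  have h1 : sgn σ * P 1 - sgn σ * Q 1 ≤ dist P Q := by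
    rw [← mul_sub, dist_eq_norm]
    refine (le_abs_self _).trans ?_
    rw [abs_mul, abs_sgn, one_mul]
    exact abs_apply_le_norm (P - Q) 1
  have h2 : ‖Q‖ ≤ ‖P‖ + dist P Q := by
    rw [dist_comm, dist_eq_norm]
    have := norm_add_le P (Q - P)
    rwa [add_sub_cancel] at this
  have h3 : ‖P‖ ≤ ‖Q‖ + dist P Q := by
    rw [dist_eq_norm]
    have := norm_add_le Q (P - Q)
    rwa [add_sub_cancel] at this
  have hd : 0 ≤ dist P Q := dist_nonneg
  constructor <;> rw [div_mul_eq_mul_div, div_le_iff₀ (by positivity)] <;> nlinarith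

/-- One arc lies in a cone around the half axis and the other eventually stays outside a wider cone,
so distances between their points are comparable to the norms. Hence equivalence of arcs cannot
leave the half plane. -/
theorem contactOrder_le_one_of_inHalf (hA : A.InHalf σ) (hM : ¬ M.InHalf σ) :
    contactOrder A.germ M.germ ≤ 1 ∧ contactOrder M.germ A.germ ≤ 1 := by
  obtain ⟨c, hc, hcone⟩ := hA.exists_cone
  have hM' := ((cone_dichotomy σ M).resolve_left fun ⟨c, hc, h⟩ => hM (inHalf_of_cone hc h))
    (c / 2) (half_pos hc)
  have hc' : 0 < c / (2 + 2 * c) := by positivity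
  constructor
  · refine contactOrder_le_one hc' hM' (hcone.mono fun P hP => ?_)
    exact (Metric.le_infDist ⟨0, M.zero_mem hM'⟩).2 fun Q hQ => (dist_cone hc hP hQ).1
  · refine contactOrder_le_one hc' hcone (hM'.mono fun Q hQ => ?_)
    exact (Metric.le_infDist ⟨0, A.zero_mem hcone⟩).2 fun P hP => by
      rw [dist_comm]; exact (dist_cone hc hP hQ).2

end half

/-- A fractional power series that is `O (y)`: the graph is an arc that is not tangent to the
`x`-axis. -/
def IsTransverse (φ : ℝ → ℝ) : Prop :=
  IsFractionalSeries φ ∧ φ =O[𝓝[≥] (0 : ℝ)] fun y : ℝ => y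

theorem IsTransverse.apply_zero {φ : ℝ → ℝ} (h : IsTransverse φ) : φ 0 = 0 := by
  obtain ⟨C, hC⟩ := h.2.bound
  simpa using (eventually_nhdsGE_iff.1 hC).1

theorem IsTransverse.exists_arc {φ : ℝ → ℝ} (h : IsTransverse φ) (σ : ℤˣ) :
    ∃ A : Arc ℝ, Represents σ A φ := by
  obtain ⟨A, hA⟩ := exists_arc_graph h.1 h.apply_zero (l := sgn σ • ContinuousLinearMap.id ℝ ℝ)
    (by simpa using sgn_ne_zero σ)
  exact ⟨A, h.1, by simpa using hA⟩

theorem Represents.inHalf_iff {σ : ℤˣ} {A : Arc ℝ} {φ : ℝ → ℝ} (h : Represents σ A φ) :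
    A.InHalf σ ↔ IsTransverse φ := by
  constructor
  · intro hA
    obtain ⟨c, hc, hcone⟩ := hA.exists_cone
    rw [h.2, eventually_map] at hcone
    refine ⟨h.1, IsBigO.of_bound c⁻¹ ?_⟩
    filter_upwards [hcone, self_mem_nhdsWithin] with y hy hy0
    have h1 := abs_apply_le_norm (!₂[φ y, sgn σ * y]) 0
    simp only [Matrix.cons_val_zero, Matrix.cons_val_one, ← mul_assoc,
      sgn_mul_self, one_mul] at h1 hy
    rw [Real.norm_eq_abs, Real.norm_of_nonneg hy0, inv_mul_eq_div, le_div_iff₀ hc]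
    nlinarith
  · intro hφ
    obtain ⟨C, hC0, hC⟩ := hφ.2.exists_pos
    refine inHalf_of_cone (c := (C + 1)⁻¹) (by positivity) ?_
    rw [h.2, eventually_map]
    filter_upwards [hC.bound, self_mem_nhdsWithin] with y hy hy0
    have h1 := norm_vec_le (φ y) (sgn σ * y)
    have hy1 : sgn σ * (!₂[φ y, sgn σ * y] : Plane ℝ) 1 = y := by
      simp [← mul_assoc, sgn_mul_self]
    rw [hy1, inv_mul_le_iff₀ (by positivity)]
    rw [norm_mul, Real.norm_eq_abs (sgn σ), abs_sgn, one_mul] at h1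
    rw [Real.norm_of_nonneg hy0] at h1 hy
    linarith

theorem analyticAt_rpow_const {v : ℝ → ℝ} {x : ℝ} (hv : AnalyticAt ℝ v x) (hpos : 0 < v x)
    (q : ℝ) : AnalyticAt ℝ (fun s => v s ^ q) x := by
  refine ((hv.log hpos).mul (analyticAt_const (v := q))).rexp.congr ?_
  filter_upwards [hv.continuousAt.eventually (lt_mem_nhds hpos)] with s hs
  exact (Real.rpow_def_of_pos hs q).symm

/-- Every arc in a half plane that is not tangent to the `x`-axis is a graph. -/
theorem Arc.InHalf.exists_represents {σ : ℤˣ} {A : Arc ℝ} (hA : A.InHalf σ) :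
    ∃ φ, Represents σ A φ := by
  obtain ⟨c, hc, hcone⟩ := hA.exists_cone
  obtain ⟨γ, ⟨h1, h2, h3⟩, hg⟩ := A.exists_param
  rw [hg, eventually_map] at hcone
  set Y : ℝ → ℝ := fun s => sgn σ * γ s 1 with hY
  have hYa : AnalyticAt ℝ Y 0 :=
    analyticAt_const.mul (((EuclideanSpace.proj (𝕜 := ℝ) (1 : Fin 2)).analyticAt _).comp h1)
  obtain ⟨d, v, hv, hv0, hve⟩ := hYa.exists_eventuallyEq_pow_smul_nonzero_iff.2 fun h => h3 (by
    filter_upwards [hcone, nhdsWithin_le_nhds h] with s hs hs0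
    have hs0 : sgn σ * γ s 1 = 0 := hs0
    rw [hs0] at hs
    exact norm_le_zero_iff.1 (nonpos_of_mul_nonpos_right hs hc))
  simp only [sub_zero, smul_eq_mul] at hve
  have hd : 0 < d := Nat.pos_of_ne_zero fun h => hv0 (by
    have := hve.self_of_nhds
    simpa [hY, h2, h] using this.symm)
  have hvpos : 0 < v 0 := by
    refine lt_of_le_of_ne ?_ hv0.symm
    have hvt : Tendsto v (𝓝[>] 0) (𝓝 (v 0)) :=
      hv.continuousAt.tendsto.mono_left nhdsWithin_le_nhds
    refine ge_of_tendsto hvt ?_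
    filter_upwards [hcone.filter_mono (nhdsWithin_mono _ Set.Ioi_subset_Ici_self),
      nhdsWithin_le_nhds hve, self_mem_nhdsWithin] with s hs hs1 hs0
    have : 0 ≤ Y s := (by positivity : 0 ≤ c * ‖γ s‖).trans hs
    rw [hs1] at this
    exact nonneg_of_mul_nonneg_right this (pow_pos hs0 d)
  -- Since `Y = s ^ d v` with `v 0 > 0`, the function `w = s v ^ (1 / d)` satisfies `Y = w ^ d` near
  -- `0` and is locally invertible. Its inverse `g` reparametrizes the arc so that the height
  -- becomes exactly `t ^ d`.
  set ρ : ℝ → ℝ := fun s => v s ^ (d : ℝ)⁻¹ with hρ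
  have hρa : AnalyticAt ℝ ρ 0 := analyticAt_rpow_const hv hvpos _
  have hρ0 : 0 < ρ 0 := Real.rpow_pos_of_pos hvpos _
  set w : ℝ → ℝ := fun s => s * ρ s with hw
  have hwa : AnalyticAt ℝ w 0 := analyticAt_id.mul hρa
  have hw0 : w 0 = 0 := by simp [hw]
  have hwd : deriv w 0 ≠ 0 := by
    have := (hasDerivAt_id (0 : ℝ)).mul hρa.differentiableAt.hasDerivAt
    have h5 : deriv w 0 = 1 * ρ 0 + id 0 * deriv ρ 0 := this.deriv
    rw [h5]; simpa using hρ0.ne'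
  set g := hwa.hasStrictDerivAt.localInverse _ _ _ hwd with hgdef
  have hga : AnalyticAt ℝ g 0 := by
    have := hwa.analyticAt_localInverse hwd
    rwa [hw0] at this
  have hgw : ∀ᶠ s in 𝓝 (0 : ℝ), g (w s) = s := HasStrictFDerivAt.eventually_left_inverse _
  have hwg : ∀ᶠ t in 𝓝 (0 : ℝ), w (g t) = t := by
    have := HasStrictFDerivAt.eventually_right_inverse
      (hwa.hasStrictDerivAt.hasStrictFDerivAt_equiv hwd)
    rwa [hw0] at this
  have hg0 : g 0 = 0 := by simpa [hw0] using hgw.self_of_nhds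
  have hgt : Tendsto g (𝓝 0) (𝓝 0) := by simpa [ContinuousAt, hg0] using hga.continuousAt
  have hwt : Tendsto w (𝓝 0) (𝓝 0) := by simpa [ContinuousAt, hw0] using hwa.continuousAt
  have hρpos : ∀ᶠ s in 𝓝 (0 : ℝ), 0 < ρ s := hρa.continuousAt.eventually (lt_mem_nhds hρ0)
  have hgGE : Tendsto g (𝓝[≥] 0) (𝓝[≥] 0) := by
    refine tendsto_nhdsWithin_iff.2 ⟨hgt.mono_left nhdsWithin_le_nhds, ?_⟩
    filter_upwards [nhdsWithin_le_nhds hwg, nhdsWithin_le_nhds (hgt.eventually hρpos),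
      self_mem_nhdsWithin] with t ht1 ht2 ht0
    have ht0 : 0 ≤ t := ht0
    rw [← ht1] at ht0
    exact nonneg_of_mul_nonneg_left ht0 ht2
  have hwGE : Tendsto w (𝓝[≥] 0) (𝓝[≥] 0) := by
    refine tendsto_nhdsWithin_iff.2 ⟨hwt.mono_left nhdsWithin_le_nhds, ?_⟩
    filter_upwards [nhdsWithin_le_nhds hρpos, self_mem_nhdsWithin] with s hs hs0
    exact mul_nonneg hs0 hs.le
  have hmapg : Filter.map g (𝓝[≥] 0) = 𝓝[≥] 0 := by
    refine le_antisymm hgGE ?_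
    calc 𝓝[≥] (0 : ℝ) = Filter.map (g ∘ w) (𝓝[≥] 0) := by
          refine (Filter.map_id.symm).trans (Filter.map_congr ?_)
          filter_upwards [nhdsWithin_le_nhds hgw] with s hs
          exact hs.symm
      _ = Filter.map g (Filter.map w (𝓝[≥] 0)) := by rw [Filter.map_map]
      _ ≤ Filter.map g (𝓝[≥] 0) := Filter.map_mono hwGE
  have hYg : ∀ᶠ t in 𝓝 (0 : ℝ), Y (g t) = t ^ d := by
    have hvp : ∀ᶠ s in 𝓝 (0 : ℝ), 0 < v s := hv.continuousAt.eventually (lt_mem_nhds hvpos)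
    filter_upwards [hwg, hgt.eventually hve, hgt.eventually hvp] with t ht1 ht2 ht3
    rw [ht2]
    conv_rhs => rw [← ht1]
    simp only [hw, hρ]
    rw [mul_pow, rpow_inv_pow hd ht3.le]
  refine ⟨fun y => γ (g (y ^ (d : ℝ)⁻¹)) 0, ⟨d, hd, fun t => γ (g t) 0, ?_, ?_⟩, ?_⟩
  · refine ((EuclideanSpace.proj (𝕜 := ℝ) (0 : Fin 2)).analyticAt _).comp
      (AnalyticAt.comp (g := γ) (f := g) (by rwa [hg0]) hga)
  · filter_upwards [self_mem_nhdsWithin] with t ht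
    rw [Real.pow_rpow_inv_natCast ht hd.ne']
  · rw [hg]
    conv_lhs => rw [← hmapg]
    conv_rhs => rw [← map_pow_nhdsGE hd]
    rw [Filter.map_map, Filter.map_map]
    refine Filter.map_congr ?_
    filter_upwards [nhdsWithin_le_nhds hYg, self_mem_nhdsWithin] with t ht ht0
    simp only [Function.comp_apply]
    rw [Real.pow_rpow_inv_natCast ht0 hd.ne', ← ht, hY]
    simp only [← mul_assoc, sgn_mul_self, one_mul]
    ext i; fin_cases i <;> rfl

end EnrichedLine
end

/-! ### The contact order of graphs. -/

noncomputable section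
namespace EnrichedLine

theorem fracOrd_le_contactOrder {𝕜 𝕂 : Type} [RCLike 𝕜] [RCLike 𝕂] {P : ℝ → Plane 𝕜} {δ : ℝ → 𝕂}
    {μ : Filter (Plane 𝕜)} (hP : ∀ᶠ y in 𝓝[≥] (0 : ℝ), y ≤ ‖P y‖) (hδ : δ 0 = 0)
    (h : ∀ T ∈ μ, ∀ᶠ y in 𝓝[≥] (0 : ℝ), Metric.infDist (P y) T ≤ ‖δ y‖) :
    fracOrd δ ≤ contactOrder (Filter.map P (𝓝[≥] 0)) μ := by
  refine iSup₂_le fun k hk => le_iSup₂_of_le k (fun T hT => ?_) le_rfl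
  obtain ⟨C, hC0, hC⟩ := hk.exists_pos
  rw [isBigO_map]
  refine IsBigO.of_bound C ?_
  have hδC : ∀ᶠ y in 𝓝[≥] (0 : ℝ), ‖δ y‖ ≤ C * y ^ (k : ℝ) := by
    refine eventually_nhdsGE_iff.2 ⟨?_, ?_⟩
    · rw [hδ, norm_zero]
      exact mul_nonneg hC0.le (Real.rpow_nonneg le_rfl _)
    · filter_upwards [hC.bound, self_mem_nhdsWithin] with y hy hy0
      rwa [Real.norm_of_nonneg (Real.rpow_nonneg (le_of_lt hy0) _)] at hy
  filter_upwards [hP, h T hT, hδC, self_mem_nhdsWithin] with y h1 h2 h3 hy0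
  have hy0 : 0 ≤ y := hy0
  simp only [Function.comp_apply]
  rw [Real.norm_of_nonneg Metric.infDist_nonneg, Real.norm_of_nonneg (by positivity)]
  refine h2.trans (h3.trans (mul_le_mul_of_nonneg_left ?_ hC0.le))
  exact Real.rpow_le_rpow hy0 h1 k.2

/-- If `k` exceeded all the orders, `y ^ k` would be negligible against every `δ i` simultaneously,
as there are finitely many. So the index in the lower bound for the distance may depend on `y`, as
it must when distances to several roots are compared. -/
theorem contactOrder_le_iSup_fracOrd {𝕜 𝕂 ι : Type} [RCLike 𝕜] [RCLike 𝕂] [Finite ι]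
    {P : ℝ → Plane 𝕜} {δ : ι → ℝ → 𝕂} (hδ : ∀ i, IsFractionalSeries (δ i)) {μ : Filter (Plane 𝕜)}
    (hP : P =O[𝓝[≥] 0] fun y : ℝ => y) {c : ℝ} (hc : 0 < c) {T : Set (Plane 𝕜)} (hT : T ∈ μ)
    (h : ∀ᶠ y in 𝓝[≥] (0 : ℝ), ∃ i, c * ‖δ i y‖ ≤ Metric.infDist (P y) T) :
    contactOrder (Filter.map P (𝓝[≥] 0)) μ ≤ ⨆ i, fracOrd (δ i) := by
  refine iSup₂_le fun k hk => ?_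
  by_contra hlt
  rw [not_le] at hlt
  have hsmall : ∀ ε > 0, ∀ᶠ y in 𝓝[>] (0 : ℝ), ∀ i, y ^ (k : ℝ) ≤ ε * ‖δ i y‖ := fun ε hε => by
    refine Filter.eventually_all.2 fun i => ?_
    have hi : fracOrd (δ i) < k := (le_iSup (fun i => fracOrd (δ i)) i).trans_lt hlt
    obtain ⟨q, hq, a, ha, hl, hqe⟩ := exists_leading_of_fracOrd_ne_top (hδ i) hi.ne_top
    have hqk : (q : ℝ) < k := by
      rw [hqe, ← ENNReal.ofReal_coe_nnreal] at hi
      exact (ENNReal.ofReal_lt_ofReal_iff_of_nonneg (by exact_mod_cast hq)).1 hi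
    have h1 : (fun y : ℝ => y ^ (k : ℝ)) =o[𝓝[>] 0] δ i := by
      refine IsLittleO.trans_isBigO ?_ (hl.isBigO_symm ha)
      have := hasLeading_iff_isLittleO.1 ((hasLeading_monomial (1 : ℝ) (k : ℝ)).of_lt hqk)
      simpa using this
    filter_upwards [h1.bound hε, self_mem_nhdsWithin] with y hy hy0
    rwa [Real.norm_of_nonneg (Real.rpow_nonneg (le_of_lt hy0) _)] at hy
  obtain ⟨C, hC0, hC⟩ := (isBigO_map.1 (hk T hT)).exists_pos
  obtain ⟨D, hD0, hD⟩ := hP.exists_pos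
  have hDk : 0 < D ^ (k : ℝ) := Real.rpow_pos_of_pos hD0 _
  -- Chosen so that the two bounds combine to `c ‖δ i y‖ ≤ (c / 2) ‖δ i y‖`.
  set ε := c / (2 * (C * D ^ (k : ℝ))) with hε
  have hε0 : 0 < ε := by positivity
  have hle : 𝓝[>] (0 : ℝ) ≤ 𝓝[≥] 0 := nhdsWithin_mono _ Set.Ioi_subset_Ici_self
  obtain ⟨y, ⟨i, h1⟩, h2, h3, h4, hy⟩ := ((h.filter_mono hle).and ((hC.bound.filter_mono hle).and
    ((hD.bound.filter_mono hle).and ((hsmall ε hε0).and self_mem_nhdsWithin)))).exists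
  have hy : 0 < y := hy
  simp only [Function.comp_apply] at h2
  rw [Real.norm_of_nonneg Metric.infDist_nonneg, Real.norm_of_nonneg (by positivity)] at h2
  rw [Real.norm_of_nonneg hy.le] at h3
  have h5 : ‖P y‖ ^ (k : ℝ) ≤ D ^ (k : ℝ) * y ^ (k : ℝ) := by
    rw [← Real.mul_rpow hD0.le hy.le]
    exact Real.rpow_le_rpow (norm_nonneg _) h3 k.2
  have h6 := h4 i
  have hyk := Real.rpow_pos_of_pos hy (k : ℝ)
  have h7 : c * ‖δ i y‖ ≤ C * D ^ (k : ℝ) * (ε * ‖δ i y‖) := by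
    refine h1.trans (h2.trans ?_)
    rw [mul_assoc]
    refine mul_le_mul_of_nonneg_left (h5.trans ?_) hC0.le
    exact mul_le_mul_of_nonneg_left h6 hDk.le
  have h8 : C * D ^ (k : ℝ) * (ε * ‖δ i y‖) = c / 2 * ‖δ i y‖ := by
    rw [hε]; field_simp
  have h9 : 0 < ‖δ i y‖ := pos_of_mul_pos_right (hyk.trans_le h6) hε0.le
  nlinarith

/-- The order of vanishing of an analytic germ is already visible on the positive real ray. -/
theorem exists_eq_pow_smul {𝕜 E : Type} [RCLike 𝕜] [NormedAddCommGroup E] [NormedSpace 𝕜 E]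
    {a : 𝕜 → E} (ha : AnalyticAt 𝕜 a 0) {d : ℕ}
    (hO : (fun t : ℝ => a (t : 𝕜)) =O[𝓝[>] 0] fun t : ℝ => t ^ d) :
    ∃ c : 𝕜 → E, AnalyticAt 𝕜 c 0 ∧ ∀ᶠ z in 𝓝 (0 : 𝕜), a z = z ^ d • c z := by
  by_cases h : ∀ᶠ z in 𝓝 (0 : 𝕜), a z = 0
  · exact ⟨fun _ => 0, analyticAt_const, by simpa using h⟩
  obtain ⟨n, g, hg, hg0, hge⟩ := ha.exists_eventuallyEq_pow_smul_nonzero_iff.2 h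
  simp only [sub_zero] at hge
  have hcast : Tendsto (fun t : ℝ => (t : 𝕜)) (𝓝[>] 0) (𝓝 0) := by
    have := (RCLike.continuous_ofReal (K := 𝕜)).tendsto 0
    rw [RCLike.ofReal_zero] at this
    exact this.mono_left nhdsWithin_le_nhds
  have h1 : (fun t : ℝ => t ^ (n : ℝ)) =O[𝓝[>] 0] fun t : ℝ => t ^ (d : ℝ) := by
    simp only [Real.rpow_natCast]
    refine IsBigO.trans ?_ hO
    refine IsBigO.of_bound (2 / ‖g 0‖) ?_
    have hpos : 0 < ‖g 0‖ := norm_pos_iff.2 hg0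
    filter_upwards [hcast.eventually hge, hcast.eventually (hg.continuousAt.norm.eventually
      (lt_mem_nhds (half_lt_self hpos)))] with t h1 h2
    rw [h1, norm_smul, norm_pow, norm_pow, RCLike.norm_ofReal, Real.norm_eq_abs,
      div_mul_eq_mul_div, le_div_iff₀ hpos]
    have := pow_nonneg (abs_nonneg t) n
    nlinarith
  have hdn : d ≤ n := by exact_mod_cast rpow_isBigO_rpow_iff.1 h1
  refine ⟨fun z => z ^ (n - d) • g z, (analyticAt_id.pow _).smul hg, ?_⟩
  filter_upwards [hge] with z hz
  rw [hz, smul_smul, ← pow_add, Nat.add_sub_cancel' hdn]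

theorem pow_mul_abs_sub_le {s t : ℝ} (hs : 0 ≤ s) (ht : 0 ≤ t) {d : ℕ} (hd : 0 < d) :
    t ^ d * |s - t| ≤ t * |s ^ d - t ^ d| := by
  obtain ⟨k, rfl⟩ := Nat.exists_eq_succ_of_ne_zero hd.ne'
  have h1 := (Commute.all s t).geom_sum₂_mul (k + 1)
  have h2 : t ^ k ≤ ∑ i ∈ Finset.range (k + 1), s ^ i * t ^ (k + 1 - 1 - i) := by
    have := Finset.single_le_sum (f := fun i => s ^ i * t ^ (k + 1 - 1 - i))
      (s := Finset.range (k + 1)) (fun i _ => by positivity) (Finset.mem_range.2 k.succ_pos)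
    simpa using this
  rw [← h1, abs_mul, pow_succ', mul_assoc]
  refine mul_le_mul_of_nonneg_left ?_ ht
  exact mul_le_mul_of_nonneg_right (h2.trans (le_abs_self _)) (abs_nonneg _)

/-- Being `O(y)`, the series has the form `ψ(y) = y c(y ^ (1 / d))` with `c` analytic. The root is
not Lipschitz at `0`, but the factor `y` compensates for it by `pow_mul_abs_sub_le`. -/
theorem IsTransverse.exists_lipschitz {ψ : ℝ → ℝ} (hψ : IsTransverse ψ) :
    ∃ C > 0, ∃ ε > 0, ∀ y ∈ Set.Ico (0 : ℝ) ε, ∀ z ∈ Set.Ico (0 : ℝ) ε,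
      |ψ y - ψ z| ≤ C * |y - z| := by
  obtain ⟨⟨d, hd, b, hb, hbe⟩, hO⟩ := hψ
  have hbO : (fun t : ℝ => b t) =O[𝓝[>] 0] fun t : ℝ => t ^ d := by
    have h1 := (hO.comp_tendsto (tendsto_pow_nhdsGE hd)).mono
      (nhdsWithin_mono _ Set.Ioi_subset_Ici_self)
    refine IsBigO.congr' h1 ?_ (EventuallyEq.refl _ _)
    exact hbe.filter_mono (nhdsWithin_mono _ Set.Ioi_subset_Ici_self)
  obtain ⟨c, hc, hbc⟩ := exists_eq_pow_smul (𝕜 := ℝ) hb (by simpa using hbO)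
  obtain ⟨K, s, hs, hK⟩ := hc.hasStrictFDerivAt.exists_lipschitzOnWith
  have hM : ∀ᶠ t in 𝓝 (0 : ℝ), |c t| < |c 0| + 1 :=
    hc.continuousAt.abs.eventually (gt_mem_nhds (lt_add_one _))
  obtain ⟨r, hr, hball⟩ := Metric.eventually_nhds_iff_ball.1 ((hbc.and hM).and hs)
  have hbe' : ∀ᶠ t in 𝓝[≥] (0 : ℝ), t ∈ Metric.ball 0 (min r 1) ∧ ψ (t ^ d) = b t := by
    filter_upwards [nhdsWithin_le_nhds (Metric.ball_mem_nhds (0 : ℝ) (lt_min hr one_pos)), hbe]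
      with t h1 h2 using ⟨h1, h2⟩
  have hroot : ∀ᶠ y in 𝓝[≥] (0 : ℝ), y ^ (d : ℝ)⁻¹ ∈ Metric.ball (0 : ℝ) (min r 1) ∧
      ψ ((y ^ (d : ℝ)⁻¹) ^ d) = b (y ^ (d : ℝ)⁻¹) :=
    (tendsto_rpow_nhdsGE (by positivity)).eventually hbe'
  obtain ⟨ε, hε, hsub⟩ := mem_nhdsGE_iff_exists_Ico_subset.1 hroot
  refine ⟨|c 0| + 1 + K, by positivity, ε, hε, fun y hy z hz => ?_⟩
  obtain ⟨hy1, hy2⟩ := hsub hy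
  obtain ⟨hz1, hz2⟩ := hsub hz
  rw [rpow_inv_pow hd hy.1] at hy2
  rw [rpow_inv_pow hd hz.1] at hz2
  have hsy : 0 ≤ y ^ (d : ℝ)⁻¹ := Real.rpow_nonneg hy.1 _
  have htz : 0 ≤ z ^ (d : ℝ)⁻¹ := Real.rpow_nonneg hz.1 _
  have hyd := rpow_inv_pow hd hy.1
  have hzd := rpow_inv_pow hd hz.1
  set s' := y ^ (d : ℝ)⁻¹
  set t' := z ^ (d : ℝ)⁻¹
  have hs1 := hball s' (Metric.ball_subset_ball (min_le_left _ _) hy1)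
  have ht1 := hball t' (Metric.ball_subset_ball (min_le_left _ _) hz1)
  have ht'1 : t' ≤ 1 := by
    have := (mem_ball_zero_iff.1 hz1).le.trans (min_le_right _ _)
    rwa [Real.norm_of_nonneg htz] at this
  have hlip : |c s' - c t'| ≤ K * |s' - t'| := hK.dist_le_mul _ hs1.2 _ ht1.2
  have hmain := pow_mul_abs_sub_le hsy htz hd
  rw [hy2, hz2, hs1.1.1, ht1.1.1, smul_eq_mul, smul_eq_mul, hyd, hzd]
  rw [hyd, hzd] at hmain
  have hsplit : y * c s' - z * c t' = (y - z) * c s' + z * (c s' - c t') := by ring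
  rw [hsplit]
  refine (abs_add_le _ _).trans ?_
  rw [abs_mul, abs_mul, abs_of_nonneg hz.1, add_mul, mul_comm |y - z|]
  refine add_le_add (mul_le_mul_of_nonneg_right hs1.1.2.le (abs_nonneg _)) ?_
  calc z * |c s' - c t'| ≤ z * (K * |s' - t'|) := mul_le_mul_of_nonneg_left hlip hz.1
    _ = K * (z * |s' - t'|) := by ring
    _ ≤ K * (t' * |y - z|) := mul_le_mul_of_nonneg_left hmain K.2
    _ ≤ K * (1 * |y - z|) := by gcongr
    _ = K * |y - z| := by rw [one_mul]

/-- The contact order of two graphs is the order of the difference of their series. -/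
theorem contactOrder_eq_fracOrd {σ : ℤˣ} {A M : Arc ℝ} {φ ψ : ℝ → ℝ} (hA : Represents σ A φ)
    (hM : Represents σ M ψ) (hφ : IsTransverse φ) (hψ : IsTransverse ψ) :
    contactOrder A.germ M.germ = fracOrd fun y => φ y - ψ y := by
  rw [hA.2]
  have hnorm : ∀ y, |y| ≤ ‖(!₂[φ y, sgn σ * y] : Plane ℝ)‖ := fun y => by
    have := abs_apply_le_norm (!₂[φ y, sgn σ * y]) 1
    simpa [abs_mul, abs_sgn] using this
  have hdist : ∀ y z, ‖φ y - ψ z‖ ≤ dist (!₂[φ y, sgn σ * y] : Plane ℝ) !₂[ψ z, sgn σ * z] ∧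
      |y - z| ≤ dist (!₂[φ y, sgn σ * y] : Plane ℝ) !₂[ψ z, sgn σ * z] := fun y z => by
    rw [dist_eq_norm]
    constructor
    · simpa using abs_apply_le_norm (!₂[φ y, sgn σ * y] - !₂[ψ z, sgn σ * z]) 0
    · have := abs_apply_le_norm (!₂[φ y, sgn σ * y] - !₂[ψ z, sgn σ * z]) 1
      simpa [← mul_sub, abs_mul, abs_sgn] using this
  refine le_antisymm ?_ (fracOrd_le_contactOrder (.of_forall fun y => (le_abs_self y).trans
    (hnorm y)) (by rw [hφ.apply_zero, hψ.apply_zero, sub_zero]) fun T hT => ?_)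
  -- The horizontal gap controls the distance: `|φ y - ψ y| ≤ |φ y - ψ z| + C |y - z|`, which is at
  -- most `1 + C` times the distance to the point over `z`.
  · obtain ⟨C, hC, ε, hε, hlip⟩ := hψ.exists_lipschitz
    have hbig : (fun y : ℝ => (!₂[φ y, sgn σ * y] : Plane ℝ)) =O[𝓝[≥] 0] fun y : ℝ => y := by
      have h1 := hφ.2.norm_left.add (isBigO_refl (fun y : ℝ => y) (𝓝[≥] 0)).norm_left
      refine IsBigO.trans (IsBigO.of_bound 1 (.of_forall fun y => ?_)) h1
      rw [one_mul, Real.norm_of_nonneg (by positivity)]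
      refine (norm_vec_le _ _).trans ?_
      rw [norm_mul, Real.norm_eq_abs (sgn σ), abs_sgn, one_mul]
    have hT : (fun y : ℝ => (!₂[ψ y, sgn σ * y] : Plane ℝ)) '' Set.Ico 0 ε ∈ M.germ := by
      rw [hM.2]
      exact Filter.image_mem_map (Ico_mem_nhdsGE hε)
    refine (contactOrder_le_iSup_fracOrd (ι := Unit) (δ := fun _ y => φ y - ψ y)
      (fun _ => hφ.1.sub hψ.1) hbig (c := (1 + C)⁻¹) (by positivity) hT ?_).trans (by simp)
    filter_upwards [Ico_mem_nhdsGE hε] with y hy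
    refine ⟨(), (Metric.le_infDist ⟨_, M.zero_mem hT⟩).2 ?_⟩
    rintro _ ⟨z, hz, rfl⟩
    rw [inv_mul_le_iff₀ (by positivity)]
    have h1 := norm_add_le (φ y - ψ z) (ψ z - ψ y)
    rw [sub_add_sub_cancel] at h1
    have h2 := hlip z hz y hy
    rw [abs_sub_comm z y] at h2
    obtain ⟨h3, h4⟩ := hdist y z
    have h5 : ‖ψ z - ψ y‖ = |ψ z - ψ y| := rfl
    have := mul_le_mul_of_nonneg_left h4 hC.le
    linarith
  · rw [hM.2, Filter.mem_map] at hT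
    filter_upwards [hT] with y hy
    have hy : (!₂[ψ y, sgn σ * y] : Plane ℝ) ∈ T := hy
    refine (Metric.infDist_le_dist_of_mem hy).trans ?_
    rw [dist_eq_norm]
    have h1 : (!₂[φ y, sgn σ * y] : Plane ℝ) - !₂[ψ y, sgn σ * y] = !₂[φ y - ψ y, 0] := by
      ext i; fin_cases i <;> simp
    rw [h1]
    simpa using norm_vec_le (φ y - ψ y) (0 : ℝ)

end EnrichedLine
end

/-! ### Systems of Newton–Puiseux roots. -/

noncomputable section
namespace EnrichedLine

/-- Simultaneous control of analytic germs divisible by `t ^ d` under a change of `t ^ d`. -/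
theorem exists_near_root {n : ℕ} {a : Fin n → ℂ → ℂ} (ha : ∀ i, AnalyticAt ℂ (a i) 0) {d : ℕ}
    (hd : 0 < d) (hO : ∀ i, (fun t : ℝ => a i t) =O[𝓝[>] 0] fun t : ℝ => t ^ d) :
    ∃ C > 0, ∀ᶠ q in 𝓝[≥] (0 : ℝ) ×ˢ 𝓝 (0 : ℂ), ∃ τ : ℂ, τ ^ d = q.2 ∧
      ∀ i, ‖a i τ - a i q.1‖ ≤ C * ‖q.2 - (q.1 : ℂ) ^ d‖ := by
  obtain ⟨c, hc, hac⟩ := exists_eq_pow_smul (𝕜 := ℂ) (a := fun z i => a i z)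
    (analyticAt_pi_iff.2 ha) (d := d) (isBigO_pi.2 hO)
  obtain ⟨K, s, hs, hK⟩ := hc.hasStrictFDerivAt.exists_lipschitzOnWith
  set M := ‖c 0‖ + 1 with hMdef
  have hM0 : 0 < M := by positivity
  have hM : ∀ᶠ z in 𝓝 (0 : ℂ), ‖c z‖ < M :=
    hc.continuousAt.norm.eventually (gt_mem_nhds (lt_add_one _))
  obtain ⟨r, hr, hball⟩ := Metric.eventually_nhds_iff_ball.1 ((hac.and hM).and hs)
  -- The principal `d`-th root satisfies a Lipschitz bound at `1`, on a ball of radius `η`.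
  have hpow : HasDerivAt (fun z : ℂ => z ^ ((d : ℂ)⁻¹)) _ 1 :=
    (hasDerivAt_id (1 : ℂ)).cpow_const (by simp)
  obtain ⟨K₂, hK₂0, hK₂⟩ := hpow.isBigO_sub.exists_pos
  obtain ⟨η, hη, hηball⟩ := Metric.eventually_nhds_iff_ball.1 hK₂.bound
  have hfst : ∀ᶠ q in 𝓝[≥] (0 : ℝ) ×ˢ 𝓝 (0 : ℂ), 0 ≤ q.1 ∧ q.1 < r := by
    have : ∀ᶠ t in 𝓝[≥] (0 : ℝ), 0 ≤ t ∧ t < r := by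
      filter_upwards [self_mem_nhdsWithin, nhdsWithin_le_nhds (gt_mem_nhds hr)] with t h1 h2
      exact ⟨h1, h2⟩
    exact tendsto_fst.eventually this
  have hsnd : ∀ᶠ q in 𝓝[≥] (0 : ℝ) ×ˢ 𝓝 (0 : ℂ), ‖q.2‖ < r ^ d := by
    have : ∀ᶠ w in 𝓝 (0 : ℂ), ‖w‖ < r ^ d := by
      have := (continuous_norm (E := ℂ)).tendsto 0
      rw [norm_zero] at this
      exact this.eventually (gt_mem_nhds (pow_pos hr d))
    exact tendsto_snd.eventually this
  refine ⟨M * (1 + 2 / η) + (M + K * (r * K₂)), by positivity, ?_⟩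
  filter_upwards [hfst, hsnd] with ⟨t, w⟩ ⟨ht0, htr⟩ hw
  simp only at ht0 htr hw ⊢
  have hsmall : ∀ τ : ℂ, τ ^ d = w → τ ∈ Metric.ball (0 : ℂ) r := fun τ hτ => by
    rw [mem_ball_zero_iff]
    refine lt_of_pow_lt_pow_left₀ d hr.le ?_
    rwa [← norm_pow, hτ]
  have ht : (t : ℂ) ∈ Metric.ball (0 : ℂ) r := by
    rw [mem_ball_zero_iff, Complex.norm_real, Real.norm_of_nonneg ht0]; exact htr
  obtain ⟨⟨ht1, ht2⟩, ht3⟩ := hball _ ht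
  have htd : ‖(t : ℂ) ^ d‖ = t ^ d := by
    rw [norm_pow, Complex.norm_real, Real.norm_of_nonneg ht0]
  set D := ‖w - (t : ℂ) ^ d‖ with hD
  have hD0 : 0 ≤ D := norm_nonneg _
  suffices h : ∃ τ : ℂ, τ ^ d = w ∧ ‖τ ^ d • c τ - (t : ℂ) ^ d • c t‖ ≤
      (M * (1 + 2 / η) + (M + K * (r * K₂))) * D by
    obtain ⟨τ, hτ, hle⟩ := h
    refine ⟨τ, hτ, fun i => ?_⟩
    rw [← (hball τ (hsmall τ hτ)).1.1, ← ht1] at hle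
    exact (norm_le_pi_norm ((fun i => a i τ) - fun i => a i (t : ℂ)) i).trans hle
  have hKr : 0 ≤ K * (r * K₂) := by positivity
  -- If `w` is close to `t ^ d` relative to its size, the branch `τ = t (w / t ^ d) ^ (1 / d)` stays
  -- near `t`. Otherwise `w` and `t ^ d` are both `O(D)`, and any root works because the germs are
  -- divisible by `t ^ d`.
  by_cases hcase : D < η * t ^ d
  · have htd0 : 0 < t ^ d := by
      by_contra h
      have := mul_nonpos_of_nonneg_of_nonpos hη.le (not_lt.1 h)
      linarith
    have htd0' : (t : ℂ) ^ d ≠ 0 := norm_pos_iff.1 (htd ▸ htd0)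
    set z := w / (t : ℂ) ^ d with hz
    have hz1 : z - 1 = (w - (t : ℂ) ^ d) / (t : ℂ) ^ d := by
      rw [hz]; field_simp
    have hz1n : ‖z - 1‖ = D / t ^ d := by rw [hz1, norm_div, htd]
    have hzb : z ∈ Metric.ball (1 : ℂ) η := by
      rw [mem_ball_iff_norm, hz1n, div_lt_iff₀ htd0]; exact hcase
    have hbound := hηball z hzb
    rw [Complex.one_cpow] at hbound
    set τ := (t : ℂ) * z ^ ((d : ℂ)⁻¹) with hτdef
    have hτ : τ ^ d = w := by
      rw [hτdef, mul_pow, Complex.cpow_nat_inv_pow _ hd.ne', hz]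
      field_simp
    refine ⟨τ, hτ, ?_⟩
    obtain ⟨⟨-, h2⟩, h3⟩ := hball τ (hsmall τ hτ)
    have hτt : ‖τ - t‖ ≤ t * (K₂ * (D / t ^ d)) := by
      have : τ - t = (t : ℂ) * (z ^ ((d : ℂ)⁻¹) - 1) := by rw [hτdef]; ring
      rw [this, norm_mul, Complex.norm_real, Real.norm_of_nonneg ht0, ← hz1n]
      exact mul_le_mul_of_nonneg_left hbound ht0
    have hlip : ‖c τ - c t‖ ≤ K * ‖τ - t‖ := by
      simpa [dist_eq_norm] using hK.dist_le_mul _ h3 _ ht3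
    have hsplit : τ ^ d • c τ - (t : ℂ) ^ d • c t =
        (w - (t : ℂ) ^ d) • c τ + (t : ℂ) ^ d • (c τ - c t) := by
      rw [hτ, sub_smul, smul_sub]; abel
    rw [hsplit]
    refine (norm_add_le _ _).trans ?_
    rw [norm_smul, norm_smul, htd]
    have h4 : t ^ d * ‖c τ - c t‖ ≤ K * (r * K₂) * D := by
      calc t ^ d * ‖c τ - c t‖ ≤ t ^ d * (K * (t * (K₂ * (D / t ^ d)))) := by gcongr; exact hlip.trans (by gcongr)
        _ = K * (t * K₂) * D := by field_simp
        _ ≤ K * (r * K₂) * D := by gcongr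
    have h5 : D * ‖c τ‖ ≤ M * D := by rw [mul_comm]; gcongr
    have h6 : 0 ≤ M * (1 + 2 / η) * D := by positivity
    nlinarith
  · rw [not_lt] at hcase
    obtain ⟨τ, hτ⟩ := IsAlgClosed.exists_pow_nat_eq w hd
    refine ⟨τ, hτ, ?_⟩
    obtain ⟨⟨-, h2⟩, -⟩ := hball τ (hsmall τ hτ)
    refine (norm_sub_le _ _).trans ?_
    rw [norm_smul, norm_smul, htd, hτ]
    have h3 : t ^ d ≤ D / η := by rw [le_div_iff₀ hη]; linarith
    have h4 : ‖w‖ ≤ D + t ^ d := by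
      have := norm_add_le (w - (t : ℂ) ^ d) ((t : ℂ) ^ d)
      rwa [sub_add_cancel, htd] at this
    have htd0 : 0 ≤ t ^ d := pow_nonneg ht0 d
    calc ‖w‖ * ‖c τ‖ + t ^ d * ‖c t‖ ≤ (D + D / η) * M + D / η * M := by
          gcongr
          linarith
      _ = M * (1 + 2 / η) * D := by field_simp; ring
      _ ≤ _ := by
        have : 0 ≤ (M + K * (r * K₂)) * D := by positivity
        linarith

/-- The Newton–Puiseux roots `x = α i (y)` of `F (x, σ y)`, with what is needed of the factorization
of `F`. -/
structure IsRootSystem (F : Plane ℂ → ℂ) (σ : ℤˣ) {n : ℕ} (α : Fin n → ℝ → ℂ) : Prop where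
  frac : ∀ i, IsFractionalSeries (α i)
  zero : ∀ i, α i 0 = 0
  factor : ∃ (U : ℂ × ℝ → ℂ) (U₀ : ℂ), U₀ ≠ 0 ∧ Tendsto U (𝓝 0 ×ˢ 𝓝[≥] 0) (𝓝 U₀) ∧
    ∀ᶠ q in 𝓝 (0 : ℂ) ×ˢ 𝓝[≥] (0 : ℝ),
      F !₂[q.1, ((sgn σ * q.2 : ℝ) : ℂ)] = U q * ∏ i, (q.1 - α i q.2)
  near : (∀ i, α i =O[𝓝[>] 0] fun y : ℝ => y) → ∃ C > 0,
    ∀ᶠ q in 𝓝[≥] (0 : ℝ) ×ˢ 𝓝 (0 : Plane ℂ), F q.2 = 0 →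
      ∃ i, ‖q.2 0 - α i q.1‖ ≤ C * ‖q.2 1 - ((sgn σ * q.1 : ℝ) : ℂ)‖

/-- The Puiseux factorization gives all but `near`. For that field, a zero `P` of `F` satisfies `P 0
= a i τ` for some `i` once `τ ^ d` is its second coordinate up to sign; `exists_near_root` supplies
a `τ` that brings all `a i τ` close to their values at the real parameter. -/
theorem exists_isRootSystem {F : Plane ℂ → ℂ} (hF : AnalyticAt ℂ F 0) {n : ℕ}
    (ho : analyticOrderAt (fun x : ℂ => F !₂[x, 0]) 0 = n) (σ : ℤˣ) :
    ∃ α : Fin n → ℝ → ℂ, IsRootSystem F σ α := by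
  set s : ℂ := ((sgn σ : ℝ) : ℂ) with hs
  have hss : s * s = 1 := by rw [hs, ← Complex.ofReal_mul, sgn_mul_self, Complex.ofReal_one]
  have hsn : ‖s‖ = 1 := by rw [hs, Complex.norm_real, Real.norm_eq_abs, abs_sgn]
  set G : ℂ × ℂ → ℂ := fun v => F !₂[v.1, s * v.2] with hGdef
  have h00 : (!₂[0, 0] : Plane ℂ) = 0 := by ext i; fin_cases i <;> rfl
  have hG : AnalyticAt ℂ G 0 := by
    refine AnalyticAt.comp (g := F) (f := fun v : ℂ × ℂ => (!₂[v.1, s * v.2] : Plane ℂ)) ?_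
      (analyticAt_vec analyticAt_fst (analyticAt_const.mul analyticAt_snd))
    simpa [h00] using hF
  obtain ⟨d, hd, a, U, ha, ha0, hU, hU0, hfac⟩ := exists_puiseux_factorization hG
    (n := n) (by simpa [hGdef] using ho)
  have hroot : Tendsto (fun y : ℝ => y ^ (d : ℝ)⁻¹) (𝓝[≥] 0) (𝓝[≥] 0) :=
    tendsto_rpow_nhdsGE (by positivity)
  have hrootc : Tendsto (fun y : ℝ => ((y ^ (d : ℝ)⁻¹ : ℝ) : ℂ)) (𝓝[≥] 0) (𝓝 0) :=
    (Complex.continuous_ofReal.tendsto' 0 0 rfl).comp (hroot.mono_right nhdsWithin_le_nhds)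
  have hpair : Tendsto (fun q : ℂ × ℝ => (q.1, ((q.2 ^ (d : ℝ)⁻¹ : ℝ) : ℂ))) (𝓝 0 ×ˢ 𝓝[≥] 0)
      (𝓝 0) := by
    rw [← Prod.mk_zero_zero, nhds_prod_eq]
    exact tendsto_fst.prodMk (hrootc.comp tendsto_snd)
  refine ⟨fun i y => a i ((y ^ (d : ℝ)⁻¹ : ℝ) : ℂ), fun i => ?_, fun i => ?_, ?_, fun hO => ?_⟩
  · refine ⟨d, hd, fun t => a i t, ?_, ?_⟩
    · exact AnalyticAt.comp (g := a i) (f := fun t : ℝ => (t : ℂ))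
        (by simpa using (ha i).restrictScalars) (Complex.ofRealCLM.analyticAt _)
    · filter_upwards [self_mem_nhdsWithin] with t ht
      rw [Real.pow_rpow_inv_natCast ht hd.ne']
  · rw [Real.zero_rpow (by positivity)]
    simpa using ha0 i
  · refine ⟨fun q => U (q.1, ((q.2 ^ (d : ℝ)⁻¹ : ℝ) : ℂ)), U 0, hU0,
      hU.continuousAt.tendsto.comp hpair, ?_⟩
    have hnn : ∀ᶠ q in 𝓝 (0 : ℂ) ×ˢ 𝓝[≥] (0 : ℝ), 0 ≤ q.2 :=
      tendsto_snd.eventually self_mem_nhdsWithin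
    filter_upwards [hpair.eventually hfac, hnn] with q hq hq0
    rw [← hq, hGdef]
    simp only
    rw [← Complex.ofReal_pow, rpow_inv_pow hd hq0, Complex.ofReal_mul]
  · have hO' : ∀ i, (fun t : ℝ => a i t) =O[𝓝[>] 0] fun t : ℝ => t ^ d := fun i => by
      have h1 : Tendsto (fun t : ℝ => t ^ d) (𝓝[>] 0) (𝓝[>] 0) := by
        simpa using tendsto_rpow_nhdsGT (q := d) (by exact_mod_cast hd)
      refine ((hO i).comp_tendsto h1).congr' ?_ (EventuallyEq.refl _ _)
      filter_upwards [self_mem_nhdsWithin] with t ht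
      simp only [Function.comp_apply]
      rw [Real.pow_rpow_inv_natCast (le_of_lt ht) hd.ne']
    obtain ⟨C, hC, hnear⟩ := exists_near_root ha hd hO'
    refine ⟨1 + C, by positivity, ?_⟩
    have hUne : ∀ᶠ v in 𝓝 (0 : ℂ × ℂ), U v ≠ 0 := hU.continuousAt.eventually_ne hU0
    obtain ⟨r, hr, hball⟩ := Metric.eventually_nhds_iff_ball.1 (hfac.and hUne)
    have hmap : Tendsto (fun q : ℝ × Plane ℂ => (q.1 ^ (d : ℝ)⁻¹, s * q.2 1))
        (𝓝[≥] 0 ×ˢ 𝓝 0) (𝓝[≥] 0 ×ˢ 𝓝 0) := by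
      have h1 : Tendsto (fun P : Plane ℂ => s * P 1) (𝓝 0) (𝓝 0) :=
        Continuous.tendsto' (by fun_prop) _ _ (by simp)
      exact (hroot.comp tendsto_fst).prodMk (h1.comp tendsto_snd)
    have hbound : ∀ᶠ q in 𝓝[≥] (0 : ℝ) ×ˢ 𝓝 (0 : Plane ℂ), 0 ≤ q.1 ∧ ‖q.2‖ < min r (r ^ d) := by
      have h1 : ∀ᶠ P in 𝓝 (0 : Plane ℂ), ‖P‖ < min r (r ^ d) := by
        have := (continuous_norm (E := Plane ℂ)).tendsto 0
        rw [norm_zero] at this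
        exact this.eventually (gt_mem_nhds (lt_min hr (pow_pos hr d)))
      have h2 : ∀ᶠ y in 𝓝[≥] (0 : ℝ), 0 ≤ y := self_mem_nhdsWithin
      exact (tendsto_fst.eventually h2).and (tendsto_snd.eventually h1)
    filter_upwards [hmap.eventually hnear, hbound] with ⟨y, P⟩ ⟨τ, hτ, hle⟩ ⟨hy0, hP⟩ hFP
    simp only at hτ hle hy0 hP hFP ⊢
    have hP0 : ‖P 0‖ < r := (PiLp.norm_apply_le P 0).trans_lt (hP.trans_le (min_le_left _ _))
    have hP1 : ‖P 1‖ < r ^ d := (PiLp.norm_apply_le P 1).trans_lt (hP.trans_le (min_le_right _ _))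
    have hτr : ‖τ‖ < r := by
      refine lt_of_pow_lt_pow_left₀ d hr.le ?_
      rwa [← norm_pow, hτ, norm_mul, hsn, one_mul]
    obtain ⟨hf, hUn⟩ := hball (P 0, τ) (by
      rw [mem_ball_zero_iff, Prod.norm_def]
      exact max_lt hP0 hτr)
    have hPv : (!₂[P 0, P 1] : Plane ℂ) = P := by ext i; fin_cases i <;> rfl
    have hG0 : G (P 0, τ ^ d) = 0 := by
      simp only [hGdef]
      rw [hτ, ← mul_assoc, hss, one_mul, hPv, hFP]
    simp only at hf
    rw [hG0] at hf
    have hprod := (mul_eq_zero.1 hf.symm).resolve_left hUn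
    obtain ⟨i, -, hi⟩ := Finset.prod_eq_zero_iff.1 hprod
    refine ⟨i, ?_⟩
    rw [sub_eq_zero.1 hi]
    refine (hle i).trans ?_
    rw [← Complex.ofReal_pow, rpow_inv_pow hd hy0]
    have h1 : s * P 1 - (y : ℂ) = s * (P 1 - ((sgn σ * y : ℝ) : ℂ)) := by
      rw [mul_sub, Complex.ofReal_mul, ← mul_assoc, ← hs, hss, one_mul]
    rw [h1, norm_mul, hsn, one_mul]
    have := norm_nonneg (P 1 - ((sgn σ * y : ℝ) : ℂ))
    nlinarith

end EnrichedLine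
end

/-! ### Initial forms along `x = p(y) + u y ^ h`. -/

noncomputable section
namespace EnrichedLine

section orders
variable {𝕜 : Type} [RCLike 𝕜] {δ : ℝ → 𝕜}

theorem IsFractionalSeries.isBigO_or_leading_lt (hδ : IsFractionalSeries δ) (h : ℝ) :
    (∃ z, HasLeading δ h z) ∨ ∃ q < h, ∃ c ≠ 0, HasLeading δ q c := by
  rcases hδ.eventually_zero_or_leading with h0 | ⟨q, -, c, hc, hl⟩
  · refine Or.inl ⟨0, tendsto_const_nhds.congr' ?_⟩
    filter_upwards [h0] with y hy
    rw [hy, smul_zero]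
  · rcases lt_trichotomy (q : ℝ) h with hlt | heq | hgt
    · exact Or.inr ⟨q, hlt, c, hc, hl⟩
    · exact Or.inl ⟨c, heq ▸ hl⟩
    · exact Or.inl ⟨0, hl.of_lt hgt⟩

theorem IsFractionalSeries.exists_hasLeading (hδ : IsFractionalSeries δ) {h : ℝ}
    (hO : δ =O[𝓝[>] (0 : ℝ)] fun y : ℝ => y ^ h) : ∃ z, HasLeading δ h z := by
  refine (hδ.isBigO_or_leading_lt h).resolve_right ?_
  rintro ⟨q, hq, c, hc, hl⟩
  exact absurd ((hl.isBigO_iff hc).1 hO) (not_le.2 hq)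

theorem hasLeading_zero_iff (hδ : IsFractionalSeries δ) {h : ℝ} (hh : 0 ≤ h) :
    HasLeading δ h 0 ↔ ENNReal.ofReal h < fracOrd δ := by
  by_cases ht : fracOrd δ = ⊤
  · refine iff_of_true (tendsto_const_nhds.congr' ?_) (by simp [ht])
    filter_upwards [(fracOrd_eq_top_iff hδ).1 ht] with y hy
    rw [hy, smul_zero]
  · obtain ⟨q, hq, c, hc, hl, he⟩ := exists_leading_of_fracOrd_ne_top hδ ht
    rw [he, ENNReal.ofReal_lt_ofReal_iff_of_nonneg hh]
    refine ⟨fun h0 => ?_, hl.of_lt⟩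
    by_contra hle
    rcases (not_lt.1 hle).lt_or_eq with hlt | heq
    · exact absurd ((hl.isBigO_iff hc).1 h0.isBigO) (not_le.2 hlt)
    · rw [heq] at hl
      exact hc (tendsto_nhds_unique hl h0)

theorem isBigO_rpow_iff_le_fracOrd (hδ : IsFractionalSeries δ) {h : ℝ} (hh : 0 ≤ h) :
    (δ =O[𝓝[>] (0 : ℝ)] fun y : ℝ => y ^ h) ↔ ENNReal.ofReal h ≤ fracOrd δ := by
  have := le_fracOrd_iff hδ (k := h.toNNReal)
  rw [Real.coe_toNNReal h hh] at this
  exact this.symm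

end orders

/-- If `δ = z y ^ h + ⋯`, the factor is `y ^ h (u - z)` to leading order; if `δ` has order `q < h`,
it is a nonzero constant times `y ^ q`. The limit is taken jointly in `y` and `u`, which later gives
local uniformity in `u`. -/
theorem exists_linear_factor {δ : ℝ → ℂ} (hδ : IsFractionalSeries δ) (h : ℝ) :
    ∃ (L : ℂ[X]) (κ : ℝ), κ ≤ h ∧ L ≠ 0 ∧
      (∀ u₀, Tendsto (fun q : ℝ × ℂ => (q.1 ^ κ)⁻¹ • ((q.1 ^ h) • q.2 - δ q.1)) (𝓝[>] 0 ×ˢ 𝓝 u₀)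
        (𝓝 (L.eval u₀))) ∧
      (∀ z, L.eval z = 0 ↔ HasLeading δ h z) ∧
      (h ≤ κ → δ =O[𝓝[>] (0 : ℝ)] fun y : ℝ => y ^ h) := by
  have hpos : ∀ u₀ : ℂ, ∀ᶠ q in 𝓝[>] (0 : ℝ) ×ˢ 𝓝 u₀, 0 < q.1 := fun u₀ => by
    have : ∀ᶠ y in 𝓝[>] (0 : ℝ), 0 < y := self_mem_nhdsWithin
    exact tendsto_fst.eventually this
  rcases hδ.isBigO_or_leading_lt h with ⟨z, hz⟩ | ⟨q, hq, c, hc, hl⟩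
  · refine ⟨X - C z, h, le_rfl, X_sub_C_ne_zero z, fun u₀ => ?_, fun w => ?_, fun _ => hz.isBigO⟩
    · have : Tendsto (fun q : ℝ × ℂ => q.2 - (q.1 ^ h)⁻¹ • δ q.1) (𝓝[>] 0 ×ˢ 𝓝 u₀)
          (𝓝 (u₀ - z)) := tendsto_snd.sub (Tendsto.comp hz tendsto_fst)
      rw [eval_sub, eval_X, eval_C]
      refine this.congr' ?_
      filter_upwards [hpos u₀] with q hq
      rw [smul_sub, smul_smul, inv_mul_cancel₀ (Real.rpow_pos_of_pos hq h).ne', one_smul]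
    · rw [eval_sub, eval_X, eval_C, sub_eq_zero]
      exact ⟨fun hw => hw ▸ hz, fun hw => tendsto_nhds_unique hw hz⟩
  · refine ⟨C (-c), q, hq.le, C_ne_zero.2 (neg_ne_zero.2 hc), fun u₀ => ?_, fun w => ?_,
      fun hle => absurd hle (not_le.2 hq)⟩
    · have h1 : Tendsto (fun p : ℝ × ℂ => ((p.1 ^ q)⁻¹ * p.1 ^ h) • p.2) (𝓝[>] 0 ×ˢ 𝓝 u₀)
          (𝓝 ((0 : ℝ) • u₀)) := ((tendsto_rpow_mul_inv hq).comp tendsto_fst).smul tendsto_snd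
      have h2 := h1.sub (Tendsto.comp hl tendsto_fst)
      rw [zero_smul, zero_sub] at h2
      rw [eval_C]
      refine h2.congr fun p => ?_
      simp only [Function.comp_apply]
      rw [smul_sub, smul_smul]
    · rw [eval_C, neg_eq_zero]
      refine iff_of_false hc fun hw => ?_
      exact absurd ((hl.isBigO_iff hc).1 hw.isBigO) (not_le.2 hq)

/-- `J` and `e` describe the leading term of `F` along `x = p(y) + u y ^ h + ⋯`. -/
def IsComplexInitialForm (F : Plane ℂ → ℂ) (σ : ℤˣ) (p : ℝ → ℂ) (h : ℝ) (J : ℂ[X]) (e : ℝ) : Prop :=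
  J ≠ 0 ∧ ∀ u₀, Tendsto
    (fun q : ℝ × ℂ => (q.1 ^ e)⁻¹ • F !₂[p q.1 + (q.1 ^ h) • q.2, ((sgn σ * q.1 : ℝ) : ℂ)])
    (𝓝[>] 0 ×ˢ 𝓝 u₀) (𝓝 (J.eval u₀))

theorem tendsto_add_rpow_smul {p : ℝ → ℂ} (hp : Tendsto p (𝓝[>] 0) (𝓝 0)) {h : ℝ} (hh : 0 < h)
    (u₀ : ℂ) : Tendsto (fun q : ℝ × ℂ => p q.1 + (q.1 ^ h) • q.2) (𝓝[>] 0 ×ˢ 𝓝 u₀) (𝓝 0) := by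
  have h1 : Tendsto (fun y : ℝ => y ^ h) (𝓝[>] 0) (𝓝 0) :=
    (tendsto_rpow_nhdsGT hh).mono_right nhdsWithin_le_nhds
  have := (hp.comp tendsto_fst).add ((h1.comp tendsto_fst).smul (tendsto_snd (g := 𝓝 u₀)))
  rw [zero_smul, add_zero] at this
  exact this

/-- The limits of the unit and of the linear factors multiply, and their exponents `κ i` add up to
`e`. As each `κ i ≤ h`, the bound `n * h ≤ e` forces `κ i = h` for all `i`, whence the last clause.
-/
theorem IsRootSystem.exists_initialForm {F : Plane ℂ → ℂ} {σ : ℤˣ} {n : ℕ} {α : Fin n → ℝ → ℂ}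
    (hα : IsRootSystem F σ α) {p : ℝ → ℂ} (hp : IsFractionalSeries p)
    (hp0 : Tendsto p (𝓝[>] 0) (𝓝 0)) {h : ℝ} (hh : 0 < h) :
    ∃ (J : ℂ[X]) (e : ℝ), IsComplexInitialForm F σ p h J e ∧
      (∀ z, J.eval z = 0 ↔ ∃ i, HasLeading (fun y => α i y - p y) h z) ∧
      (n * h ≤ e → ∀ i, (fun y => α i y - p y) =O[𝓝[>] (0 : ℝ)] fun y : ℝ => y ^ h) := by
  choose L κ hκ hL hlim hroot hO using fun i => exists_linear_factor ((hα.frac i).sub hp) h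
  obtain ⟨U, U₀, hU₀, hU, hfac⟩ := hα.factor
  refine ⟨C U₀ * ∏ i, L i, ∑ i, κ i, ⟨mul_ne_zero (C_ne_zero.2 hU₀)
    (Finset.prod_ne_zero_iff.2 fun i _ => hL i), fun u₀ => ?_⟩, fun z => ?_, fun hle i => ?_⟩
  · have hpos : ∀ᶠ q in 𝓝[>] (0 : ℝ) ×ˢ 𝓝 u₀, 0 < q.1 := by
      have : ∀ᶠ y in 𝓝[>] (0 : ℝ), 0 < y := self_mem_nhdsWithin
      exact tendsto_fst.eventually this
    have hto : Tendsto (fun q : ℝ × ℂ => (p q.1 + (q.1 ^ h) • q.2, q.1)) (𝓝[>] 0 ×ˢ 𝓝 u₀)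
        (𝓝 0 ×ˢ 𝓝[≥] 0) := (tendsto_add_rpow_smul hp0 hh u₀).prodMk
      (tendsto_fst.mono_right (nhdsWithin_mono _ Set.Ioi_subset_Ici_self))
    have h1 := (hU.comp hto).mul (tendsto_finsetProd Finset.univ fun i _ => hlim i u₀)
    rw [eval_mul, eval_C, eval_prod]
    refine h1.congr' ?_
    filter_upwards [hpos, hto.eventually hfac] with q hq hq2
    rw [hq2, Finset.prod_congr rfl fun i _ => (?_ : _ = (q.1 ^ κ i)⁻¹ •
      (p q.1 + (q.1 ^ h) • q.2 - α i q.1))]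
    · simp only [Complex.real_smul, Function.comp_apply]
      rw [Finset.prod_mul_distrib, Real.rpow_sum_of_pos hq]
      push_cast
      rw [Finset.prod_inv_distrib]
      ring
    · congr 1; ring
  · rw [eval_mul, eval_C, eval_prod, mul_eq_zero, or_iff_right hU₀, Finset.prod_eq_zero_iff]
    simp [hroot]
  · refine hO i ?_
    have h1 : ∑ j, (h - κ j) ≤ 0 := by
      rw [Finset.sum_sub_distrib]
      simpa using hle
    have h2 := Finset.single_le_sum (f := fun j => h - κ j) (fun j _ => sub_nonneg.2 (hκ j))
      (Finset.mem_univ i)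
    linarith

section initialForm
variable {F : Plane ℂ → ℂ} {σ : ℤˣ} {p : ℝ → ℂ} {h : ℝ} {J : ℂ[X]} {e : ℝ}

theorem IsComplexInitialForm.hasLeading (hJ : IsComplexInitialForm F σ p h J e) {ψ : ℝ → ℂ} {u : ℂ}
    (hψ : HasLeading (fun y => ψ y - p y) h u) :
    HasLeading (fun y => F !₂[ψ y, ((sgn σ * y : ℝ) : ℂ)]) e (J.eval u) := by
  have h1 : Tendsto (fun y : ℝ => (y, (y ^ h)⁻¹ • (ψ y - p y))) (𝓝[>] 0) (𝓝[>] 0 ×ˢ 𝓝 u) :=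
    tendsto_id.prodMk hψ
  refine ((hJ.2 u).comp h1).congr' ?_
  filter_upwards [self_mem_nhdsWithin] with y hy
  simp only [Function.comp_apply]
  rw [smul_smul, mul_inv_cancel₀ (Real.rpow_pos_of_pos hy h).ne', one_smul, add_sub_cancel]

/-- The initial form of `F_x` is the derivative of the initial form of `F`. -/
theorem IsComplexInitialForm.derivative_eq (hF : AnalyticAt ℂ F 0)
    (hp0 : Tendsto p (𝓝[>] 0) (𝓝 0)) (hh : 0 < h)
    (hJ : IsComplexInitialForm F σ p h J e) {J' : ℂ[X]} {e' : ℝ}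
    (hJ' : IsComplexInitialForm (fun P => deriv (fun x : ℂ => F !₂[x, P 1]) (P 0)) σ p h J' e')
    (hd : derivative J ≠ 0) : J' = derivative J := by
  obtain ⟨r, hr, hball⟩ := Metric.eventually_nhds_iff_ball.1 hF.eventually_analyticAt
  have hlead : ∀ u₀ : ℂ, HasLeading (fun y : ℝ => deriv (fun x : ℂ =>
      F !₂[x, ((sgn σ * y : ℝ) : ℂ)]) (p y + (y ^ h) • u₀)) (e - h) ((derivative J).eval u₀) := by
    intro u₀
    set g : ℝ → ℂ → ℂ := fun y u =>
      (y ^ e)⁻¹ • F !₂[p y + (y ^ h) • u, ((sgn σ * y : ℝ) : ℂ)] with hg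
    -- Joint convergence is locally uniform convergence in `u`, so the `u`-derivatives converge too.
    -- Differentiating in `u` produces a factor `y ^ h`, so `F_x` has exponent `e - h` wherever `J'`
    -- does not vanish.
    have hloc : TendstoLocallyUniformlyOn g (fun u => J.eval u) (𝓝[>] 0) (Metric.ball u₀ 1) := by
      rw [tendstoLocallyUniformlyOn_iff_filter]
      intro u _
      rw [tendstoUniformlyOnFilter_iff_tendsto]
      have h1 : Tendsto (fun q : ℝ × ℂ => (J.eval q.2, g q.1 q.2)) (𝓝[>] 0 ×ˢ 𝓝 u)
          (𝓝 (J.eval u) ×ˢ 𝓝 (J.eval u)) :=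
        ((J.continuous.tendsto u).comp tendsto_snd).prodMk (hJ.2 u)
      rw [← nhds_prod_eq] at h1
      exact (h1.mono_left (Filter.prod_mono le_rfl nhdsWithin_le_nhds)).mono_right
        (nhds_le_uniformity _)
    have hR : ∀ᶠ y in 𝓝[>] (0 : ℝ), 0 < y ∧ ‖p y‖ < r / 3 ∧ y ^ h * (‖u₀‖ + 1) < r / 3 ∧ y < r / 3 := by
      have h1 : Tendsto (fun y : ℝ => y ^ h * (‖u₀‖ + 1)) (𝓝[>] 0) (𝓝 0) := by
        have := ((tendsto_rpow_nhdsGT hh).mono_right nhdsWithin_le_nhds).mul_const (‖u₀‖ + 1)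
        rwa [zero_mul] at this
      have h2 := hp0.norm
      rw [norm_zero] at h2
      have hr3 : 0 < r / 3 := by positivity
      filter_upwards [self_mem_nhdsWithin, h2.eventually (gt_mem_nhds hr3),
        h1.eventually (gt_mem_nhds hr3), nhdsWithin_le_nhds (gt_mem_nhds hr3)] with y a b c d
      exact ⟨a, b, c, d⟩
    have hanF : ∀ y : ℝ, 0 < y ∧ ‖p y‖ < r / 3 ∧ y ^ h * (‖u₀‖ + 1) < r / 3 ∧ y < r / 3 →
        ∀ u ∈ Metric.ball u₀ 1, DifferentiableAt ℂ (fun x : ℂ => F !₂[x, ((sgn σ * y : ℝ) : ℂ)])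
          (p y + (y ^ h) • u) := by
      rintro y ⟨hy0, hy1, hy2, hy3⟩ u hu
      have hun : ‖u‖ ≤ ‖u₀‖ + 1 := by
        rw [mem_ball_iff_norm] at hu
        have := norm_add_le (u - u₀) u₀
        rw [sub_add_cancel] at this
        linarith
      have hmem : (!₂[p y + (y ^ h) • u, ((sgn σ * y : ℝ) : ℂ)] : Plane ℂ) ∈ Metric.ball 0 r := by
        rw [mem_ball_zero_iff]
        refine (norm_vec_le _ _).trans_lt ?_
        have h3 := norm_add_le (p y) ((y ^ h) • u)
        rw [norm_smul, Real.norm_of_nonneg (Real.rpow_nonneg hy0.le h)] at h3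
        have h4 := mul_le_mul_of_nonneg_left hun (Real.rpow_nonneg hy0.le h)
        rw [Complex.norm_real, norm_mul, Real.norm_eq_abs (sgn σ), abs_sgn, one_mul,
          Real.norm_of_nonneg hy0.le]
        linarith
      exact (AnalyticAt.comp (g := F) (f := fun x : ℂ => (!₂[x, ((sgn σ * y : ℝ) : ℂ)] : Plane ℂ))
        (hball _ hmem) (analyticAt_vec analyticAt_id analyticAt_const)).differentiableAt
    have hgd : ∀ y : ℝ, 0 < y ∧ ‖p y‖ < r / 3 ∧ y ^ h * (‖u₀‖ + 1) < r / 3 ∧ y < r / 3 →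
        ∀ u ∈ Metric.ball u₀ 1, HasDerivAt (g y) ((y ^ e)⁻¹ • ((y ^ h) • deriv (fun x : ℂ =>
          F !₂[x, ((sgn σ * y : ℝ) : ℂ)]) (p y + (y ^ h) • u))) u := by
      intro y hy u hu
      have h3 : HasDerivAt (fun u : ℂ => p y + (y ^ h) • u) ((y ^ h : ℝ) : ℂ) u := by
        have := ((hasDerivAt_id u).const_mul ((y ^ h : ℝ) : ℂ)).const_add (p y)
        simpa using this
      have h4 := (HasDerivAt.comp u (h := fun u : ℂ => p y + (y ^ h) • u)
        (hanF y hy u hu).hasDerivAt h3).const_mul (((y ^ e)⁻¹ : ℝ) : ℂ)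
      simp only [hg, Complex.real_smul]
      refine h4.congr_deriv ?_
      simp only [Complex.real_smul]
      ring
    have hder := hloc.deriv (by
      filter_upwards [hR] with y hy u hu
      exact (hgd y hy u hu).differentiableAt.differentiableWithinAt) Metric.isOpen_ball
    have hat := hder.tendsto_at (Metric.mem_ball_self one_pos)
    rw [Polynomial.deriv] at hat
    refine hat.congr' ?_
    filter_upwards [hR] with y hy
    simp only [Function.comp_apply]
    rw [(hgd y hy u₀ (Metric.mem_ball_self one_pos)).deriv, smul_smul, Real.rpow_sub hy.1]
    congr 1
    rw [inv_div, div_eq_inv_mul]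
  have hlead' : ∀ u₀ : ℂ, HasLeading (fun y : ℝ => deriv (fun x : ℂ =>
      F !₂[x, ((sgn σ * y : ℝ) : ℂ)]) (p y + (y ^ h) • u₀)) e' (J'.eval u₀) := by
    intro u₀
    have h1 : HasLeading (fun y : ℝ => p y + (y ^ h) • u₀ - p y) h u₀ :=
      (hasLeading_monomial u₀ h).congr (.of_forall fun y => (add_sub_cancel_left _ _).symm)
    simpa using hJ'.hasLeading h1
  -- At a point where neither polynomial vanishes the two leading exponents must agree; uniqueness
  -- of limits then identifies the polynomials.
  obtain ⟨u, hu⟩ : ∃ u, (derivative J * J').eval u ≠ 0 := by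
    by_contra hcon
    push Not at hcon
    exact mul_ne_zero hd hJ'.1 (Polynomial.funext (by simpa using hcon))
  rw [eval_mul] at hu
  have h1 := left_ne_zero_of_mul hu
  have h2 := right_ne_zero_of_mul hu
  have heq : e' = e - h := le_antisymm
    (((hlead u).isBigO_iff h1).1 (hlead' u).isBigO) (((hlead' u).isBigO_iff h2).1 (hlead u).isBigO)
  refine Polynomial.funext fun z => ?_
  exact tendsto_nhds_unique (hlead' z) (heq ▸ hlead z)

end initialForm

/-- `J` and its conjugate agree at infinitely many points, so the coefficients are real. -/
theorem exists_real_polynomial {J : ℂ[X]} (hJ : ∀ u : ℝ, ∃ v : ℝ, J.eval (u : ℂ) = v) :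
    ∃ I : ℝ[X], I.map Complex.ofRealHom = J := by
  have h1 : J.map (starRingEnd ℂ) = J := by
    refine Polynomial.eq_of_infinite_eval_eq _ _ (Set.Infinite.mono ?_
      (Set.infinite_range_of_injective Complex.ofReal_injective))
    rintro _ ⟨u, rfl⟩
    obtain ⟨v, hv⟩ := hJ u
    have h2 : (J.map (starRingEnd ℂ)).eval ((starRingEnd ℂ) (u : ℂ)) = (starRingEnd ℂ) (J.eval (u : ℂ)) :=
      Polynomial.eval_map_apply _ _
    rw [Complex.conj_ofReal] at h2
    simp only [Set.mem_ofPred_eq]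
    rw [h2, hv, Complex.conj_ofReal]
  have h2 : J ∈ lifts Complex.ofRealHom := by
    rw [lifts_iff_coeff_lifts]
    intro k
    have h3 := congrArg (fun p => p.coeff k) h1
    simp only [coeff_map] at h3
    exact ⟨(J.coeff k).re, Complex.conj_eq_iff_re.1 h3⟩
  exact (mem_lifts J).1 h2

end EnrichedLine
end

/-! ### Mini-regularity, and heights as orders of contact with roots. -/

noncomputable section
namespace EnrichedLine

theorem IsFractionalSeries.tendsto {𝕜 : Type} [RCLike 𝕜] {φ : ℝ → 𝕜} (hφ : IsFractionalSeries φ) :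
    Tendsto φ (𝓝[≥] 0) (𝓝 (φ 0)) := by
  obtain ⟨d, hd, a, ha, h⟩ := hφ
  have h0 : φ 0 = a 0 := by simpa [hd.ne'] using (eventually_nhdsGE_iff.1 h).1
  rw [← map_pow_nhdsGE hd, tendsto_map'_iff, h0]
  exact (ha.continuousAt.tendsto.mono_left nhdsWithin_le_nhds).congr'
    (h.mono fun t ht => ht.symm)

theorem IsRootSystem.tendsto {F : Plane ℂ → ℂ} {σ : ℤˣ} {m : ℕ} {α : Fin m → ℝ → ℂ}
    (hα : IsRootSystem F σ α) (i : Fin m) : Tendsto (α i) (𝓝[≥] 0) (𝓝 0) := by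
  have := (hα.frac i).tendsto
  rwa [hα.zero i] at this

theorem IsRootSystem.eventually_eq_zero {F : Plane ℂ → ℂ} {σ : ℤˣ} {m : ℕ} {α : Fin m → ℝ → ℂ}
    (hα : IsRootSystem F σ α) (i : Fin m) :
    ∀ᶠ y in 𝓝[≥] (0 : ℝ), F !₂[α i y, ((sgn σ * y : ℝ) : ℂ)] = 0 := by
  obtain ⟨U, U₀, -, -, hfac⟩ := hα.factor
  filter_upwards [((hα.tendsto i).prodMk tendsto_id).eventually hfac] with y hy
  rw [Finset.prod_eq_zero (Finset.mem_univ i) (by simp), mul_zero] at hy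
  simpa using hy

theorem isTheta_pow_of_analyticOrderAt {𝕜 : Type} [RCLike 𝕜] {g : 𝕜 → 𝕜} (hg : AnalyticAt 𝕜 g 0)
    {k : ℕ} (hk : analyticOrderAt g 0 = k) :
    (fun x : ℝ => g (x : 𝕜)) =Θ[𝓝[>] 0] fun x : ℝ => x ^ (k : ℝ) := by
  obtain ⟨w, hw, hw0, hwe⟩ := hg.analyticOrderAt_eq_natCast.1 hk
  have ht : Tendsto (fun x : ℝ => (x : 𝕜)) (𝓝[>] 0) (𝓝 0) :=
    ((RCLike.continuous_ofReal (K := 𝕜)).tendsto' 0 0 (by simp)).mono_left nhdsWithin_le_nhds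
  have hl : HasLeading (fun x : ℝ => g (x : 𝕜)) k (w 0) := by
    refine (hw.continuousAt.tendsto.comp ht).congr' ?_
    filter_upwards [ht.eventually hwe, self_mem_nhdsWithin] with x hx hx0
    have hx0 : 0 < x := hx0
    rw [hx, Function.comp_apply, sub_zero, Real.rpow_natCast, smul_eq_mul, RCLike.real_smul_eq_coe_mul,
      ← mul_assoc, RCLike.ofReal_inv, RCLike.ofReal_pow, inv_mul_cancel₀, one_mul]
    simpa using fun h => absurd h hx0.ne'
  exact ⟨hl.isBigO, hl.isBigO_symm hw0⟩

theorem tendsto_graph {σ : ℤˣ} {φ : ℝ → ℝ} (hφ : IsTransverse φ) :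
    (fun y : ℝ => (!₂[φ y, sgn σ * y] : Plane ℝ)) =O[𝓝[≥] 0] (fun y : ℝ => y) ∧
      Tendsto (fun y : ℝ => (!₂[φ y, sgn σ * y] : Plane ℝ)) (𝓝[≥] 0) (𝓝 0) := by
  have h1 : (fun y : ℝ => (!₂[φ y, sgn σ * y] : Plane ℝ)) =O[𝓝[≥] 0] (fun y : ℝ => y) := by
    obtain ⟨C, hC⟩ := hφ.2.bound
    refine IsBigO.of_bound (C + 1) ?_
    filter_upwards [hC] with y hy
    refine (norm_vec_le _ _).trans ?_
    rw [norm_mul, Real.norm_eq_abs (sgn σ), abs_sgn]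
    linarith
  exact ⟨h1, h1.trans_tendsto (tendsto_id.mono_left nhdsWithin_le_nhds)⟩

theorem IsComplexification.eventually_graph {f : Plane ℝ → ℝ} {F : Plane ℂ → ℂ}
    (hF : IsComplexification f F) (σ : ℤˣ) {φ : ℝ → ℝ} (hφ : IsTransverse φ) :
    ∀ᶠ y in 𝓝[≥] (0 : ℝ), F !₂[(φ y : ℂ), ((sgn σ * y : ℝ) : ℂ)] = (f !₂[φ y, sgn σ * y] : ℝ) :=
  ((tendsto_graph hφ).2.eventually hF.2).mono fun y hy => by simpa [toComplexPlane] using hy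

/-- The orders `j` and `k` of the real and complex slices are squeezed: `j ≤ m` from the nonzero
derivative, `k ≤ j` since the slices agree on the reals, and `m ≤ k` from the growth of `f`. -/
theorem MiniRegular.exists_order {f : Plane ℝ → ℝ} (hf : AnalyticAt ℝ f 0) (hf0 : f 0 = 0)
    (hreg : MiniRegular f) {F : Plane ℂ → ℂ} (hF : IsComplexification f F) :
    ∃ m : ℕ, 1 ≤ m ∧ f =O[𝓝 0] (fun P => ‖P‖ ^ m) ∧
      analyticOrderAt (fun x : ℂ => F !₂[x, 0]) 0 = m := by
  obtain ⟨m, hO, hd⟩ := hreg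
  have hline : Tendsto (fun x : ℝ => (!₂[x, 0] : Plane ℝ)) (𝓝 0) (𝓝 0) := by
    have h0 : (!₂[(0 : ℝ), 0] : Plane ℝ) = 0 := by ext i; fin_cases i <;> rfl
    have := (analyticAt_vec (𝕜 := ℝ) (x := (0 : ℝ)) analyticAt_id
      (analyticAt_const (v := (0 : ℝ)))).continuousAt.tendsto
    simpa [h0] using this
  have h0c : (!₂[(0 : ℂ), 0] : Plane ℂ) = 0 := by ext i; fin_cases i <;> rfl
  have h0r : (!₂[(0 : ℝ), 0] : Plane ℝ) = 0 := by ext i; fin_cases i <;> rfl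
  have hg : AnalyticAt ℂ (fun x : ℂ => F !₂[x, 0]) 0 :=
    AnalyticAt.comp (g := F) (f := fun x : ℂ => (!₂[x, 0] : Plane ℂ)) (by rw [h0c]; exact hF.1)
      (analyticAt_vec analyticAt_id analyticAt_const)
  have hgr : AnalyticAt ℝ (fun x : ℝ => f !₂[x, 0]) 0 :=
    AnalyticAt.comp (g := f) (f := fun x : ℝ => (!₂[x, 0] : Plane ℝ)) (by rw [h0r]; exact hf)
      (analyticAt_vec analyticAt_id analyticAt_const)
  have heq : ∀ᶠ x : ℝ in 𝓝 (0 : ℝ), F !₂[(x : ℂ), 0] = (f !₂[x, 0] : ℝ) :=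
    (hline.eventually hF.2).mono fun x hx => by simpa [toComplexPlane] using hx
  have hm : 1 ≤ m := by
    rw [Nat.one_le_iff_ne_zero]
    rintro rfl
    rw [iteratedDeriv_zero, h0r] at hd
    exact hd hf0
  have hlt : ¬ ((m + 1 : ℕ) : ℕ∞) ≤ analyticOrderAt (fun x : ℝ => f !₂[x, 0]) 0 := fun h =>
    hd ((natCast_le_analyticOrderAt_iff_iteratedDeriv_eq_zero hgr).1 h m (Nat.lt_succ_self m))
  obtain ⟨j, hj⟩ := ENat.ne_top_iff_exists.1 (fun h => hlt (h ▸ le_top) :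
    analyticOrderAt (fun x : ℝ => f !₂[x, 0]) 0 ≠ ⊤)
  have hjm : j ≤ m := by
    rw [← hj] at hlt
    have : ¬ (m + 1 ≤ j) := fun h => hlt (by exact_mod_cast h)
    omega
  have hθj := isTheta_pow_of_analyticOrderAt hgr hj.symm
  have hne : analyticOrderAt (fun x : ℂ => F !₂[x, 0]) 0 ≠ ⊤ := fun h => by
    have ht : Tendsto (fun x : ℝ => (x : ℂ)) (𝓝 0) (𝓝 0) := Complex.continuous_ofReal.tendsto' 0 0 rfl
    have h1 : (fun x : ℝ => f !₂[x, 0]) =ᶠ[𝓝 0] fun _ => 0 := by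
      filter_upwards [ht.eventually (analyticOrderAt_eq_top.1 h), heq] with x h1 h2
      rw [h1] at h2
      exact_mod_cast h2.symm
    rw [analyticOrderAt_eq_top.2 h1] at hj
    exact ENat.natCast_ne_top j hj
  obtain ⟨k, hk⟩ := ENat.ne_top_iff_exists.1 hne
  have hθk := isTheta_pow_of_analyticOrderAt hg hk.symm
  have hfg : (fun x : ℝ => F !₂[(x : ℂ), 0]) =Θ[𝓝[>] 0] fun x : ℝ => f !₂[x, 0] := by
    refine IsTheta.of_norm_eventuallyEq_norm ?_
    filter_upwards [nhdsWithin_le_nhds heq] with x hx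
    rw [hx, Complex.norm_real]
  have hkj : k ≤ j := by
    exact_mod_cast rpow_isBigO_rpow_iff.1 (hθj.2.trans (hfg.2.trans hθk.1))
  have hmk : m ≤ k := by
    have h1 : (fun x : ℝ => f !₂[x, 0]) =O[𝓝[>] 0] fun x : ℝ => x ^ (m : ℝ) := by
      refine ((hO.comp_tendsto hline).mono nhdsWithin_le_nhds).trans ?_
      refine IsBigO.of_bound 1 (.of_forall fun x => ?_)
      have := norm_vec_le x (0 : ℝ)
      rw [norm_zero, add_zero] at this
      simp only [Function.comp_apply, norm_pow, norm_norm, Real.rpow_natCast, one_mul]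
      gcongr
    exact_mod_cast rpow_isBigO_rpow_iff.1 (hθk.2.trans (hfg.1.trans h1))
  refine ⟨m, hm, hO, ?_⟩
  rw [← hk, show k = m by omega]

/-- If the order of `F (x, 0)` is the multiplicity, then no root is tangent to the `x`-axis. -/
theorem IsRootSystem.isBigO {f : Plane ℝ → ℝ} {F : Plane ℂ → ℂ} (hF : IsComplexification f F) {m : ℕ}
    (hO : f =O[𝓝 0] (fun P => ‖P‖ ^ m)) {σ : ℤˣ} {α : Fin m → ℝ → ℂ} (hα : IsRootSystem F σ α)
    (i : Fin m) : α i =O[𝓝[>] (0 : ℝ)] fun y : ℝ => y := by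
  have h0 : IsFractionalSeries fun _ : ℝ => (0 : ℂ) :=
    ⟨1, one_pos, fun _ => 0, analyticAt_const, .of_forall fun _ => rfl⟩
  -- Take `p = 0`, `h = 1`. On a line `x = u y` with `J(u) ≠ 0` the multiplicity bound gives `e ≥
  -- m`, and the last clause makes every root `O(y)`.
  obtain ⟨J, e, hJ, -, h3⟩ := hα.exists_initialForm h0 tendsto_const_nhds one_pos
  obtain ⟨u, hu⟩ : ∃ u : ℝ, J.eval (u : ℂ) ≠ 0 := by
    by_contra hcon
    push Not at hcon
    refine hJ.1 (Polynomial.eq_of_infinite_eval_eq _ _ (Set.Infinite.mono ?_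
      (Set.infinite_range_of_injective Complex.ofReal_injective)))
    rintro _ ⟨u, rfl⟩
    simpa using hcon u
  have hφ : IsTransverse fun y => u * y :=
    ⟨⟨1, one_pos, fun y => u * y, analyticAt_const.mul analyticAt_id,
      .of_forall fun y => by rw [pow_one]⟩, isBigO_const_mul_self _ _ _⟩
  have hl := hJ.hasLeading (ψ := fun y => ((u * y : ℝ) : ℂ)) (u := u)
    ((hasLeading_monomial (u : ℂ) 1).congr (.of_forall fun y => by
      simp [mul_comm]))
  have h1 : (fun y : ℝ => F !₂[((u * y : ℝ) : ℂ), ((sgn σ * y : ℝ) : ℂ)]) =O[𝓝[>] 0]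
      fun y : ℝ => y ^ (m : ℝ) := by
    have h2 : (fun y : ℝ => f !₂[u * y, sgn σ * y]) =O[𝓝[≥] 0] fun y : ℝ => y ^ (m : ℝ) := by
      simp only [Real.rpow_natCast]
      exact (hO.comp_tendsto (tendsto_graph hφ).2).trans ((tendsto_graph hφ).1.norm_left.pow m)
    refine (IsBigO.trans ?_ h2).mono (nhdsWithin_mono _ Set.Ioi_subset_Ici_self)
    refine IsBigO.of_bound 1 ((hF.eventually_graph σ hφ).mono fun y hy => ?_)
    rw [hy, Complex.norm_real, one_mul]
  have := h3 (by rw [mul_one]; exact (hl.isBigO_iff hu).1 h1) i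
  simpa using this

theorem norm_sub_le_dist_add {C : ℝ} (hC : 0 ≤ C) {P Q : Plane ℂ} {z : ℂ}
    (h : ‖Q 0 - z‖ ≤ C * ‖Q 1 - P 1‖) : ‖P 0 - z‖ ≤ (1 + C) * dist P Q := by
  have h1 : ‖P 0 - Q 0‖ ≤ dist P Q := by
    rw [dist_eq_norm]; exact PiLp.norm_apply_le (P - Q) 0
  have h2 : ‖Q 1 - P 1‖ ≤ dist P Q := by
    rw [dist_comm, dist_eq_norm]; exact PiLp.norm_apply_le (Q - P) 1
  have h3 := norm_add_le (P 0 - Q 0) (Q 0 - z)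
  rw [sub_add_sub_cancel] at h3
  nlinarith

/-- The height of a real arc is its maximal contact with the Newton–Puiseux roots. -/
theorem arcHeight_eq {f : Plane ℝ → ℝ} {F : Plane ℂ → ℂ} (hF : IsComplexification f F) {m : ℕ}
    {σ : ℤˣ} {α : Fin m → ℝ → ℂ} (hα : IsRootSystem F σ α)
    (hO : ∀ i, α i =O[𝓝[>] (0 : ℝ)] fun y : ℝ => y) {A : Arc ℝ} {φ : ℝ → ℝ}
    (hA : Represents σ A φ) (hφ : IsTransverse φ) :
    arcHeight f A = ⨆ i, fracOrd fun y => (φ y : ℂ) - α i y := by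
  set P : ℝ → Plane ℂ := fun y => toComplexPlane !₂[φ y, sgn σ * y] with hP
  have hP0 : ∀ y, P y 0 = (φ y : ℂ) := fun y => by simp [hP, toComplexPlane]
  have hP1 : ∀ y, P y 1 = ((sgn σ * y : ℝ) : ℂ) := fun y => by simp [hP, toComplexPlane]
  have hgerm : A.germ.map toComplexPlane = Filter.map P (𝓝[≥] 0) := by
    rw [hA.2, Filter.map_map]; rfl
  have hPO : P =O[𝓝[≥] 0] fun y : ℝ => y := by
    refine IsBigO.trans (IsBigO.of_bound 1 (.of_forall fun y => ?_)) (tendsto_graph (σ := σ) hφ).1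
    rw [hP, norm_toComplexPlane, one_mul]
  have hfrac : ∀ i, IsFractionalSeries fun y => (φ y : ℂ) - α i y :=
    fun i => hφ.1.ofReal.sub (hα.frac i)
  refine le_antisymm (iSup₂_le fun ζ hζ => ?_) (iSup_le fun i => ?_)
  · obtain ⟨F', hF', hζ0⟩ := hζ
    obtain ⟨C, hC, hnear⟩ := hα.near hO
    obtain ⟨pa, hpa, pb, hpb, hab⟩ := eventually_prod_iff.1 hnear
    rw [hgerm]
    have hT : {Q | pb Q ∧ F Q = 0} ∈ ζ.germ := by
      filter_upwards [hζ0, ζ.germ_le_nhds (hF.eventuallyEq hF'), ζ.germ_le_nhds hpb] with Q h1 h2 h3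
      exact ⟨h3, h2.trans h1⟩
    refine contactOrder_le_iSup_fracOrd hfrac hPO (c := (1 + C)⁻¹) (by positivity) hT ?_
    filter_upwards [hpa] with y hy
    have hone : ∀ Q ∈ {Q | pb Q ∧ F Q = 0}, ∃ i, ‖(φ y : ℂ) - α i y‖ ≤ (1 + C) * dist (P y) Q := by
      rintro Q ⟨hQ, hQ0⟩
      obtain ⟨i, hi⟩ := hab hy hQ hQ0
      refine ⟨i, ?_⟩
      rw [← hP0]
      exact norm_sub_le_dist_add hC.le (by rw [hP1]; exact hi)
    obtain ⟨i₀, -⟩ := hone 0 (ζ.zero_mem hT)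
    have : Nonempty (Fin m) := ⟨i₀⟩
    -- Each zero `Q` is matched with its own root; the root closest to `φ y` gives a bound valid for
    -- all `Q`.
    obtain ⟨i, hi⟩ := Finite.exists_min fun i => ‖(φ y : ℂ) - α i y‖
    refine ⟨i, (Metric.le_infDist ⟨0, ζ.zero_mem hT⟩).2 fun Q hQ => ?_⟩
    obtain ⟨j, hj⟩ := hone Q hQ
    rw [inv_mul_le_iff₀ (by positivity)]
    exact (hi j).trans hj
  -- The graph of a root is itself a complex zero arc, and comparing points at equal `y` bounds its
  -- distance.
  · obtain ⟨ζ, hζ⟩ := exists_arc_graph (hα.frac i) (hα.zero i)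
      (l := Complex.ofRealCLM.comp (sgn σ • ContinuousLinearMap.id ℝ ℝ))
      (by simpa using sgn_ne_zero σ)
    have hζ0 : ζ ∈ complexZeroArcs f := by
      refine ⟨F, hF, ?_⟩
      rw [hζ, eventually_map]
      exact hα.eventually_eq_zero i
    refine le_iSup₂_of_le ζ hζ0 ?_
    rw [hgerm]
    refine fracOrd_le_contactOrder (.of_forall fun y => ?_) (by rw [hφ.apply_zero, hα.zero]; simp)
      fun T hT => ?_
    · have := PiLp.norm_apply_le (P y) 1
      rw [hP1, Complex.norm_real, norm_mul, Real.norm_eq_abs (sgn σ), abs_sgn, one_mul] at this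
      exact (le_abs_self y).trans this
    · rw [hζ] at hT
      filter_upwards [hT] with y hy
      refine (Metric.infDist_le_dist_of_mem (Set.mem_preimage.1 hy)).trans (le_of_eq ?_)
      rw [EuclideanSpace.dist_eq, Fin.sum_univ_two, hP0, hP1]
      simp [dist_eq_norm]

end EnrichedLine
end

/-! ### The equivalence relations on arcs and `f`-arcs. -/

noncomputable section
namespace EnrichedLine

/-- The Newton–Puiseux roots of (the complexification `F` of) a mini-regular germ `f`. -/
structure IsRealRootSystem (f : Plane ℝ → ℝ) (F : Plane ℂ → ℂ) (σ : ℤˣ) {m : ℕ}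
    (α : Fin m → ℝ → ℂ) : Prop where
  pos : 0 < m
  complexification : IsComplexification f F
  order : analyticOrderAt (fun x : ℂ => F !₂[x, 0]) 0 = m
  roots : IsRootSystem F σ α
  isBigO : ∀ i, α i =O[𝓝[>] (0 : ℝ)] fun y : ℝ => y

theorem MiniRegular.exists_isRealRootSystem {f : Plane ℝ → ℝ} (hf : AnalyticAt ℝ f 0) (hf0 : f 0 = 0)
    (hreg : MiniRegular f) (σ : ℤˣ) :
    ∃ (F : Plane ℂ → ℂ) (m : ℕ) (α : Fin m → ℝ → ℂ), IsRealRootSystem f F σ α := by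
  obtain ⟨F, hF⟩ := exists_isComplexification hf
  obtain ⟨m, hm, hO, ho⟩ := hreg.exists_order hf hf0 hF
  obtain ⟨α, hα⟩ := exists_isRootSystem hF.1 ho σ
  exact ⟨F, m, α, hm, hF, ho, hα, fun i => hα.isBigO hF hO i⟩

section contact
variable {σ : ℤˣ} {A M N : Arc ℝ}

theorem fracOrd_sub_comm {𝕜 : Type} [RCLike 𝕜] (φ ψ : ℝ → 𝕜) :
    (fracOrd fun y => φ y - ψ y) = fracOrd fun y => ψ y - φ y :=
  fracOrd_congr_norm fun _ => norm_sub_rev _ _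

theorem fracOrd_sub_le {𝕜 : Type} [RCLike 𝕜] {φ ψ χ : ℝ → 𝕜} (hφ : IsFractionalSeries φ)
    (hψ : IsFractionalSeries ψ) (hχ : IsFractionalSeries χ) :
    min (fracOrd fun y => φ y - ψ y) (fracOrd fun y => ψ y - χ y) ≤ fracOrd fun y => φ y - χ y := by
  simpa using fracOrd_add_le (hφ.sub hψ) (hψ.sub hχ)

theorem contactOrder_self (hA : A.InHalf σ) : contactOrder A.germ A.germ = ⊤ := by
  obtain ⟨φ, hφ⟩ := hA.exists_represents
  rw [contactOrder_eq_fracOrd hφ hφ (hφ.inHalf_iff.1 hA) (hφ.inHalf_iff.1 hA),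
    fracOrd_eq_top_iff (hφ.1.sub hφ.1)]
  simp

theorem contactOrder_comm (hA : A.InHalf σ) (hM : M.InHalf σ) :
    contactOrder A.germ M.germ = contactOrder M.germ A.germ := by
  obtain ⟨φ, hφ⟩ := hA.exists_represents
  obtain ⟨ψ, hψ⟩ := hM.exists_represents
  rw [contactOrder_eq_fracOrd hφ hψ (hφ.inHalf_iff.1 hA) (hψ.inHalf_iff.1 hM),
    contactOrder_eq_fracOrd hψ hφ (hψ.inHalf_iff.1 hM) (hφ.inHalf_iff.1 hA), fracOrd_sub_comm]

theorem contactOrder_ultrametric (hA : A.InHalf σ) (hM : M.InHalf σ) (hN : N.InHalf σ) :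
    min (contactOrder A.germ M.germ) (contactOrder M.germ N.germ) ≤ contactOrder A.germ N.germ := by
  obtain ⟨φ, hφ⟩ := hA.exists_represents
  obtain ⟨ψ, hψ⟩ := hM.exists_represents
  obtain ⟨χ, hχ⟩ := hN.exists_represents
  rw [contactOrder_eq_fracOrd hφ hψ (hφ.inHalf_iff.1 hA) (hψ.inHalf_iff.1 hM),
    contactOrder_eq_fracOrd hψ hχ (hψ.inHalf_iff.1 hM) (hχ.inHalf_iff.1 hN),
    contactOrder_eq_fracOrd hφ hχ (hφ.inHalf_iff.1 hA) (hχ.inHalf_iff.1 hN)]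
  exact fracOrd_sub_le hφ.1 hψ.1 hχ.1

end contact

section classes
variable {f : Plane ℝ → ℝ} {F : Plane ℂ → ℂ} {σ : ℤˣ} {m : ℕ} {α : Fin m → ℝ → ℂ} {A M N : Arc ℝ}
  {a b : FArc f}

/-- The series of the arc and every root are `O(y)`, and there is at least one root. -/
theorem IsRealRootSystem.one_le_arcHeight (S : IsRealRootSystem f F σ α) (hA : A.InHalf σ) :
    1 ≤ arcHeight f A := by
  obtain ⟨φ, hφ⟩ := hA.exists_represents
  have hφt := hφ.inHalf_iff.1 hA
  rw [arcHeight_eq S.complexification S.roots S.isBigO hφ hφt]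
  refine le_iSup_of_le ⟨0, S.pos⟩ ?_
  have := (le_fracOrd_iff (k := 1) (hφt.1.ofReal.sub (S.roots.frac ⟨0, S.pos⟩))).2 ?_
  · simpa using this
  · simp only [NNReal.coe_one, Real.rpow_one]
    refine IsBigO.sub ?_ (S.isBigO _)
    refine IsBigO.trans (IsBigO.of_bound 1 (.of_forall fun y => ?_))
      (hφt.2.mono (nhdsWithin_mono _ Set.Ioi_subset_Ici_self))
    rw [Complex.norm_real, one_mul]

theorem FEquiv.arcHeight_eq (h : FEquiv f A M) : arcHeight f A = arcHeight f M := by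
  rcases h with rfl | h
  exacts [rfl, h.1]

theorem FEquiv.inHalf_iff (S : IsRealRootSystem f F σ α) (h : FEquiv f A M) :
    A.InHalf σ ↔ M.InHalf σ := by
  rcases h with rfl | ⟨h1, h2⟩
  · rfl
  · constructor
    · intro hA
      by_contra hM
      have h3 := S.one_le_arcHeight hA
      rw [h1] at h3
      exact absurd (h2.trans_le (contactOrder_le_one_of_inHalf hA hM).1) (not_lt.2 h3)
    · intro hM
      by_contra hA
      exact absurd (h2.trans_le (contactOrder_le_one_of_inHalf hM hA).2)
        (not_lt.2 (S.one_le_arcHeight hM))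

theorem FEquiv.symm (h : FEquiv f A M) (hA : A.InHalf σ) (hM : M.InHalf σ) : FEquiv f M A := by
  rcases h with rfl | ⟨h1, h2⟩
  · exact Or.inl rfl
  · exact Or.inr ⟨h1.symm, by rwa [h1, contactOrder_comm hM hA]⟩

theorem FEquiv.trans (h : FEquiv f A M) (h' : FEquiv f M N) (hA : A.InHalf σ) (hM : M.InHalf σ)
    (hN : N.InHalf σ) : FEquiv f A N := by
  rcases h with rfl | ⟨h1, h2⟩
  · exact h'
  · rcases h' with rfl | ⟨h3, h4⟩
    · exact Or.inr ⟨h1, h2⟩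
    · refine Or.inr ⟨h1.trans h3, (lt_min ?_ h4).trans_le (contactOrder_ultrametric hA hM hN)⟩
      rwa [← h3]

theorem FArc.height_eq (hA : A ∈ a.1) : a.height = arcHeight f A := by
  obtain ⟨s, lam, rfl⟩ := a
  have hA' : FEquiv f lam A := hA
  refine le_antisymm (iSup₂_le fun M hM => ?_) (le_iSup₂_of_le A hA le_rfl)
  have hM' : FEquiv f lam M := hM
  rw [← hA'.arcHeight_eq, hM'.arcHeight_eq]

theorem FArc.nonempty (a : FArc f) : a.1.Nonempty := by
  obtain ⟨s, lam, rfl⟩ := a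
  exact ⟨lam, Or.inl rfl⟩

theorem FArc.InHalf.of_mem (S : IsRealRootSystem f F σ α) (ha : a.InHalf σ) (hA : A ∈ a.1) :
    A.InHalf σ := by
  obtain ⟨M, hM, hMσ⟩ := ha
  obtain ⟨s, lam, rfl⟩ := a
  have hA' : FEquiv f lam A := hA
  have hM' : FEquiv f lam M := hM
  exact (hA'.inHalf_iff S).1 ((hM'.inHalf_iff S).2 hMσ)

theorem FArc.fEquiv_of_mem (S : IsRealRootSystem f F σ α) (ha : a.InHalf σ) (hA : A ∈ a.1)
    (hM : M ∈ a.1) : FEquiv f A M := by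
  have hAσ := ha.of_mem S hA
  have hMσ := ha.of_mem S hM
  obtain ⟨s, lam, rfl⟩ := a
  have hA' : FEquiv f lam A := hA
  have hM' : FEquiv f lam M := hM
  have hlσ := (hA'.inHalf_iff S).2 hAσ
  exact (hA'.symm hlσ hAσ).trans hM' hAσ hlσ hMσ

theorem FArc.eq_of_fEquiv (S : IsRealRootSystem f F σ α) (ha : a.InHalf σ) (hA : A ∈ a.1)
    (hM : M ∈ b.1) (h : FEquiv f A M) : a = b := by
  have hAσ := ha.of_mem S hA
  have hMσ := (h.inHalf_iff S).1 hAσ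
  have hclass : ∀ {c : FArc f} {N : Arc ℝ}, N ∈ c.1 → N.InHalf σ → c.1 = {K | FEquiv f N K} := by
    intro c N hN hNσ
    have hc : c.InHalf σ := ⟨N, hN, hNσ⟩
    refine Set.ext fun K => ⟨fun hK => FArc.fEquiv_of_mem S hc hN hK, fun hK => ?_⟩
    have hKσ := (FEquiv.inHalf_iff S hK).1 hNσ
    obtain ⟨s, lam, rfl⟩ := c
    have hN' : FEquiv f lam N := hN
    exact hN'.trans hK ((hN'.inHalf_iff S).2 hNσ) hNσ hKσ
  refine Subtype.ext ?_
  rw [hclass hA hAσ, hclass hM hMσ]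
  ext K
  constructor
  · intro hK
    exact (h.symm hAσ hMσ).trans hK hMσ hAσ ((FEquiv.inHalf_iff S hK).1 hAσ)
  · intro hK
    exact h.trans hK hAσ hMσ ((FEquiv.inHalf_iff S hK).1 hMσ)

theorem arcHeight_le_contactOrder (h : FEquiv f A M) (hA : A.InHalf σ) :
    arcHeight f M ≤ contactOrder A.germ M.germ := by
  rcases h with rfl | h
  · rw [contactOrder_self hA]
    exact le_top
  · exact h.2.le

/-- The contact of `f`-arcs is a supremum over representatives; the ultrametric inequality reduces
bar equivalence to a test on a single pair. The equality in `BarEquiv` becomes an inequality because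
contact above the common height means that the `f`-arcs coincide. -/
theorem barEquiv_iff (S : IsRealRootSystem f F σ α) (ha : a.InHalf σ) (hb : b.InHalf σ)
    (hA : A ∈ a.1) (hM : M ∈ b.1) :
    BarEquiv a b ↔ arcHeight f A = arcHeight f M ∧ arcHeight f M ≤ contactOrder A.germ M.germ := by
  have hAσ := ha.of_mem S hA
  have hMσ := hb.of_mem S hM
  constructor
  · rintro (rfl | ⟨h1, h2⟩)
    · have h := FArc.fEquiv_of_mem S ha hA hM
      exact ⟨h.arcHeight_eq, arcHeight_le_contactOrder h hAσ⟩
    · rw [FArc.height_eq hA, FArc.height_eq hM] at h1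
      refine ⟨h1, ?_⟩
      by_contra hlt
      rw [not_le] at hlt
      refine absurd (h2 ▸ FArc.height_eq hM ▸ hlt : contactOrder A.germ M.germ < a.contact b)
        (not_lt.2 (iSup₂_le fun A' hA' => iSup₂_le fun M' hM' => ?_))
      have hA'σ := ha.of_mem S hA'
      have hM'σ := hb.of_mem S hM'
      have h3 := arcHeight_le_contactOrder (FArc.fEquiv_of_mem S ha hA' hA) hA'σ
      have h4 := arcHeight_le_contactOrder (FArc.fEquiv_of_mem S hb hM' hM) hM'σ
      rw [h1, contactOrder_comm hA'σ hAσ] at h3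
      have h5 := contactOrder_ultrametric hAσ hA'σ hMσ
      have h6 := contactOrder_ultrametric hA'σ hM'σ hMσ
      rcases min_le_iff.1 h5 with h5 | h5
      · exact absurd (h3.trans h5) (not_le.2 hlt)
      · rcases min_le_iff.1 h6 with h6 | h6
        · exact h6.trans h5
        · exact absurd (h4.trans (h6.trans h5)) (not_le.2 hlt)
  · rintro ⟨h1, h2⟩
    by_cases hab : a = b
    · exact Or.inl hab
    · rw [BarEquiv, FArc.height_eq hA, FArc.height_eq hM]
      refine Or.inr ⟨h1, le_antisymm (h2.trans (le_iSup₂_of_le A hA (le_iSup₂_of_le M hM le_rfl)))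
        (iSup₂_le fun A' hA' => iSup₂_le fun M' hM' => ?_)⟩
      by_contra hlt
      refine hab (FArc.eq_of_fEquiv S ha hA' hM' (Or.inr ?_))
      rw [← FArc.height_eq hA', ← FArc.height_eq hM', FArc.height_eq hA, FArc.height_eq hM]
      exact ⟨h1, not_le.1 hlt⟩

theorem FBar.exists_mem (B : FBar f) : ∃ a ∈ B.carrier, a.InHalf B.sign ∧
    B.carrier = {b | b.InHalf B.sign ∧ BarEquiv a b} := by
  obtain ⟨a, ha, h⟩ := B.isClass
  exact ⟨a, h ▸ ⟨ha, Or.inl rfl⟩, ha, h⟩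

theorem FBar.height_eq (B : FBar f) (ha : a ∈ B.carrier) : B.height = a.height := by
  obtain ⟨c, -, -, h⟩ := B.exists_mem
  have hc : ∀ b ∈ B.carrier, b.height = c.height := by
    intro b hb
    rw [h] at hb
    rcases hb.2 with rfl | h
    exacts [rfl, h.1.symm]
  refine le_antisymm (iSup₂_le fun b hb => ?_) (le_iSup₂_of_le a ha le_rfl)
  rw [hc b hb, hc a ha]

end classes

end EnrichedLine
end

/-! ### The polynomial of a bar of finite height. -/

noncomputable section
namespace EnrichedLine

section series
variable {𝕜 : Type} [RCLike 𝕜]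

theorem IsFractionalSeries.isTransverse {φ : ℝ → ℝ} (hφ : IsFractionalSeries φ)
    (hO : φ =O[𝓝[>] (0 : ℝ)] fun y : ℝ => y) : IsTransverse φ := by
  have h0 : φ 0 = 0 := tendsto_nhds_unique
    (hφ.tendsto.mono_left (nhdsWithin_mono _ Set.Ioi_subset_Ici_self))
    (hO.trans_tendsto (tendsto_id.mono_left nhdsWithin_le_nhds))
  obtain ⟨C, hC⟩ := hO.bound
  exact ⟨hφ, IsBigO.of_bound C (eventually_nhdsGE_iff.2 ⟨by simp [h0], hC⟩)⟩

theorem hasLeading_iff_isLittleO_sub_add {δ p : ℝ → 𝕜} {h : ℝ} {c : 𝕜} :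
    HasLeading (fun y => δ y - p y) h c ↔
      (fun y : ℝ => δ y - (p y + c * ((y ^ h : ℝ) : 𝕜))) =o[𝓝[>] 0] fun y : ℝ => y ^ h := by
  rw [hasLeading_iff_isLittleO]
  refine iff_of_eq (congrArg (fun g => g =o[𝓝[>] 0] _) (funext fun _ => ?_))
  rw [RCLike.real_smul_eq_coe_mul]
  ring

theorem HasLeading.ofReal_sub {φ p : ℝ → ℝ} {h u : ℝ} (hl : HasLeading (fun y => φ y - p y) h u) :
    HasLeading (fun y => (φ y : ℂ) - (p y : ℂ)) h (u : ℂ) :=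
  hl.ofReal.congr (.of_forall fun _ => Complex.ofReal_sub _ _)

theorem HasLeading.of_ofReal {δ : ℝ → ℝ} {q c : ℝ} (h : HasLeading (fun y => (δ y : ℂ)) q (c : ℂ)) :
    HasLeading δ q c := by
  have := (Complex.continuous_re.tendsto (c : ℂ)).comp h
  simpa [HasLeading, Function.comp_def] using this

theorem HasLeading.unique {δ : ℝ → 𝕜} {q q' : ℝ} {c c' : 𝕜} (h : HasLeading δ q c)
    (h' : HasLeading δ q' c') (hc : c ≠ 0) (hc' : c' ≠ 0) : c = c' := by
  obtain rfl : q = q' := le_antisymm ((h'.isBigO_iff hc').1 h.isBigO) ((h.isBigO_iff hc).1 h'.isBigO)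
  exact tendsto_nhds_unique h h'

theorem hasLeading_iff_isLittleO_sub {δ : ℝ → ℝ} {q c : ℝ} : HasLeading δ q c ↔
    (fun y : ℝ => δ y - c * y ^ q) =o[𝓝[>] 0] fun y : ℝ => y ^ q := by
  rw [hasLeading_iff_isLittleO]
  simp only [smul_eq_mul, mul_comm c]

/-- Contact with `α i₀` is at least `h` since both series agree with `p` up to `O(y ^ h)`. It
exceeds `h` for some root exactly when that root has the same coefficient `u` at `y ^ h`. -/
theorem iSup_fracOrd_eq_iff {ι : Type} {α : ι → ℝ → 𝕜} {ψ p : ℝ → 𝕜}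
    (hα : ∀ i, IsFractionalSeries (α i)) (hψ : IsFractionalSeries ψ) {h : ℝ} (hh : 0 ≤ h) {u : 𝕜}
    (hu : HasLeading (fun y => ψ y - p y) h u) {i₀ : ι}
    (hi₀ : (fun y => α i₀ y - p y) =O[𝓝[>] (0 : ℝ)] fun y : ℝ => y ^ h) :
    (⨆ i, fracOrd fun y => ψ y - α i y) = ENNReal.ofReal h ↔
      ∀ i, ¬ HasLeading (fun y => α i y - p y) h u := by
  have hlow : ENNReal.ofReal h ≤ ⨆ i, fracOrd fun y => ψ y - α i y := by
    refine le_iSup_of_le i₀ ((isBigO_rpow_iff_le_fracOrd (hψ.sub (hα i₀)) hh).1 ?_)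
    refine (hu.isBigO.sub hi₀).congr_left fun y => ?_
    ring
  rw [← hlow.ge_iff_eq', iSup_le_iff]
  refine forall_congr' fun i => ?_
  rw [← not_lt, ← hasLeading_zero_iff (hψ.sub (hα i)) hh, not_iff_not]
  constructor
  · intro h0
    have := (hu.sub h0).congr (.of_forall fun y => (by ring : _ = α i y - p y))
    rwa [sub_zero] at this
  · intro h0
    have := (hu.sub h0).congr (.of_forall fun y => (by ring : _ = ψ y - α i y))
    rwa [sub_self] at this

end series

section bars
variable {f : Plane ℝ → ℝ} {B : FBar f} {p : ℚ →₀ ℝ}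

theorem IsCanonicalRep.unique {p' : ℚ →₀ ℝ} {a : FArc f} (ha : a ∈ B.carrier) {A : Arc ℝ}
    (hA : A ∈ a.1) {φ : ℝ → ℝ} (hφ : Represents B.sign A φ) (hp : IsCanonicalRep B p)
    (hp' : IsCanonicalRep B p') : p' = p := by
  refine fracEval_unique hp'.1 hp.1 ?_
  refine ((hp.2 a ha A hA φ hφ).sub (hp'.2 a ha A hA φ hφ)).congr_left fun y => ?_
  ring

/-- Along any root with coefficient `z` the function `G` vanishes, so its leading coefficient `J(z)`
does as well. Conversely, a zero of `J` comes from a member of the root system. -/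
theorem isBRoot_iff {g : Plane ℝ → ℝ} {G : Plane ℂ → ℂ} (hG : IsComplexification g G) {n : ℕ}
    {β : Fin n → ℝ → ℂ} (hβ : IsRootSystem G B.sign β) (hp : IsCanonicalRep B p)
    (huniq : ∀ p', IsCanonicalRep B p' → p' = p) (hp0 : Tendsto (fracEval p) (𝓝[>] 0) (𝓝 0))
    (hh : 0 < B.height.toReal) {J : ℂ[X]} {e : ℝ}
    (hJ : IsComplexInitialForm G B.sign (fun y => (fracEval p y : ℂ)) B.height.toReal J e)
    (hroot : ∀ z, J.eval z = 0 ↔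
      ∃ i, HasLeading (fun y => β i y - (fracEval p y : ℂ)) B.height.toReal z) (z : ℂ) :
    IsBRoot g B z ↔ J.eval z = 0 := by
  constructor
  · rintro ⟨p', hp', α, hα, ⟨G', hG', hz⟩, ho⟩
    obtain rfl := huniq p' hp'
    have hl := hasLeading_iff_isLittleO_sub_add.2 ho
    have hα0 : Tendsto α (𝓝[>] 0) (𝓝 0) := by
      have h1 := (hl.isBigO.trans_tendsto
        ((tendsto_rpow_nhdsGT hh).mono_right nhdsWithin_le_nhds)).add
        ((Complex.continuous_ofReal.tendsto 0).comp hp0)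
      simpa using h1
    have hv : Tendsto (fun y : ℝ => (!₂[α y, ((sgn B.sign * y : ℝ) : ℂ)] : Plane ℂ)) (𝓝[>] 0)
        (𝓝 0) := by
      have h1 : Tendsto (fun y : ℝ => ((sgn B.sign * y : ℝ) : ℂ)) (𝓝[>] 0) (𝓝 0) := by
        have : Continuous fun y : ℝ => ((sgn B.sign * y : ℝ) : ℂ) := by fun_prop
        exact (this.tendsto' 0 0 (by simp)).mono_left nhdsWithin_le_nhds
      refine squeeze_zero_norm (fun y => norm_vec_le _ _) ?_
      simpa using hα0.norm.add h1.norm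
    refine tendsto_nhds_unique (hJ.hasLeading hl) (tendsto_const_nhds.congr' ?_)
    filter_upwards [hv.eventually (hG.eventuallyEq hG'),
      hz.filter_mono (nhdsWithin_mono _ Set.Ioi_subset_Ici_self)] with y h1 h2
    rw [h1, h2, smul_zero]
  · intro hz
    obtain ⟨i, hi⟩ := (hroot z).1 hz
    exact ⟨p, hp, β i, hβ.frac i, ⟨G, hG, hβ.eventually_eq_zero i⟩,
      hasLeading_iff_isLittleO_sub_add.1 hi⟩

/-- The properties of the polynomial `I` of a bar of finite height. -/
structure IsBarForm (B : FBar f) (I : ℝ[X]) : Prop where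
  ne_zero : I ≠ 0
  exists_root : ∃ z : ℂ, aeval z I = 0
  initialForm : ∃ e, IsInitialForm B I e
  unique : ∀ I' e, IsInitialForm B I' e → I' = I
  exists_point : ∀ u : ℝ, I.eval u ≠ 0 → ∃ a, IsCanonicalCoord B a u ∧ IsPointOf B u a
  mem_of_point : ∀ (u : ℝ) (a : FArc f), I.eval u ≠ 0 → IsPointOf B u a → a ∈ B.carrier
  bRoot_iff : ∀ z, IsBRoot f B z ↔ aeval z I = 0
  bRoot_partialX_iff : ∀ z, IsBRoot (partialX f) B z ↔ aeval z (derivative I) = 0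

theorem eval_map_ofRealHom (I : ℝ[X]) (u : ℝ) :
    (I.map Complex.ofRealHom).eval (u : ℂ) = ((I.eval u : ℝ) : ℂ) :=
  Polynomial.eval_map_apply Complex.ofRealHom u

theorem IsRealRootSystem.exists_partialX {F : Plane ℂ → ℂ} {σ : ℤˣ} {m : ℕ} {α : Fin m → ℝ → ℂ}
    (S : IsRealRootSystem f F σ α) : ∃ (n : ℕ) (β : Fin n → ℝ → ℂ),
      IsRootSystem (fun P => deriv (fun x : ℂ => F !₂[x, P 1]) (P 0)) σ β := by
  obtain ⟨n, rfl⟩ := Nat.exists_eq_succ_of_ne_zero S.pos.ne'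
  have h0 : (!₂[(0 : ℂ), 0] : Plane ℂ) = 0 := by ext i; fin_cases i <;> rfl
  have hg : AnalyticAt ℂ (fun x : ℂ => F !₂[x, 0]) 0 :=
    AnalyticAt.comp (g := F) (f := fun x : ℂ => (!₂[x, 0] : Plane ℂ))
      (by rw [h0]; exact S.complexification.1) (analyticAt_vec analyticAt_id analyticAt_const)
  obtain ⟨β, hβ⟩ := exists_isRootSystem S.complexification.partialX.1 (n := n) (by
    simpa using analyticOrderAt_deriv_of_pos hg (n := n) (by simpa using S.order)) σ
  exact ⟨n, β, hβ⟩

/-- One arc of `B` supplies the data: its truncation below `h` is `λ_B`, and a root with which its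
contact is exactly `h` makes `I` non-constant. Arcs and roots are then compared through their
coefficients at `y ^ h`. -/
theorem exists_isBarForm (hf : AnalyticAt ℝ f 0) (hf0 : f 0 = 0) (hreg : MiniRegular f) (B : FBar f)
    (hB : B.height ≠ ⊤) : ∃ I, IsBarForm B I := by
  obtain ⟨F, m, α, S⟩ := hreg.exists_isRealRootSystem hf hf0 B.sign
  obtain ⟨a₀, ha₀, ha₀σ, hcar⟩ := B.exists_mem
  obtain ⟨A₀, hA₀⟩ := a₀.nonempty
  have hA₀σ := ha₀σ.of_mem S hA₀
  obtain ⟨φ₀, hφ₀⟩ := hA₀σ.exists_represents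
  have hφ₀t := hφ₀.inHalf_iff.1 hA₀σ
  have hheight : arcHeight f A₀ = B.height := by rw [B.height_eq ha₀, FArc.height_eq hA₀]
  set h := B.height.toReal with hdef
  have hBh : B.height = ENNReal.ofReal h := (ENNReal.ofReal_toReal hB).symm
  have hh1 : 1 ≤ h := by
    have := S.one_le_arcHeight hA₀σ
    rwa [hheight, hBh, ENNReal.one_le_ofReal] at this
  have hh : 0 < h := one_pos.trans_le hh1
  have hpow : (fun y : ℝ => y ^ h) =O[𝓝[>] 0] fun y : ℝ => y := by
    simpa using rpow_isBigO_rpow_iff.2 hh1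
  have harc : ∀ {A : Arc ℝ} {φ : ℝ → ℝ}, Represents B.sign A φ → IsTransverse φ →
      arcHeight f A = ⨆ i, fracOrd fun y => (φ y : ℂ) - α i y := fun hA hφ =>
    arcHeight_eq S.complexification S.roots S.isBigO hA hφ
  have : Nonempty (Fin m) := ⟨⟨0, S.pos⟩⟩
  obtain ⟨i₀, hi₀⟩ := exists_eq_ciSup_of_finite (f := fun i => fracOrd fun y => (φ₀ y : ℂ) - α i y)
  rw [← harc hφ₀ hφ₀t, hheight, hBh] at hi₀
  have hfrac₀ := hφ₀t.1.ofReal.sub (S.roots.frac i₀)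
  -- The height is rational, being the order of a fractional series; this is what makes `u y ^ h` an
  -- admissible term.
  obtain ⟨q, hq0, -, -, -, hq⟩ := exists_leading_of_fracOrd_ne_top hfrac₀
    (by rw [hi₀]; exact ENNReal.ofReal_ne_top)
  have hqh : (q : ℝ) = h := by
    rw [hi₀, ENNReal.ofReal_eq_ofReal_iff hh.le (by exact_mod_cast hq0)] at hq
    exact hq.symm
  obtain ⟨p, hps, hpO⟩ := hφ₀t.1.exists_truncation h
  have hpf : IsFractionalSeries (fracEval p) := isFractionalSeries_fracEval fun e he => (hps e he).1
  have hpy : fracEval p =O[𝓝[>] 0] fun y : ℝ => y :=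
    ((hφ₀t.2.mono (nhdsWithin_mono _ Set.Ioi_subset_Ici_self)).sub (hpO.trans hpow)).congr_left
      fun y => sub_sub_cancel _ _
  have hp0 : Tendsto (fracEval p) (𝓝[>] 0) (𝓝 0) :=
    hpy.trans_tendsto (tendsto_id.mono_left nhdsWithin_le_nhds)
  have hp0c : Tendsto (fun y => (fracEval p y : ℂ)) (𝓝[>] 0) (𝓝 0) := by
    simpa [Function.comp_def] using (Complex.continuous_ofReal.tendsto 0).comp hp0
  have hαp : (fun y => α i₀ y - (fracEval p y : ℂ)) =O[𝓝[>] 0] fun y : ℝ => y ^ h := by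
    have h1 := (isBigO_rpow_iff_le_fracOrd hfrac₀ hh.le).2 hi₀.ge
    have h2 : (fun y => ((φ₀ y - fracEval p y : ℝ) : ℂ)) =O[𝓝[>] 0] fun y : ℝ => y ^ h :=
      (IsBigO.of_bound 1 (.of_forall fun y => by rw [Complex.norm_real, one_mul])).trans hpO
    refine (h2.sub h1).congr_left fun y => ?_
    push_cast
    ring
  have hmem : ∀ {b : FArc f} {M : Arc ℝ} {ψ : ℝ → ℝ}, M ∈ b.1 → Represents B.sign M ψ →
      IsTransverse ψ → (b ∈ B.carrier ↔ arcHeight f M = ENNReal.ofReal h ∧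
        (fun y => ψ y - fracEval p y) =O[𝓝[>] (0 : ℝ)] fun y : ℝ => y ^ h) := by
    intro b M ψ hM hψ hψt
    have hbσ : b.InHalf B.sign := ⟨M, hM, hψ.inHalf_iff.2 hψt⟩
    rw [hcar]
    refine (and_iff_right hbσ).trans ((barEquiv_iff S ha₀σ hbσ hA₀ hM).trans ?_)
    rw [hheight, hBh, eq_comm]
    refine and_congr_right fun hM => ?_
    rw [hM, contactOrder_eq_fracOrd hφ₀ hψ hφ₀t hψt,
      ← isBigO_rpow_iff_le_fracOrd (hφ₀t.1.sub hψt.1) hh.le]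
    constructor
    · intro ho
      exact (hpO.sub ho).congr_left fun y => by ring
    · intro ho
      exact (hpO.sub ho).congr_left fun y => by ring
  have hrepr : ∀ {b : FArc f} {M : Arc ℝ} {ψ : ℝ → ℝ}, b ∈ B.carrier → M ∈ b.1 →
      Represents B.sign M ψ → IsTransverse ψ := by
    intro b M ψ hb hM hψ
    rw [hcar] at hb
    exact hψ.inHalf_iff.1 (hb.1.of_mem S hM)
  have hcan : IsCanonicalRep B p := ⟨fun e he => (hps e he).2, fun b hb M hM ψ hψ =>
    ((hmem hM hψ (hrepr hb hM hψ)).1 hb).2⟩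
  have huniq : ∀ p', IsCanonicalRep B p' → p' = p := fun p' hp' => hcan.unique ha₀ hA₀ hφ₀ hp'
  obtain ⟨J, e, hJ, hroot, -⟩ := S.roots.exists_initialForm hpf.ofReal hp0c hh
  -- The height stays at `h` exactly when no root shares the coefficient `u`.
  have hiff : ∀ {M : Arc ℝ} {ψ : ℝ → ℝ} {u : ℝ}, Represents B.sign M ψ → IsTransverse ψ →
      HasLeading (fun y => ψ y - fracEval p y) h u →
      (arcHeight f M = ENNReal.ofReal h ↔ J.eval (u : ℂ) ≠ 0) := by
    intro M ψ u hM hψ hu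
    rw [harc hM hψ, iSup_fracOrd_eq_iff S.roots.frac hψ.1.ofReal hh.le hu.ofReal_sub hαp, Ne, hroot,
      not_exists]
  have hlead : ∀ {ψ : ℝ → ℝ} {u : ℝ}, IsTransverse ψ →
      HasLeading (fun y => ψ y - fracEval p y) h u →
      HasLeading (fun y => ((f !₂[ψ y, sgn B.sign * y] : ℝ) : ℂ)) e (J.eval (u : ℂ)) := by
    intro ψ u hψ hu
    refine (hJ.hasLeading hu.ofReal_sub).congr ?_
    exact (S.complexification.eventually_graph B.sign hψ).filter_mono
      (nhdsWithin_mono _ Set.Ioi_subset_Ici_self)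
  have hpt : ∀ u : ℝ, IsTransverse (fun y => fracEval p y + u * y ^ h) ∧
      HasLeading (fun y => fracEval p y + u * y ^ h - fracEval p y) h u := by
    intro u
    refine ⟨IsFractionalSeries.isTransverse (hpf.add ?_) (hpy.add (hpow.const_mul_left u)), ?_⟩
    · rw [← hqh]
      exact isFractionalSeries_monomial u hq0
    · refine (hasLeading_monomial u h).congr (.of_forall fun y => ?_)
      simp only [smul_eq_mul]
      ring
  -- For real `u`, `J(u)` is a limit of real numbers, and the reals are closed in `ℂ`.
  obtain ⟨I, rfl⟩ := exists_real_polynomial (J := J) fun u => by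
    have := Complex.isometry_ofReal.isClosedEmbedding.isClosed_range.mem_of_tendsto (hlead (hpt u).1 (hpt u).2)
      (.of_forall fun y => ⟨(y ^ e)⁻¹ • f !₂[fracEval p y + u * y ^ h, sgn B.sign * y], by simp⟩)
    obtain ⟨v, hv⟩ := this
    exact ⟨v, hv.symm⟩
  have haeval : ∀ z : ℂ, aeval z I = (I.map Complex.ofRealHom).eval z := fun z => by
    rw [aeval_def, eval_map]; rfl
  have hI : ∀ u : ℝ, (I.map Complex.ofRealHom).eval (u : ℂ) ≠ 0 ↔ I.eval u ≠ 0 := fun u => by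
    rw [eval_map_ofRealHom, Ne, Complex.ofReal_eq_zero]
  have hI0 : I ≠ 0 := fun h0 => hJ.1 (by rw [h0, Polynomial.map_zero])
  obtain ⟨z₀, hz₀⟩ : ∃ z : ℂ, aeval z I = 0 := by
    obtain ⟨z, hz⟩ := ((S.roots.frac i₀).sub hpf.ofReal).exists_hasLeading hαp
    exact ⟨z, by rw [haeval]; exact (hroot z).2 ⟨i₀, hz⟩⟩
  have hmem_point : ∀ (u : ℝ) (a : FArc f), I.eval u ≠ 0 → IsPointOf B u a → a ∈ B.carrier := by
    rintro u a hu ⟨p', hp', M, hM, hψ⟩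
    obtain rfl := huniq p' hp'
    exact (hmem hM hψ (hpt u).1).2 ⟨(hiff hψ (hpt u).1 (hpt u).2).2 ((hI u).2 hu),
      (hpt u).2.isBigO⟩
  have hpoint : ∀ u : ℝ, I.eval u ≠ 0 → ∃ a, IsCanonicalCoord B a u ∧ IsPointOf B u a := by
    intro u hu
    obtain ⟨M, hM⟩ := (hpt u).1.exists_arc B.sign
    have hpo : IsPointOf B u ⟨{μ | FEquiv f M μ}, M, rfl⟩ := ⟨p, hcan, M, Or.inl rfl, hM⟩
    refine ⟨_, ⟨hmem_point u _ hu hpo, p, hcan, M, Or.inl rfl, _, hM, ?_⟩, hpo⟩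
    exact hasLeading_iff_isLittleO_sub_add.1 (hpt u).2
  have hinit : IsInitialForm B I e := by
    rintro a ha u ⟨-, p', hp', M, hM, ψ, hψ, ho⟩
    obtain rfl := huniq p' hp'
    have hl : HasLeading (fun y => ψ y - fracEval p' y) h u := hasLeading_iff_isLittleO_sub_add.2 ho
    have hψt := hrepr ha hM hψ
    have hMh := ((hmem hM hψ hψt).1 ha).1
    refine ⟨(hI u).1 ((hiff hψ hψt hl).1 hMh), fun N hN χ hχ => ?_⟩
    have hχt := hrepr ha hN hχ
    have haσ : a.InHalf B.sign := ⟨M, hM, hψ.inHalf_iff.2 hψt⟩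
    -- Representatives of one `f`-arc have contact greater than `h`, hence the same coefficient `u`.
    have hlt : ENNReal.ofReal h < fracOrd fun y => ψ y - χ y := by
      rw [← contactOrder_eq_fracOrd hψ hχ hψt hχt]
      rcases FArc.fEquiv_of_mem S haσ hM hN with rfl | ⟨h1, h2⟩
      · rw [contactOrder_self (hψ.inHalf_iff.2 hψt)]
        exact ENNReal.ofReal_lt_top
      · rwa [← h1, hMh] at h2
    have hl' : HasLeading (fun y => χ y - fracEval p' y) h u := by
      have := (hl.sub ((hasLeading_zero_iff (hψt.1.sub hχt.1) hh.le).2 hlt)).congr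
        (.of_forall fun y => (by ring : _ = χ y - fracEval p' y))
      rwa [sub_zero] at this
    have h1 := hlead hχt hl'
    rw [eval_map_ofRealHom] at h1
    exact hasLeading_iff_isLittleO_sub.1 h1.of_ofReal
  have hd : derivative (I.map Complex.ofRealHom) ≠ 0 := fun h0 => by
    have h1 := derivative_eq_zero.1 h0
    obtain ⟨c, hc⟩ := natDegree_eq_zero.1 h1
    rw [haeval, ← hc, eval_C] at hz₀
    exact hJ.1 (by rw [← hc, hz₀, C_0])
  obtain ⟨n, β, hβ⟩ := S.exists_partialX
  obtain ⟨J', e', hJ', hroot', -⟩ := hβ.exists_initialForm hpf.ofReal hp0c hh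
  have hJJ' : J' = derivative (I.map Complex.ofRealHom) :=
    hJ.derivative_eq S.complexification.1 hp0c hh hJ' hd
  refine ⟨I, hI0, ⟨z₀, hz₀⟩, ⟨e, hinit⟩, fun I' e₂ hI' => ?_, hpoint, hmem_point, fun z => ?_,
    fun z => ?_⟩
  -- Every real non-root `u` of `I` is the coordinate of a point of `B`, where both forms are the
  -- leading coefficient of the same function. The product thus vanishes on all of `ℝ`.
  · have hmul : I * (I' - I) = 0 := by
      refine Polynomial.funext fun u => ?_
      rw [eval_mul, eval_sub, eval_zero, mul_eq_zero, or_iff_not_imp_left]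
      intro hu
      obtain ⟨a, ha, -⟩ := hpoint u hu
      obtain ⟨M, hM⟩ := a.nonempty
      obtain ⟨ψ, hψ⟩ : ∃ ψ, Represents B.sign M ψ := by
        have := ha.1
        rw [hcar] at this
        exact (this.1.of_mem S hM).exists_represents
      obtain ⟨h1, h2⟩ := hinit a ha.1 u ha
      obtain ⟨h3, h4⟩ := hI' a ha.1 u ha
      have h5 : HasLeading (fun y : ℝ => f !₂[ψ y, sgn B.sign * y]) e (I.eval u) :=
        hasLeading_iff_isLittleO_sub.2 (h2 M hM ψ hψ)
      have h6 : HasLeading (fun y : ℝ => f !₂[ψ y, sgn B.sign * y]) e₂ (I'.eval u) :=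
        hasLeading_iff_isLittleO_sub.2 (h4 M hM ψ hψ)
      rw [h5.unique h6 h1 h3, sub_self]
    exact sub_eq_zero.1 ((mul_eq_zero.1 hmul).resolve_left hI0)
  · rw [haeval]
    exact isBRoot_iff S.complexification S.roots hcan huniq hp0 hh hJ hroot z
  · have : aeval z (derivative I) = J'.eval z := by
      rw [hJJ', derivative_map, aeval_def, eval_map]; rfl
    rw [this]
    exact isBRoot_iff S.complexification.partialX hβ hcan huniq hp0 hh hJ' hroot' z

end bars

end EnrichedLine
end

/-! ### Roots of a polynomial and its derivative, and the critical points. -/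

noncomputable section
namespace EnrichedLine

/-- A non-constant complex polynomial has at least two distinct roots iff its derivative has a root
that is not a root of the polynomial. -/
theorem exists_root_derivative_iff {J : ℂ[X]} (hJ : J.natDegree ≠ 0) :
    (∃ v, (derivative J).eval v = 0 ∧ J.eval v ≠ 0) ↔ 1 < J.roots.toFinset.card := by
  have hJ0 : J ≠ 0 := by rintro rfl; simp at hJ
  have hd0 : derivative J ≠ 0 := fun h => hJ (derivative_eq_zero.1 h)
  set s := J.roots.toFinset
  set t := (derivative J).roots.toFinset
  have hs : ∀ v, v ∈ s ↔ J.eval v = 0 := fun v => by simp [s, hJ0]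
  have ht : ∀ v, v ∈ t ↔ (derivative J).eval v = 0 := fun v => by
    simp only [t, Multiset.mem_toFinset, mem_roots hd0, IsRoot.def]
  -- Each root of `J` loses one from its multiplicity on passing to `J'`.
  have h1 : ∑ v ∈ s, (derivative J).roots.count v + s.card = J.natDegree := by
    have h2 : ∑ v ∈ s, J.roots.count v = J.natDegree := by
      rw [Multiset.toFinset_sum_count_eq, IsAlgClosed.card_roots_eq_natDegree]
    rw [← h2, Finset.card_eq_sum_ones, ← Finset.sum_add_distrib]
    refine Finset.sum_congr rfl fun v hv => ?_
    have hv' : J.IsRoot v := (hs v).1 hv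
    rw [count_roots, count_roots, derivative_rootMultiplicity_of_root hv']
    have := (rootMultiplicity_pos hJ0).2 hv'
    omega
  -- `J'` has `deg J - 1` roots in all, so those outside `s` number `s.card - 1` with multiplicity.
  have h3 : ∑ v ∈ s, (derivative J).roots.count v + ∑ v ∈ t \ s, (derivative J).roots.count v + 1 =
      J.natDegree := by
    rw [← Finset.sum_union Finset.disjoint_sdiff, Finset.union_sdiff_self_eq_union,
      Multiset.sum_count_eq_card (by
        intro a ha
        exact Finset.mem_union_right _ (Multiset.mem_toFinset.2 ha)),
      IsAlgClosed.card_roots_eq_natDegree, natDegree_derivative]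
    omega
  have h4 : 1 < s.card ↔ ∑ v ∈ t \ s, (derivative J).roots.count v ≠ 0 := by omega
  rw [h4, Ne, Finset.sum_eq_zero_iff]
  push Not
  refine exists_congr fun v => ?_
  have h5 : (derivative J).roots.count v ≠ 0 ↔ v ∈ t :=
    Multiset.count_ne_zero.trans Multiset.mem_toFinset.symm
  rw [h5, Finset.mem_sdiff, ht, hs]
  tauto

theorem exists_two_roots_iff {I : ℝ[X]} (hI : I ≠ 0) (hroot : ∃ z : ℂ, aeval z I = 0) :
    (∃ z w : ℂ, z ≠ w ∧ aeval z I = 0 ∧ aeval w I = 0) ↔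
      ∃ v : ℂ, aeval v (derivative I) = 0 ∧ aeval v I ≠ 0 := by
  set J := I.map (algebraMap ℝ ℂ)
  have hJ0 : J ≠ 0 := (Polynomial.map_ne_zero_iff (algebraMap ℝ ℂ).injective).2 hI
  have haeval : ∀ (P : ℝ[X]) (z : ℂ), aeval z P = (P.map (algebraMap ℝ ℂ)).eval z := fun P z =>
    (eval_map_algebraMap P z).symm
  have hdeg : J.natDegree ≠ 0 := fun h => by
    obtain ⟨c, hc⟩ := natDegree_eq_zero.1 h
    obtain ⟨z, hz⟩ := hroot
    rw [haeval, show I.map (algebraMap ℝ ℂ) = C c from hc.symm, eval_C] at hz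
    exact hJ0 (by rw [← hc, hz, C_0])
  simp only [haeval, ← derivative_map]
  rw [exists_root_derivative_iff hdeg, Finset.one_lt_card_iff]
  have hmem : ∀ v, v ∈ J.roots.toFinset ↔ J.eval v = 0 := fun v => by simp [hJ0]
  simp only [hmem]
  refine exists_congr fun z => exists_congr fun w => ?_
  tauto

theorem aeval_ofReal_ne_zero {I : ℝ[X]} {u : ℝ} : aeval (u : ℂ) I ≠ 0 ↔ I.eval u ≠ 0 := by
  rw [← Complex.coe_algebraMap, aeval_algebraMap_apply_eq_algebraMap_eval, Complex.coe_algebraMap,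
    Ne, Complex.ofReal_eq_zero]

section critical
variable {f : Plane ℝ → ℝ} {B : FBar f} {I : ℝ[X]} {c : FArc f}

theorem IsBarForm.isPolar (hI : IsBarForm B I) (hB : B.height ≠ ⊤)
    (h : ∃ z w : ℂ, z ≠ w ∧ aeval z I = 0 ∧ aeval w I = 0) : IsPolar B := by
  obtain ⟨e, he⟩ := hI.initialForm
  exact Or.inl ⟨hB, I, e, he, h⟩

theorem IsBarForm.isPolar_of_ordinary (hI : IsBarForm B I) (hc : IsOrdinaryCritical B c) :
    IsPolar B ∧ c ∈ B.carrier := by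
  obtain ⟨hB, u, hu, hroot⟩ := hc
  obtain ⟨e, he⟩ := hI.initialForm
  exact ⟨hI.isPolar hB ((exists_two_roots_iff hI.ne_zero hI.exists_root).2
    ⟨u, (hI.bRoot_partialX_iff u).1 hroot, aeval_ofReal_ne_zero.2 (he c hu.1 u hu).1⟩), hu.1⟩

/-- A non-real root `z` of `I'` is either off the zeros of `I`, or a zero of `I` together with its
distinct conjugate. -/
theorem IsBarForm.isPolar_of_needsGenericPoint (hI : IsBarForm B I) (hB : NeedsGenericPoint B) :
    IsPolar B := by
  obtain ⟨hB, ⟨z, hz, hroot⟩, -⟩ := hB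
  refine hI.isPolar hB ?_
  by_cases h0 : aeval z I = 0
  · refine ⟨z, starRingEnd ℂ z, fun h => hz (Complex.conj_eq_iff_im.1 h.symm), h0, ?_⟩
    rw [aeval_conj, h0, map_zero]
  · exact (exists_two_roots_iff hI.ne_zero hI.exists_root).2
      ⟨z, (hI.bRoot_partialX_iff z).1 hroot, h0⟩

theorem IsBarForm.eval_ne_zero {r : FBar f → ℝ} (hr : IsGenericChoice f r) (hI : IsBarForm B I)
    (hB : NeedsGenericPoint B) : I.eval (r B) ≠ 0 := by
  rw [← aeval_ofReal_ne_zero, Ne, ← hI.bRoot_iff]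
  exact hr B hB

theorem IsBarForm.exists_isCriticalPoint {r : FBar f → ℝ} (hr : IsGenericChoice f r)
    (hI : IsBarForm B I) (hB : B.height ≠ ⊤)
    (h : ∃ z w : ℂ, z ≠ w ∧ aeval z I = 0 ∧ aeval w I = 0) :
    ∃ c ∈ B.carrier, IsCriticalPoint r c := by
  obtain ⟨v, hv, hv0⟩ := (exists_two_roots_iff hI.ne_zero hI.exists_root).1 h
  have hroot := (hI.bRoot_partialX_iff v).2 hv
  by_cases hord : ∃ c ∈ B.carrier, IsOrdinaryCritical B c
  · obtain ⟨c, hc, ho⟩ := hord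
    exact ⟨c, hc, B, Or.inl ho⟩
  by_cases him : v.im = 0
  · obtain ⟨u, rfl⟩ : ∃ u : ℝ, (u : ℂ) = v := ⟨v.re, Complex.ext rfl him.symm⟩
    obtain ⟨c, hc, -⟩ := hI.exists_point u (aeval_ofReal_ne_zero.1 hv0)
    -- A real `v` with `I(v) ≠ 0` is the coordinate of a point of `B`, which would be an ordinary
    -- critical point.
    exact absurd ⟨c, hc.1, hB, u, hc, hroot⟩ hord
  · have hg : NeedsGenericPoint B := ⟨hB, ⟨v, him, hroot⟩, hord⟩
    obtain ⟨c, hc, hpt⟩ := hI.exists_point (r B) (hI.eval_ne_zero hr hg)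
    exact ⟨c, hc.1, B, Or.inr (Or.inr ⟨hg, hpt⟩)⟩

end critical

end EnrichedLine
end

theorem mainTheorem6 (f : EnrichedLine.Plane ℝ → ℝ) (hf : AnalyticAt ℝ f 0) (hf0 : f 0 = 0)
    (hreg : EnrichedLine.MiniRegular f)
    (r : EnrichedLine.FBar f → ℝ) (hr : EnrichedLine.IsGenericChoice f r) :
    (∀ c : EnrichedLine.FArc f, EnrichedLine.IsCriticalPoint r c →
      ∃ B : EnrichedLine.FBar f, EnrichedLine.IsPolar B ∧ c ∈ B.carrier) ∧
    (∀ B : EnrichedLine.FBar f, EnrichedLine.IsPolar B →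
      ∃ c ∈ B.carrier, EnrichedLine.IsCriticalPoint r c) := by
  refine ⟨?_, ?_⟩
  · rintro c ⟨B, hc | hc | ⟨hB, hc⟩⟩
    · obtain ⟨I, hI⟩ := EnrichedLine.exists_isBarForm hf hf0 hreg B hc.1
      exact ⟨B, hI.isPolar_of_ordinary hc⟩
    · exact ⟨B, Or.inr ⟨c, hc⟩, by rw [hc.1]; rfl⟩
    · obtain ⟨I, hI⟩ := EnrichedLine.exists_isBarForm hf hf0 hreg B hB.1
      exact ⟨B, hI.isPolar_of_needsGenericPoint hB,
        hI.mem_of_point _ _ (hI.eval_ne_zero hr hB) hc⟩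
  · rintro B (⟨hB, I', e, hI', h⟩ | ⟨c, hc⟩)
    · obtain ⟨I, hI⟩ := EnrichedLine.exists_isBarForm hf hf0 hreg B hB
      -- Polarity is stated for some initial form; uniqueness transfers its two roots to the
      -- polynomial `I` constructed here.
      rw [hI.unique I' e hI'] at h
      exact hI.exists_isCriticalPoint hr hB h
    · exact ⟨c, by rw [hc.1]; rfl, B, Or.inr (Or.inl hc)⟩
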